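/- **Theorem.** The fetch-and-add data type has eventual consensus number exactly $2$. The notions are as follows. *Model.* A data type is given by states, possible initial states, invocations, return values and a transition relation. The fetch-and-add type has state $s\in\mathbb Z$; the operation $\mathrm{fetch\_and\_add}(k)$, $k\in\mathbb Z$, returns the current $s$ and replaces it by $s+k$. The fetch-and-cons (FAC) type, over a fixed set $\alpha$ of values with at least two elements whose elements are encoded so that a Turing machine can compute with them, has as state a finite list, initially empty; the operation $\mathrm{fac}(v)$ returns the list stored before the operation and adds $v$ to its head. A history is a finite or infinite sequence of invocation and response events of processes; it is well-formed if for each process invocations and responses alternate, beginning with an invocation. *Eventual linearizability.* Let $H$ be a well-formed history. $H$ is weakly consistent if for each operation $o$, by a process $p$, that has a response in $H$ there is a legal sequential history that contains only operations invoked in $H$ before $o$ returns, contains all operations of $p$ preceding $o$, and ends with $o$ and its response in $H$. Let $H_t$ be $H$ without its first $t$ events. A $t$-linearization of $H$ is a legal sequential history $S$ such that (1) every operation in $S$ is invoked in $H$; (2) every operation completed in $H$ is completed in $S$; (3) if the response of $o_1$ precedes the invocation of $o_2$, both events are in $H_t$, and $o_2$ is in $S$, then $o_1$ precedes $o_2$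 in $S$; (4) every operation with a response in $H_t$ has the same response in $S$. $H$ is linearizable if it has a $0$-linearization, and eventually linearizable if it is weakly consistent and has a $t$-linearization for some $t\ge 0$. *Implementations.* An implementation of an $n$-process object from objects of type $T$ and registers consists of a program for each of the $n$ processes, with Turing-computable local steps and persistent local memory, and of (computable) initial states of the base objects, of which there may be finitely many or countable arrays. In an execution the steps of the processes (invocation of an implemented operation, invocation of a base object, reply of a base object, return) are interleaved arbitrarily, the history of each base object of type $T$ is eventually linearizable, and the history of each register is linearizable. The implementation is wait-free if in every execution each operation of a process that takes infinitely many steps terminates; it is eventually linearizable if in every execution the history of the implemented object is eventually linearizable. The eventual consensus number of $T$ is the largest $n$ for which an $n$-process, wait-free, eventually linearizable FAC object has an implementation from eventually linearizable objects of type $T$ and linearizable read/write registers. *Claim.* For the fetch-and-add type this largest number exists and equals $2$: eventually linearizable fetch-and-add objects and linearizable registers can wait-free implement an eventually linearizable $2$-process FAC object, and for no $n\ge 3$ can they wait-free implement an eventually linearizable $n$-process FAC object. -/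

import Mathlib

/-! ## Abstract data types -/

/-- An abstract data type: a labelled transition system with states, possible initial states,
invocations, return values and a transition relation `step s i r s'`. -/
structure ADT where
  State : Type
  init : Set State
  Inv : Type
  Resp : Type
  step : State → Inv → Resp → State → Prop

/-- Read/write registers with values in `V`. The invocation `none` is a read, `some v` is
"write `v`"; a read replies `some` of the current value, a write replies `none`. -/
abbrev registerADT (V : Type) : ADT where
  State := V
  init := Set.univ
  Inv := Option V
  Resp := Option V
  step s i r s' :=
    (i = none ∧ r = some s ∧ s' = s) ∨ (∃ v, i = some v ∧ r = none ∧ s' = v)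

/-- The fetch-and-add data type: an integer `s`; `fetch_and_add k` returns the old value `s` and
replaces it by `s + k`. -/
abbrev fetchAndAdd : ADT where
  State := ℤ
  init := Set.univ
  Inv := ℤ
  Resp := ℤ
  step s k r s' := r = s ∧ s' = s + k

/-- The fetch-and-cons data type with values in `α`: a list, initially empty; `fac v` returns the
list stored before the operation and adds `v` to its head. -/
abbrev fetchAndCons (α : Type) : ADT where
  State := List α
  init := {[]}
  Inv := α
  Resp := List α
  step L v r L' := r = L ∧ L' = v :: L

/-! ## Histories of one object -/

/-- An event at an object shared by the processes `P`: an invocation or a response. -/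
inductive Event (P I R : Type) where
  | inv (p : P) (i : I)
  | res (p : P) (r : R)

/-- The process performing an event. -/
def Event.proc {P I R : Type} : Event P I R → P
  | .inv p _ => p
  | .res p _ => p

/-- A finite or infinite history: the sequence of the events that occur at the times
`0, 1, 2, …`. At some times (possibly at all times from some time on) no event need occur, so
that a subsequence of a history is obtained by erasing events. -/
abbrev History (P I R : Type) := ℕ → Option (Event P I R)

namespace History

variable {P I R : Type} (H : History P I R)

/-- An operation is identified by the time of its invocation event: some operation of process `p`
with invocation `i` is invoked at time `k`. -/
def Invoked (k : ℕ) (p : P) (i : I) : Prop := H k = some (.inv p i)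

/-- The operation invoked at time `k` completes at time `m` with response `r`: the next event of
its process after `k` is the response `r` at time `m`. -/
def Responds (k m : ℕ) (r : R) : Prop :=
  k < m ∧ ∃ p i, H k = some (.inv p i) ∧ H m = some (.res p r) ∧
    ∀ j, k < j → j < m → ∀ e, H j = some e → e.proc ≠ p

/-- For each process, invocations and responses alternate, beginning with an invocation. -/
def WellFormed : Prop :=
  (∀ m p r, H m = some (.res p r) → ∃ k, H.Responds k m r) ∧
  (∀ k k' p i i', H.Invoked k p i → H.Invoked k' p i' → k < k' →
    ∃ m r, m < k' ∧ H.Responds k m r)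

open Classical in
/-- The event at time `k` remains when the first `t` events of the history are removed. -/
def InSuffix (t k : ℕ) : Prop := t ≤ Nat.count (fun j => (H j).isSome = true) k

end History

section Sequential

variable {P : Type} (T : ADT) (s₀ : T.State) (H : History P T.Inv T.Resp)

/-- `S` is a legal sequential history (finite or infinite, with all its operations completed)
of operations of `H`, for an object of type `T` with initial state `s₀`.
`S j = some (k, r)` means that the `j`-th place of `S` is taken by the operation of `H` invoked at
time `k`, with response `r` (which need not be its response in `H`). A place may be left empty. -/
structure IsLegalSequential (S : ℕ → Option (ℕ × T.Resp)) : Prop where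
  invoked : ∀ j k r, S j = some (k, r) → ∃ p i, H.Invoked k p i
  once : ∀ j j' k r r', S j = some (k, r) → S j' = some (k, r') → j = j'
  legal : ∃ s : ℕ → T.State, s 0 = s₀ ∧
    (∀ j, S j = none → s (j + 1) = s j) ∧
    (∀ j k r p i, S j = some (k, r) → H.Invoked k p i → T.step (s j) i r (s (j + 1)))

/-- Weak consistency: each completed operation has an explanation history `S`, which contains only
operations invoked before the operation returns, contains all earlier operations of the same
process, and ends with this operation and its response in `H`. -/
def WeaklyConsistent : Prop :=
  ∀ k m r p i, H.Invoked k p i → H.Responds k m r →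
    ∃ S, IsLegalSequential T s₀ H S ∧
      (∀ j k' r', S j = some (k', r') → k' < m) ∧
      (∀ k' i', H.Invoked k' p i' → k' < k → ∃ j r', S j = some (k', r')) ∧
      (∃ e, S e = some (k, r) ∧ ∀ j, e < j → S j = none)

/-- `S` is a `t`-linearization of `H`. -/
structure IsTLinearization (t : ℕ) (S : ℕ → Option (ℕ × T.Resp)) : Prop where
  sequential : IsLegalSequential T s₀ H S
  completed : ∀ k m r, H.Responds k m r → ∃ j r', S j = some (k, r')
  order : ∀ k₁ m₁ r₁ k₂, H.Responds k₁ m₁ r₁ → m₁ < k₂ → H.InSuffix t m₁ → H.InSuffix t k₂ →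
    ∀ j₁ j₂ a₁ a₂, S j₁ = some (k₁, a₁) → S j₂ = some (k₂, a₂) → j₁ < j₂
  response : ∀ k m r, H.Responds k m r → H.InSuffix t m → ∃ j, S j = some (k, r)

/-- `H` is `t`-linearizable. -/
def TLinearizable (t : ℕ) : Prop := ∃ S, IsTLinearization T s₀ H t S

/-- `H` is linearizable: no event is exempted. -/
def Linearizable : Prop := H.WellFormed ∧ TLinearizable T s₀ H 0

/-- `H` is eventually linearizable. -/
def EventuallyLinearizable : Prop :=
  H.WellFormed ∧ WeaklyConsistent T s₀ H ∧ ∃ t, TLinearizable T s₀ H t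

end Sequential

/-! ## Implementations -/

/-- The program of one process that performs operations of type `U`, using objects of type `T`
with names in `ι` and registers with names in `ρ` and values in `V`. `σ` is the set of states of
its local memory, which persists between operations.
* `start s a`: the local state after operation `a` is invoked in local state `s`;
* `next s`: what to do next: invoke `i` at an object (`.inl (x, i)`), invoke `i` at a register
  (`.inr (.inl (y, i))`), or end the current operation and return `v` (`.inr (.inr v)`);
* `onObj s r`, `onReg s r`: the local state after the awaited reply `r` arrives. -/
structure Program (T U : ADT) (ι ρ V σ : Type) where
  init : σ
  start : σ → U.Inv → σ
  next : σ → (ι × T.Inv) ⊕ ((ρ × Option V) ⊕ U.Resp)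
  onObj : σ → T.Resp → σ
  onReg : σ → Option V → σ

/-- The local computations of the program can be done by a Turing machine. -/
structure Program.IsComputable {T U : ADT} {ι ρ V σ : Type}
    [Primcodable T.Inv] [Primcodable T.Resp] [Primcodable U.Inv] [Primcodable U.Resp]
    [Primcodable ι] [Primcodable ρ] [Primcodable V] [Primcodable σ]
    (A : Program T U ι ρ V σ) : Prop where
  start : Computable₂ A.start
  next : Computable A.next
  onObj : Computable₂ A.onObj
  onReg : Computable₂ A.onReg

/-- What a process is doing: no operation in progress, computing within an operation, or waiting
for the reply to an invocation at a base object within an operation. -/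
inductive Phase where
  | idle
  | running
  | waiting

/-- The steps a process can make: invocation of and return from an operation of the implemented
object; invocation and reply at a base object of type `T`, or at a register. -/
inductive Act (T U : ADT) (ι ρ V : Type) where
  | invoke (a : U.Inv)
  | ret (v : U.Resp)
  | callObj (x : ι) (i : T.Inv)
  | replyObj (x : ι) (r : T.Resp)
  | callReg (y : ρ) (i : Option V)
  | replyReg (y : ρ) (r : Option V)

/-- The possible steps of a process following program `A`. The environment chooses the operations
to be invoked and the replies; otherwise the program determines the step. -/
inductive Program.Step {T U : ADT} {ι ρ V σ : Type} (A : Program T U ι ρ V σ) :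
    σ × Phase → Act T U ι ρ V → σ × Phase → Prop where
  | invoke (s : σ) (a : U.Inv) : Step A (s, .idle) (.invoke a) (A.start s a, .running)
  | ret (s : σ) (v : U.Resp) (h : A.next s = .inr (.inr v)) :
      Step A (s, .running) (.ret v) (s, .idle)
  | callObj (s : σ) (x : ι) (i : T.Inv) (h : A.next s = .inl (x, i)) :
      Step A (s, .running) (.callObj x i) (s, .waiting)
  | replyObj (s : σ) (x : ι) (i : T.Inv) (r : T.Resp) (h : A.next s = .inl (x, i)) :
      Step A (s, .waiting) (.replyObj x r) (A.onObj s r, .running)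
  | callReg (s : σ) (y : ρ) (i : Option V) (h : A.next s = .inr (.inl (y, i))) :
      Step A (s, .running) (.callReg y i) (s, .waiting)
  | replyReg (s : σ) (y : ρ) (i : Option V) (r : Option V) (h : A.next s = .inr (.inl (y, i))) :
      Step A (s, .waiting) (.replyReg y r) (A.onReg s r, .running)

/-- An implementation, for `n` processes, of an object of type `U`: a program for each process,
and the initial states of the base objects, which are objects of type `T` and registers. -/
structure Implementation (n : ℕ) (T U : ADT) (ι ρ V σ : Type) where
  prog : Fin n → Program T U ι ρ V σ
  objInit : ι → T.State
  objInit_mem : ∀ x, objInit x ∈ T.init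
  regInit : ρ → V

namespace Implementation

variable {n : ℕ} {T U : ADT} {ι ρ V σ : Type}

/-- The programs and the initialization are computable. -/
structure IsComputable [Primcodable T.State] [Primcodable T.Inv] [Primcodable T.Resp]
    [Primcodable U.Inv] [Primcodable U.Resp]
    [Primcodable ι] [Primcodable ρ] [Primcodable V] [Primcodable σ]
    (A : Implementation n T U ι ρ V σ) : Prop where
  prog : ∀ p, (A.prog p).IsComputable
  objInit : Computable A.objInit
  regInit : Computable A.regInit

/-- `e` is a finite or infinite sequence of steps of the processes, interleaved arbitrarily
(`e k = some (p, a)`: process `p` makes step `a` at time `k`), in which every process follows its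
program; the replies of the base objects are not yet constrained. -/
def IsRun (A : Implementation n T U ι ρ V σ) (e : ℕ → Option (Fin n × Act T U ι ρ V)) : Prop :=
  ∃ c : ℕ → Fin n → σ × Phase,
    (∀ p, c 0 p = ((A.prog p).init, .idle)) ∧
    (∀ k, e k = none → c (k + 1) = c k) ∧
    (∀ k p a, e k = some (p, a) →
      (A.prog p).Step (c k p) a (c (k + 1) p) ∧ ∀ q, q ≠ p → c (k + 1) q = c k q)

end Implementation

section Projections

variable {n : ℕ} {T U : ADT} {ι ρ V : Type} (e : ℕ → Option (Fin n × Act T U ι ρ V))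

/-- The history of the implemented object. -/
def implHistory : History (Fin n) U.Inv U.Resp := fun k =>
  match e k with
  | some (p, .invoke a) => some (.inv p a)
  | some (p, .ret v) => some (.res p v)
  | _ => none

open Classical in
/-- The history of the base object `x` of type `T`. -/
noncomputable def objHistory (x : ι) : History (Fin n) T.Inv T.Resp := fun k =>
  match e k with
  | some (p, .callObj x' i) => if x' = x then some (.inv p i) else none
  | some (p, .replyObj x' r) => if x' = x then some (.res p r) else none
  | _ => none

open Classical in
/-- The history of the register `y`. -/
noncomputable def regHistory (y : ρ) :
    History (Fin n) (registerADT V).Inv (registerADT V).Resp := fun k =>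
  match e k with
  | some (p, .callReg y' i) => if y' = y then some (.inv p i) else none
  | some (p, .replyReg y' r) => if y' = y then some (.res p r) else none
  | _ => none

end Projections

namespace Implementation

variable {n : ℕ} {T U : ADT} {ι ρ V σ : Type} (A : Implementation n T U ι ρ V σ)

/-- The executions of `A` in which the base objects of type `T` are eventually linearizable and
the registers are linearizable. -/
structure IsExecution (e : ℕ → Option (Fin n × Act T U ι ρ V)) : Prop where
  run : A.IsRun e
  obj : ∀ x, EventuallyLinearizable T (A.objInit x) (objHistory e x)
  reg : ∀ y, Linearizable (registerADT V) (A.regInit y) (regHistory e y)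

/-- Wait-freedom: an operation terminates after finitely many steps of its process, whatever the
other processes do. -/
def WaitFree : Prop :=
  ∀ e, A.IsExecution e → ∀ p, (∀ N, ∃ k, N ≤ k ∧ ∃ a, e k = some (p, a)) →
    ∀ k a, e k = some (p, .invoke a) → ∃ m v, k < m ∧ e m = some (p, .ret v)

/-- Every history of the implemented object, with initial state `u₀`, is eventually
linearizable. -/
def EventuallyLinearizableImpl (u₀ : U.State) : Prop :=
  ∀ e, A.IsExecution e → EventuallyLinearizable U u₀ (implHistory e)

end Implementation

/-- Eventually linearizable objects of type `T` with linearizable registers can wait-free implement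
an eventually linearizable object of type `U` shared by `n` processes. -/
def WaitFreeEventuallyImplements (n : ℕ) (T U : ADT)
    [Primcodable T.State] [Primcodable T.Inv] [Primcodable T.Resp]
    [Primcodable U.Inv] [Primcodable U.Resp] : Prop :=
  ∃ (ι ρ V σ : Type) (_ : Primcodable ι) (_ : Primcodable ρ) (_ : Primcodable V)
    (_ : Primcodable σ) (A : Implementation n T U ι ρ V σ) (u₀ : U.State),
    u₀ ∈ U.init ∧ A.IsComputable ∧ A.WaitFree ∧ A.EventuallyLinearizableImpl u₀

/-- `N` is the eventual consensus number of `T`: the largest `n` such that eventually linearizable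
objects of type `T` and linearizable registers can wait-free implement an `n`-process eventually
linearizable fetch-and-cons object (with values in `α`). -/
def IsEventualConsensusNumber (α : Type) [Primcodable α] (T : ADT)
    [Primcodable T.State] [Primcodable T.Inv] [Primcodable T.Resp] (N : ℕ) : Prop :=
  IsGreatest {n : ℕ | WaitFreeEventuallyImplements n T (fetchAndCons α)} N

/-! Impossibility for `n ≥ 3`. Executions in which every base access is atomic are admissible, so
only these are considered. Given an implementation, some finite schedule `E` is stable
(`exists_stable`): in all extensions of `E`, any two responses returned after `E` are proper
suffixes one of the other. Otherwise bad extensions could be glued into one infinite execution with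
incomparable responses arbitrarily late, against eventual linearizability. After `E` the object
solves consensus: each process keeps adding its own value and decides the entry at a fixed height
`N`, counted from the oldest entry, of its first response that is long enough. Comparability gives
agreement; wait-freedom and the distinct lengths of comparable lists give termination; a process
running alone fills the high positions with its own value, so at least two decisions are possible.
But memory effects of fetch-and-add and register steps pairwise commute or overwrite
(`atomicEff_comm`), and then a valency argument with a third process as observer excludes such a
protocol (`Valency.not_multi`).

Construction for two processes. The `j`-th operation of a process announces itself in a fresh
register, increments one shared counter, subtracts its own `j` earlier increments from the reply to
learn how many operations of the other process precede it, and reads the announcement of the last of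
these. Even before the counter stabilizes, weak consistency ensures that every increment counted has
been invoked, hence was announced (`exists_increment_of_lt_seen`, `readReply_of_stepAt`). So each
process maintains a duplicate-free log of invoked operations containing all its own, and this log
explains its response: weak consistency of the result.

Process `0` leads: its log only grows, by new operations of process `1`. Process `1` follows: when
it sees a new operation of process `0`, it adopts the log announced with it, inserting its own
missing operations just below that operation. With both processes active, the counter eventually
gives one common order of the increments; the first adoption after that discards all earlier
disagreement, and from then on the log of process `1` is a suffix of a later log of process `0`
(`eventually_followerLog`). The growing logs of process `0` then form the linearization
(`tLinearizable_of_chain`). If process `0` stops, process `1` eventually only extends its own log,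
which takes over that role. If process `1` stops, its finitely many responses are exempted. -/

set_option linter.unusedSectionVars false

/-! ## Bivalence arguments in systems whose effects commute or overwrite -/

namespace Valency

variable {n : ℕ} {L M D : Type}

/-- One step of process `p` in a system with local states `L` and shared memory `M`. -/
def next (upd : Fin n → L → M → L) (eff : Fin n → L → M → M) (C : (Fin n → L) × M) (p : Fin n) :
    (Fin n → L) × M :=
  (Function.update C.1 p (upd p (C.1 p) C.2), eff p (C.1 p) C.2)

/-- The configuration after the processes in `w` have made their steps. -/
def run (upd : Fin n → L → M → L) (eff : Fin n → L → M → M) (C : (Fin n → L) × M)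
    (w : List (Fin n)) : (Fin n → L) × M :=
  w.foldl (next upd eff) C

/-- Some process decides `d` in some extension. -/
def Val (upd : Fin n → L → M → L) (eff : Fin n → L → M → M) (dec : L → Option D)
    (C : (Fin n → L) × M) (d : D) : Prop :=
  ∃ w p, dec ((run upd eff C w).1 p) = some d

/-- Takes the place of bivalence, since the decisions range over an arbitrary type. -/
def Multi (upd : Fin n → L → M → L) (eff : Fin n → L → M → M) (dec : L → Option D)
    (C : (Fin n → L) × M) : Prop :=
  ∃ d d', d ≠ d' ∧ Val upd eff dec C d ∧ Val upd eff dec C d'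

variable {upd : Fin n → L → M → L} {eff : Fin n → L → M → M} {dec : L → Option D}

theorem run_append (C : (Fin n → L) × M) (w w' : List (Fin n)) :
    run upd eff C (w ++ w') = run upd eff (run upd eff C w) w' := by
  simp [run]

theorem run_cons (C : (Fin n → L) × M) (p : Fin n) (w : List (Fin n)) :
    run upd eff C (p :: w) = run upd eff (next upd eff C p) w := rfl

/-- A process running alone cannot distinguish configurations that differ only in the local states
of the other processes. -/
theorem run_solo (r : Fin n) (C C' : (Fin n → L) × M) (h1 : C.1 r = C'.1 r) (h2 : C.2 = C'.2)
    (k : ℕ) : (run upd eff C (List.replicate k r)).1 r = (run upd eff C' (List.replicate k r)).1 r := by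
  induction k generalizing C C' with
  | zero => exact h1
  | succ k ih =>
    rw [List.replicate_succ, run_cons, run_cons]
    apply ih <;> simp [next, h1, h2]

/-- The schedule that starts with `w` and continues with `r` forever. -/
theorem range_map_getD {β : Type} (w : List β) (r : β) (k : ℕ) :
    (List.range (w.length + k)).map (fun i => w.getD i r) = w ++ List.replicate k r := by
  apply List.ext_getElem?
  intro i
  by_cases h : i < w.length
  · simp [h, show i < w.length + k by omega]
  · by_cases h' : i < w.length + k
    · simp [h, h', not_lt.1 h]
    · simp [h']

theorem exists_infinite_fiber (f : ℕ → Fin n) : ∃ p, ∀ K, ∃ k ≥ K, f k = p := by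
  obtain ⟨p, hp⟩ := Finite.exists_infinite_fiber f
  refine ⟨p, fun K => ?_⟩
  have := Set.infinite_coe_iff.1 hp
  obtain ⟨k, hk, hK⟩ := this.exists_gt K
  exact ⟨k, hK.le, hk⟩

variable {X : (Fin n → L) × M}

/-- A path through multivalent configurations cannot go on forever, since some process occurs on it
infinitely often and decides. So there is a critical configuration, where steps of some `p ≠ q`
commit to different values. Commuting or overwriting lets the two branches reach the same memory; a
third process, whose local state is the same in both, then runs alone and decides the same value in
both. `p` and `q` themselves may learn the order from their replies, so they cannot serve as
observers. -/
theorem not_multi (hn : 3 ≤ n)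
    (comm : ∀ p q l l', (∀ m, eff p l (eff q l' m) = eff q l' (eff p l m)) ∨
      (∀ m, eff p l (eff q l' m) = eff p l m) ∨ (∀ m, eff q l' (eff p l m) = eff q l' m))
    (agree : ∀ w₁ w₂ p q d d', dec ((run upd eff X w₁).1 p) = some d →
      dec ((run upd eff X (w₁ ++ w₂)).1 q) = some d' → d = d')
    (live : ∀ (f : ℕ → Fin n) p, (∀ K, ∃ k ≥ K, f k = p) →
      ∃ K d, ∀ k ≥ K, dec ((run upd eff X ((List.range k).map f)).1 p) = some d) :
    ¬ Multi upd eff dec X := by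
  intro hX
  have solo : ∀ (w : List (Fin n)) (r : Fin n),
      ∃ k d, dec ((run upd eff X (w ++ List.replicate k r)).1 r) = some d := by
    intro w r
    obtain ⟨K, d, h⟩ := live (fun i => w.getD i r) r (fun K => ⟨K + w.length, by omega, by simp⟩)
    refine ⟨K, d, ?_⟩
    rw [← range_map_getD]
    exact h _ (by omega)
  have agreeVal : ∀ w p d d', dec ((run upd eff X w).1 p) = some d →
      Val upd eff dec (run upd eff X w) d' → d = d' := by
    rintro w p d d' h ⟨w', q, h'⟩
    rw [← run_append] at h'
    exact agree _ _ _ _ _ _ h h'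
  obtain ⟨w, hw, hcrit⟩ : ∃ w, Multi upd eff dec (run upd eff X w) ∧
      ∀ p, ¬ Multi upd eff dec (run upd eff X (w ++ [p])) := by
    by_contra! hne
    have : Nonempty (Fin n) := ⟨⟨0, by omega⟩⟩
    choose! g hg using hne
    let W : ℕ → List (Fin n) := fun k => Nat.rec [] (fun _ w => w ++ [g w]) k
    have hW : ∀ k, W (k + 1) = W k ++ [g (W k)] := fun k => rfl
    have hWr : ∀ k, W k = (List.range k).map (fun i => g (W i)) := by
      intro k
      induction k with
      | zero => rfl
      | succ k ih => rw [hW, List.range_succ, List.map_append, ← ih]; rfl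
    have hM : ∀ k, Multi upd eff dec (run upd eff X (W k)) := by
      intro k
      induction k with
      | zero => exact hX
      | succ k ih => exact hg _ ih
    obtain ⟨p, hp⟩ := exists_infinite_fiber (fun i => g (W i))
    obtain ⟨K, d, h⟩ := live _ p hp
    have h := h K le_rfl
    rw [← hWr] at h
    obtain ⟨d₁, d₂, hne, h₁, h₂⟩ := hM K
    exact hne ((agreeVal _ _ _ _ h h₁).symm.trans (agreeVal _ _ _ _ h h₂))
  set Y := run upd eff X w with hY
  obtain ⟨d, d', hne, ⟨u, p₁, hu⟩, ⟨u', p₂, hu'⟩⟩ := hw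
  cases u with
  | nil => exact hne (agreeVal w p₁ d d' hu ⟨u', p₂, hu'⟩)
  | cons p u =>
  cases u' with
  | nil => exact hne (agreeVal w p₂ d' d hu' ⟨p :: u, p₁, hu⟩).symm
  | cons q u' =>
  have hstep : ∀ p, run upd eff X (w ++ [p]) = next upd eff Y p := fun p => by
    rw [run_append]; rfl
  have huniv : ∀ p d d', Val upd eff dec (next upd eff Y p) d →
      Val upd eff dec (next upd eff Y p) d' → d = d' := by
    intro p d d' h h'
    by_contra hd
    exact hcrit p (by rw [hstep]; exact ⟨d, d', hd, h, h'⟩)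
  have hp : Val upd eff dec (next upd eff Y p) d := ⟨u, p₁, hu⟩
  have hq : Val upd eff dec (next upd eff Y q) d' := ⟨u', p₂, hu'⟩
  have hpq : p ≠ q := by
    rintro rfl
    exact hne (huniv _ _ _ hp hq)
  obtain ⟨r, hrp, hrq⟩ : ∃ r : Fin n, r ≠ p ∧ r ≠ q := by
    obtain ⟨r, hr⟩ := Finset.exists_mem_notMem_of_card_lt_card
      (s := ({p, q} : Finset (Fin n))) (t := Finset.univ)
      (lt_of_le_of_lt Finset.card_le_two (by simp; omega))
    simp at hr
    exact ⟨r, hr.1, hr.2⟩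
  -- It suffices to bring the `p`-branch and the `q`-branch to configurations that look alike to
  -- `r`.
  have key : ∀ v v' : List (Fin n),
      (run upd eff (next upd eff Y p) v).1 r = (run upd eff (next upd eff Y q) v').1 r →
      (run upd eff (next upd eff Y p) v).2 = (run upd eff (next upd eff Y q) v').2 → False := by
    intro v v' h₁ h₂
    obtain ⟨k, e, hk⟩ := solo (w ++ [p] ++ v) r
    have h := run_solo (upd := upd) (eff := eff) r _ _ h₁ h₂ k
    rw [run_append, run_append, hstep] at hk
    have e₁ : d = e := huniv _ _ _ hp ⟨v ++ List.replicate k r, r, by rw [run_append]; exact hk⟩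
    have e₂ : d' = e := huniv _ _ _ hq
      ⟨v' ++ List.replicate k r, r, by rw [run_append, ← h]; exact hk⟩
    exact hne (e₁.trans e₂.symm)
  rcases comm p q (Y.1 p) (Y.1 q) with h | h | h
  · refine key [q] [p] ?_ ?_
    · simp [run, next, Function.update_of_ne, hrp, hrq]
    · simp [run, next, Function.update_of_ne, hpq, hpq.symm, h]
  · refine key [] [p] ?_ ?_
    · simp [run, next, Function.update_of_ne, hrp, hrq]
    · simp [run, next, Function.update_of_ne, hpq, h]
  · refine key [q] [] ?_ ?_
    · simp [run, next, Function.update_of_ne, hrp, hrq]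
    · simp [run, next, Function.update_of_ne, hpq.symm, h]

end Valency

/-! ## Atomic histories -/

section Atomic

variable {P : Type} {T : ADT} {H : History P T.Inv T.Resp} {s : ℕ → T.State}

open Classical in
/-- The sequential history in which each operation takes the place of its invocation, restricted
to the operations invoked before time `b`. -/
noncomputable def atomicSequence (H : History P T.Inv T.Resp) (b : ℕ) (j : ℕ) :
    Option (ℕ × T.Resp) :=
  if j < b then
    match H j, H (j + 1) with
    | some (.inv _ _), some (.res _ r) => some (j, r)
    | _, _ => none
  else none

theorem atomicSequence_eq_some {b j k : ℕ} {r : T.Resp} :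
    atomicSequence H b j = some (k, r) ↔
      k = j ∧ j < b ∧ (∃ p i, H j = some (.inv p i)) ∧ ∃ p, H (j + 1) = some (.res p r) := by
  unfold atomicSequence
  split_ifs with h
  · split <;> simp_all
    all_goals grind
  · simp [h]

/-- In `H` every invocation is immediately followed by the response of the same process, and the
states `s` witness that the object is atomic. -/
structure IsAtomicHistory (T : ADT) (H : History P T.Inv T.Resp) (s : ℕ → T.State) : Prop where
  inv : ∀ k p i, H k = some (.inv p i) → ∃ r, H (k + 1) = some (.res p r) ∧
    T.step (s k) i r (s (k + 1))
  res : ∀ k p r, H k = some (.res p r) → ∃ j i, k = j + 1 ∧ H j = some (.inv p i)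
  idle : ∀ k, (∀ p i, H k ≠ some (.inv p i)) → s (k + 1) = s k

theorem IsAtomicHistory.responds (h : IsAtomicHistory T H s) {k m : ℕ} {r : T.Resp} :
    H.Responds k m r ↔ m = k + 1 ∧ ∃ p i, H k = some (.inv p i) ∧ H m = some (.res p r) := by
  constructor
  · rintro ⟨hkm, p, i, hk, hm, hb⟩
    refine ⟨?_, p, i, hk, hm⟩
    obtain ⟨r', hr', -⟩ := h.inv _ _ _ hk
    by_contra hne
    exact hb (k + 1) (by omega) (by omega) _ hr' rfl
  · rintro ⟨rfl, p, i, hk, hm⟩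
    exact ⟨by omega, p, i, hk, hm, fun j _ _ => by omega⟩

theorem IsAtomicHistory.wellFormed (h : IsAtomicHistory T H s) : H.WellFormed := by
  constructor
  · intro m p r hm
    obtain ⟨j, i, rfl, hj⟩ := h.res _ _ _ hm
    exact ⟨j, h.responds.2 ⟨rfl, p, i, hj, hm⟩⟩
  · intro k k' p i i' hk hk' hlt
    obtain ⟨r, hr, -⟩ := h.inv _ _ _ hk
    refine ⟨k + 1, r, ?_, h.responds.2 ⟨rfl, p, i, hk, hr⟩⟩
    rcases Nat.lt_or_ge (k + 1) k' with h' | h'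
    · exact h'
    · obtain rfl : k' = k + 1 := by omega
      rw [History.Invoked, hr] at hk'
      simp at hk'

theorem IsAtomicHistory.isLegalSequential (h : IsAtomicHistory T H s) (b : ℕ) :
    IsLegalSequential T (s 0) H (atomicSequence H b) where
  invoked j k r hj := by
    obtain ⟨rfl, -, h, -⟩ := atomicSequence_eq_some.1 hj
    exact h
  once j j' k r r' hj hj' := by
    rw [atomicSequence_eq_some] at hj hj'
    omega
  legal := by
    -- The places from `b` on are empty, so the state is frozen at `s b`.
    refine ⟨fun j => s (min j b), by simp, ?_, ?_⟩
    · intro j hj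
      by_cases hb : j < b
      · simp only [min_eq_left hb.le, min_eq_left (Nat.succ_le_of_lt hb)]
        apply h.idle
        intro p i hi
        obtain ⟨r, hr, -⟩ := h.inv _ _ _ hi
        rw [atomicSequence_eq_some.2 ⟨rfl, hb, ⟨p, i, hi⟩, p, hr⟩] at hj
        cases hj
      · simp [min_eq_right (not_lt.1 hb), min_eq_right ((not_lt.1 hb).trans (Nat.le_succ j))]
    · intro j k r p i hj hk
      obtain ⟨rfl, hb, -, p', hr⟩ := atomicSequence_eq_some.1 hj
      obtain ⟨r', hr', hs⟩ := h.inv _ _ _ hk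
      rw [hr'] at hr
      simp at hr
      obtain ⟨-, rfl⟩ := hr
      simpa only [min_eq_left hb.le, min_eq_left (Nat.succ_le_of_lt hb)] using hs

theorem IsAtomicHistory.tLinearizable (h : IsAtomicHistory T H s) :
    TLinearizable T (s 0) H 0 := by
  classical
  -- With the cutoff `j + 1` at place `j`, the bound on invocation times disappears.
  let S : ℕ → Option (ℕ × T.Resp) := fun j => atomicSequence H (j + 1) j
  have hS : ∀ j k r, S j = some (k, r) ↔
      k = j ∧ (∃ p i, H j = some (.inv p i)) ∧ ∃ p, H (j + 1) = some (.res p r) := by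
    intro j k r
    simp only [S, atomicSequence_eq_some]
    simp
  have hresp : ∀ k m r, H.Responds k m r → S k = some (k, r) := by
    intro k m r hr
    obtain ⟨rfl, p, i, hk, hm⟩ := h.responds.1 hr
    exact (hS _ _ _).2 ⟨rfl, ⟨p, i, hk⟩, p, hm⟩
  refine ⟨S, ⟨?_, ?_, ?_⟩, fun k m r hr => ⟨k, r, hresp _ _ _ hr⟩, ?_, fun k m r hr _ =>
    ⟨k, hresp _ _ _ hr⟩⟩
  · intro j k r hj
    obtain ⟨rfl, h, -⟩ := (hS _ _ _).1 hj
    exact h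
  · intro j j' k r r' hj hj'
    rw [hS] at hj hj'
    omega
  · refine ⟨s, rfl, ?_, ?_⟩
    · intro j hj
      apply h.idle
      intro p i hi
      obtain ⟨r, hr, -⟩ := h.inv _ _ _ hi
      rw [(hS _ _ _).2 ⟨rfl, ⟨p, i, hi⟩, p, hr⟩] at hj
      cases hj
    · intro j k r p i hj hk
      obtain ⟨rfl, -, p', hr⟩ := (hS _ _ _).1 hj
      obtain ⟨r', hr', hs⟩ := h.inv _ _ _ hk
      rw [hr'] at hr
      simp at hr
      obtain ⟨-, rfl⟩ := hr
      exact hs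
  · intro k₁ m₁ r₁ k₂ h₁ hlt _ _ j₁ j₂ a₁ a₂ hj₁ hj₂
    have := h.responds.1 h₁
    rw [hS] at hj₁ hj₂
    omega

theorem IsAtomicHistory.linearizable (h : IsAtomicHistory T H s) : Linearizable T (s 0) H :=
  ⟨h.wellFormed, h.tLinearizable⟩

theorem IsAtomicHistory.eventuallyLinearizable (h : IsAtomicHistory T H s) :
    EventuallyLinearizable T (s 0) H := by
  refine ⟨h.wellFormed, ?_, 0, h.tLinearizable⟩
  intro k m r p i hk hr
  obtain ⟨rfl, p', i', hk', hm⟩ := h.responds.1 hr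
  refine ⟨atomicSequence H (k + 1), h.isLegalSequential _, ?_, ?_, k, ?_, ?_⟩
  · intro j k' r' hj
    rw [atomicSequence_eq_some] at hj
    omega
  · intro k' i' hk' hlt
    obtain ⟨r', hr', -⟩ := h.inv _ _ _ hk'
    exact ⟨k', r', atomicSequence_eq_some.2 ⟨rfl, by omega, ⟨p, i', hk'⟩, p, hr'⟩⟩
  · exact atomicSequence_eq_some.2 ⟨rfl, by omega, ⟨p, i, hk⟩, p', hm⟩
  · intro j hj
    simp [atomicSequence, show ¬ j < k + 1 by omega]

end Atomic

/-! ## Executions with atomic base objects -/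

section AtomicExecution

variable {n : ℕ} {U : ADT} {ι ρ V σ : Type}

/-- The state of a process between two atomic steps: its local memory, and whether it has an
operation in progress. -/
def betweenSteps (l : σ × Bool) : σ × Phase := (l.1, if l.2 then .running else .idle)

namespace Program

variable (B : Program fetchAndAdd U ι ρ V σ) (a : U.Inv) (l : σ × Bool) (m : (ι → ℤ) × (ρ → V))

/-- The local state after an atomic step. -/
def atomicUpd : σ × Bool :=
  match l.2 with
  | false => (B.start l.1 a, true)
  | true =>
    match B.next l.1 with
    | .inl (x, _) => (B.onObj l.1 (m.1 x), true)
    | .inr (.inl (y, none)) => (B.onReg l.1 (some (m.2 y)), true)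
    | .inr (.inl (_, some _)) => (B.onReg l.1 none, true)
    | .inr (.inr _) => (l.1, false)

open Classical in
/-- The shared memory after an atomic step. -/
noncomputable def atomicEff : (ι → ℤ) × (ρ → V) :=
  match l.2 with
  | false => m
  | true =>
    match B.next l.1 with
    | .inl (x, k) => (Function.update m.1 x (m.1 x + k), m.2)
    | .inr (.inl (y, some v)) => (m.1, Function.update m.2 y v)
    | _ => m

/-- The response returned by an atomic step. -/
def atomicOut : Option U.Resp :=
  match l.2 with
  | false => none
  | true =>
    match B.next l.1 with
    | .inr (.inr r) => some r
    | _ => none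

/-- An access to a base object consists of a call immediately followed by its reply, which is
`secondAct`. An invocation or a return of the implemented object is a single event, and its second
slot stays empty. -/
def firstAct : Act fetchAndAdd U ι ρ V :=
  match l.2 with
  | false => .invoke a
  | true =>
    match B.next l.1 with
    | .inl (x, k) => .callObj x k
    | .inr (.inl (y, i)) => .callReg y i
    | .inr (.inr r) => .ret r

def secondAct : Option (Act fetchAndAdd U ι ρ V) :=
  match l.2 with
  | false => none
  | true =>
    match B.next l.1 with
    | .inl (x, _) => some (.replyObj x (m.1 x))
    | .inr (.inl (y, none)) => some (.replyReg y (some (m.2 y)))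
    | .inr (.inl (y, some _)) => some (.replyReg y none)
    | .inr (.inr _) => none

/-- The state of the process between the two parts of an atomic step. -/
def midState : σ × Phase :=
  match l.2 with
  | false => (B.start l.1 a, .running)
  | true =>
    match B.next l.1 with
    | .inl _ => (l.1, .waiting)
    | .inr (.inl _) => (l.1, .waiting)
    | .inr (.inr _) => (l.1, .idle)

theorem step_firstAct : B.Step (betweenSteps l) (B.firstAct a l) (B.midState a l) := by
  obtain ⟨s, b⟩ := l
  cases b
  · exact .invoke s a
  · unfold firstAct midState betweenSteps
    rcases h : B.next s with ⟨x, k⟩ | ⟨⟨y, i⟩ | r⟩ <;> simp only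
    · exact .callObj _ _ _ h
    · exact .callReg _ _ _ h
    · exact .ret _ _ h

theorem step_secondAct {c : Act fetchAndAdd U ι ρ V} (hc : B.secondAct l m = some c) :
    B.Step (B.midState a l) c (betweenSteps (B.atomicUpd a l m)) := by
  obtain ⟨s, b⟩ := l
  cases b
  · simp [secondAct] at hc
  · unfold secondAct at hc
    unfold atomicUpd midState betweenSteps
    rcases h : B.next s with ⟨x, k⟩ | ⟨⟨y, _ | v⟩ | r⟩ <;> simp only [h, Option.some.injEq] at hc ⊢
    · subst hc
      exact .replyObj _ _ _ _ h
    · subst hc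
      exact .replyReg _ _ _ _ h
    · subst hc
      exact .replyReg _ _ _ _ h
    · simp at hc

theorem midState_of_secondAct_eq_none (hc : B.secondAct l m = none) :
    B.midState a l = betweenSteps (B.atomicUpd a l m) := by
  obtain ⟨s, b⟩ := l
  cases b
  · rfl
  · unfold secondAct at hc
    unfold atomicUpd midState betweenSteps
    rcases h : B.next s with ⟨x, k⟩ | ⟨⟨y, _ | v⟩ | r⟩ <;> simp [h] at hc ⊢

end Program

namespace Implementation

variable (A : Implementation n fetchAndAdd U ι ρ V σ)

/-- One atomic step: the process `x.1` moves, invoking `x.2` if it is idle. -/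
noncomputable def atomicStep (C : (Fin n → σ × Bool) × ((ι → ℤ) × (ρ → V))) (x : Fin n × U.Inv) :
    (Fin n → σ × Bool) × ((ι → ℤ) × (ρ → V)) :=
  (Function.update C.1 x.1 ((A.prog x.1).atomicUpd x.2 (C.1 x.1) C.2),
    (A.prog x.1).atomicEff (C.1 x.1) C.2)

/-- The configuration after a finite schedule. -/
noncomputable def conf (w : List (Fin n × U.Inv)) : (Fin n → σ × Bool) × ((ι → ℤ) × (ρ → V)) :=
  w.foldl A.atomicStep (fun p => ((A.prog p).init, false), (A.objInit, A.regInit))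

/-- The response returned by process `p` in its next step after the schedule `w`. -/
noncomputable def outAfter (w : List (Fin n × U.Inv)) (p : Fin n) : Option U.Resp :=
  (A.prog p).atomicOut ((A.conf w).1 p)

theorem conf_concat (w : List (Fin n × U.Inv)) (x : Fin n × U.Inv) :
    A.conf (w ++ [x]) = A.atomicStep (A.conf w) x := by
  simp [conf]

noncomputable def confAt (f : ℕ → Fin n × U.Inv) (k : ℕ) :
    (Fin n → σ × Bool) × ((ι → ℤ) × (ρ → V)) :=
  A.conf ((List.range k).map f)

theorem confAt_succ (f : ℕ → Fin n × U.Inv) (k : ℕ) :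
    A.confAt f (k + 1) = A.atomicStep (A.confAt f k) (f k) := by
  simp [confAt, List.range_succ, conf]

/-- The execution with schedule `f`; the `k`-th step occupies the times `2 * k` and `2 * k + 1`. -/
noncomputable def atomicExec (f : ℕ → Fin n × U.Inv) (t : ℕ) :
    Option (Fin n × Act fetchAndAdd U ι ρ V) :=
  let k := t / 2
  let p := (f k).1
  let l := (A.confAt f k).1 p
  if t % 2 = 0 then some (p, (A.prog p).firstAct (f k).2 l)
  else ((A.prog p).secondAct l (A.confAt f k).2).map (p, ·)

theorem atomicExec_even (f : ℕ → Fin n × U.Inv) (k : ℕ) :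
    A.atomicExec f (2 * k) =
      some ((f k).1, (A.prog (f k).1).firstAct (f k).2 ((A.confAt f k).1 (f k).1)) := by
  simp [atomicExec]

theorem atomicExec_odd (f : ℕ → Fin n × U.Inv) (k : ℕ) :
    A.atomicExec f (2 * k + 1) =
      ((A.prog (f k).1).secondAct ((A.confAt f k).1 (f k).1) (A.confAt f k).2).map
        ((f k).1, ·) := by
  simp [atomicExec, show (2 * k + 1) / 2 = k by omega, Nat.add_mod]

theorem atomicExec_isRun (f : ℕ → Fin n × U.Inv) : A.IsRun (A.atomicExec f) := by
  let c : ℕ → Fin n → σ × Phase := fun t =>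
    let b := fun p => betweenSteps ((A.confAt f (t / 2)).1 p)
    let p := (f (t / 2)).1
    if t % 2 = 0 then b
    else Function.update b p ((A.prog p).midState (f (t / 2)).2 ((A.confAt f (t / 2)).1 p))
  have ce : ∀ k, c (2 * k) = fun p => betweenSteps ((A.confAt f k).1 p) := by
    intro k
    simp [c]
  have co : ∀ k, c (2 * k + 1) = Function.update (c (2 * k)) (f k).1
      ((A.prog (f k).1).midState (f k).2 ((A.confAt f k).1 (f k).1)) := by
    intro k
    simp [c, show (2 * k + 1) / 2 = k by omega, Nat.add_mod]
  have cs : ∀ k, c (2 * (k + 1)) = Function.update (c (2 * k)) (f k).1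
      (betweenSteps ((A.prog (f k).1).atomicUpd (f k).2 ((A.confAt f k).1 (f k).1)
        (A.confAt f k).2)) := by
    intro k
    rw [ce, ce, confAt_succ, atomicStep]
    funext p
    by_cases hp : p = (f k).1
    · subst hp; simp
    · simp [hp]
  refine ⟨c, ?_, ?_, ?_⟩
  · intro p
    have := ce 0
    simp only [mul_zero] at this
    simp [this, confAt, conf, betweenSteps]
  · intro t ht
    obtain ⟨k, rfl | rfl⟩ := Nat.even_or_odd' t
    · simp [atomicExec_even] at ht
    · rw [atomicExec_odd, Option.map_eq_none_iff] at ht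
      rw [show 2 * k + 1 + 1 = 2 * (k + 1) by ring, cs, co,
        Program.midState_of_secondAct_eq_none _ _ _ _ ht]
  · intro t p a ht
    obtain ⟨k, rfl | rfl⟩ := Nat.even_or_odd' t
    · rw [atomicExec_even, Option.some_inj, Prod.mk.injEq] at ht
      obtain ⟨rfl, rfl⟩ := ht
      rw [co]
      refine ⟨?_, fun q hq => by simp [hq]⟩
      rw [Function.update_self, ce]
      exact Program.step_firstAct _ _ _
    · rw [atomicExec_odd, Option.map_eq_some_iff] at ht
      obtain ⟨a', ha', h⟩ := ht
      simp only [Prod.mk.injEq] at h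
      obtain ⟨rfl, rfl⟩ := h
      rw [show 2 * k + 1 + 1 = 2 * (k + 1) by ring, cs, co]
      refine ⟨?_, fun q hq => by simp [hq]⟩
      simp only [Function.update_self]
      exact Program.step_secondAct _ _ _ _ ha'

/-- The index `(t + 1) / 2` lets step `k` take effect between its call at time `2 * k` and its reply
at `2 * k + 1`. -/
theorem atomicExec_obj (f : ℕ → Fin n × U.Inv) (x : ι) :
    IsAtomicHistory fetchAndAdd (objHistory (A.atomicExec f) x)
      (fun t => (A.confAt f ((t + 1) / 2)).2.1 x) := by
  constructor
  · intro t p i ht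
    obtain ⟨k, rfl | rfl⟩ := Nat.even_or_odd' t
    · simp only [objHistory, atomicExec_even, atomicExec_odd,
        show (2 * k + 1) / 2 = k by omega, show (2 * k + 1 + 1) / 2 = k + 1 by omega,
        confAt_succ, atomicStep] at ht ⊢
      generalize (A.confAt f k).1 (f k).1 = l at ht ⊢
      obtain ⟨s, _ | _⟩ := l
      · simp [Program.firstAct] at ht
      · rcases h : (A.prog (f k).1).next s with ⟨z, k⟩ | ⟨⟨y, _ | v⟩ | r⟩ <;>
          simp [Program.firstAct, Program.secondAct, Program.atomicEff, h] at ht ⊢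
        obtain ⟨rfl, rfl, rfl⟩ := ht
        simp
    · simp only [objHistory, atomicExec_odd] at ht
      generalize (A.confAt f k).1 (f k).1 = l at ht
      obtain ⟨s, _ | _⟩ := l
      · simp [Program.secondAct] at ht
      · rcases h : (A.prog (f k).1).next s with ⟨z, k⟩ | ⟨⟨y, _ | v⟩ | r⟩ <;>
          simp [Program.secondAct, h] at ht
  · intro t p r ht
    obtain ⟨k, rfl | rfl⟩ := Nat.even_or_odd' t
    · simp only [objHistory, atomicExec_even] at ht
      generalize (A.confAt f k).1 (f k).1 = l at ht
      obtain ⟨s, _ | _⟩ := l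
      · simp [Program.firstAct] at ht
      · rcases h : (A.prog (f k).1).next s with ⟨z, k⟩ | ⟨⟨y, _ | v⟩ | r⟩ <;>
          simp [Program.firstAct, h] at ht
    · refine ⟨2 * k, ?_⟩
      simp only [objHistory, atomicExec_odd, atomicExec_even] at ht ⊢
      generalize (A.confAt f k).1 (f k).1 = l at ht ⊢
      obtain ⟨s, _ | _⟩ := l
      · simp [Program.secondAct] at ht
      · rcases h : (A.prog (f k).1).next s with ⟨z, k⟩ | ⟨⟨y, _ | v⟩ | r⟩ <;>
          simp [Program.secondAct, Program.firstAct, h] at ht ⊢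
        tauto
  · intro t ht
    obtain ⟨k, rfl | rfl⟩ := Nat.even_or_odd' t
    · simp only [objHistory, atomicExec_even, 
        show (2 * k + 1) / 2 = k by omega, show (2 * k + 1 + 1) / 2 = k + 1 by omega,
        confAt_succ, atomicStep] at ht ⊢
      generalize (A.confAt f k).1 (f k).1 = l at ht ⊢
      obtain ⟨s, _ | _⟩ := l
      · simp [Program.atomicEff]
      · rcases h : (A.prog (f k).1).next s with ⟨z, k⟩ | ⟨⟨y, _ | v⟩ | r⟩ <;>
          simp [Program.firstAct, Program.atomicEff, h] at ht ⊢
        classical exact Function.update_of_ne (Ne.symm ht) _ _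
    · simp [show (2 * k + 1 + 1 + 1) / 2 = k + 1 by omega,
        show (2 * k + 1 + 1) / 2 = k + 1 by omega]

theorem atomicExec_reg (f : ℕ → Fin n × U.Inv) (x : ρ) :
    IsAtomicHistory (registerADT V) (regHistory (A.atomicExec f) x)
      (fun t => (A.confAt f ((t + 1) / 2)).2.2 x) := by
  constructor
  · intro t p i ht
    obtain ⟨k, rfl | rfl⟩ := Nat.even_or_odd' t
    · simp only [regHistory, atomicExec_even, atomicExec_odd,
        show (2 * k + 1) / 2 = k by omega, show (2 * k + 1 + 1) / 2 = k + 1 by omega,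
        confAt_succ, atomicStep] at ht ⊢
      generalize (A.confAt f k).1 (f k).1 = l at ht ⊢
      obtain ⟨s, _ | _⟩ := l
      · simp [Program.firstAct] at ht
      · rcases h : (A.prog (f k).1).next s with ⟨z, k⟩ | ⟨⟨y, _ | v⟩ | r⟩ <;>
          simp [Program.firstAct, Program.secondAct, Program.atomicEff, h] at ht ⊢
        all_goals
          obtain ⟨rfl, rfl, rfl⟩ := ht
          simp
    · simp only [regHistory, atomicExec_odd] at ht
      generalize (A.confAt f k).1 (f k).1 = l at ht
      obtain ⟨s, _ | _⟩ := l
      · simp [Program.secondAct] at ht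
      · rcases h : (A.prog (f k).1).next s with ⟨z, k⟩ | ⟨⟨y, _ | v⟩ | r⟩ <;>
          simp [Program.secondAct, h] at ht
  · intro t p r ht
    obtain ⟨k, rfl | rfl⟩ := Nat.even_or_odd' t
    · simp only [regHistory, atomicExec_even] at ht
      generalize (A.confAt f k).1 (f k).1 = l at ht
      obtain ⟨s, _ | _⟩ := l
      · simp [Program.firstAct] at ht
      · rcases h : (A.prog (f k).1).next s with ⟨z, k⟩ | ⟨⟨y, _ | v⟩ | r⟩ <;>
          simp [Program.firstAct, h] at ht
    · refine ⟨2 * k, ?_⟩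
      simp only [regHistory, atomicExec_odd, atomicExec_even] at ht ⊢
      generalize (A.confAt f k).1 (f k).1 = l at ht ⊢
      obtain ⟨s, _ | _⟩ := l
      · simp [Program.secondAct] at ht
      · rcases h : (A.prog (f k).1).next s with ⟨z, k⟩ | ⟨⟨y, _ | v⟩ | r⟩ <;>
          simp [Program.secondAct, Program.firstAct, h] at ht ⊢
        all_goals tauto
  · intro t ht
    obtain ⟨k, rfl | rfl⟩ := Nat.even_or_odd' t
    · simp only [regHistory, atomicExec_even, 
        show (2 * k + 1) / 2 = k by omega, show (2 * k + 1 + 1) / 2 = k + 1 by omega,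
        confAt_succ, atomicStep] at ht ⊢
      generalize (A.confAt f k).1 (f k).1 = l at ht ⊢
      obtain ⟨s, _ | _⟩ := l
      · simp [Program.atomicEff]
      · rcases h : (A.prog (f k).1).next s with ⟨z, k⟩ | ⟨⟨y, _ | v⟩ | r⟩ <;>
          simp [Program.firstAct, Program.atomicEff, h] at ht ⊢
        classical exact Function.update_of_ne (Ne.symm ht) _ _
    · simp [show (2 * k + 1 + 1 + 1) / 2 = k + 1 by omega,
        show (2 * k + 1 + 1) / 2 = k + 1 by omega]

/-- Atomic objects are in particular eventually linearizable, so the assumptions on an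
implementation apply to every schedule of atomic steps. -/
theorem atomicExec_isExecution (f : ℕ → Fin n × U.Inv) : A.IsExecution (A.atomicExec f) where
  run := A.atomicExec_isRun f
  obj x := (A.atomicExec_obj f x).eventuallyLinearizable
  reg x := (A.atomicExec_reg f x).linearizable

end Implementation

end AtomicExecution

/-! ## Responses of eventually linearizable fetch-and-cons histories -/

section FetchAndCons

variable {P : Type} {α : Type}

/-- One of the two lists is a proper suffix of the other. -/
def SuffixComparable (r₁ r₂ : List α) : Prop :=
  (r₁ <:+ r₂ ∧ r₁.length < r₂.length) ∨ (r₂ <:+ r₁ ∧ r₂.length < r₁.length)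

theorem List.IsSuffix.reverse_getElem?_eq {r₁ r₂ : List α} (h : r₁ <:+ r₂) {N : ℕ} {d d' : α}
    (h₁ : r₁.reverse[N]? = some d) (h₂ : r₂.reverse[N]? = some d') : d = d' := by
  obtain ⟨t, rfl⟩ := h
  obtain ⟨hlt, -⟩ := List.getElem?_eq_some_iff.1 h₁
  rw [List.reverse_append, List.getElem?_append_left hlt, h₁] at h₂
  exact Option.some_inj.1 h₂

theorem SuffixComparable.reverse_getElem?_eq {r₁ r₂ : List α} (h : SuffixComparable r₁ r₂) {N : ℕ}
    {d d' : α} (h₁ : r₁.reverse[N]? = some d) (h₂ : r₂.reverse[N]? = some d') : d = d' := by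
  rcases h with h | h
  · exact h.1.reverse_getElem?_eq h₁ h₂
  · exact (h.1.reverse_getElem?_eq h₂ h₁).symm

theorem IsLegalSequential.exists_states {H : History P α (List α)}
    {S : ℕ → Option (ℕ × List α)} (hS : IsLegalSequential (fetchAndCons α) [] H S) :
    ∃ s : ℕ → List α, (∀ j, S j = none → s (j + 1) = s j) ∧
      ∀ j k r, S j = some (k, r) → r = s j ∧ ∃ p v, H k = some (.inv p v) ∧ s (j + 1) = v :: s j := by
  obtain ⟨s, -, h₁, h₂⟩ := hS.legal
  refine ⟨s, h₁, fun j k r hj => ?_⟩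
  obtain ⟨p, v, hk⟩ := hS.invoked j k r hj
  obtain ⟨hr, hs⟩ := h₂ j k r p v hj hk
  exact ⟨hr, p, v, hk, hs⟩

theorem suffix_of_le_of_succ {s : ℕ → List α} (h : ∀ j, s j <:+ s (j + 1)) {i j : ℕ} (hij : i ≤ j) :
    s i <:+ s j := by
  induction j, hij using Nat.le_induction with
  | base => exact List.suffix_rfl
  | succ j _ ih => exact ih.trans (h j)

theorem History.Responds.unique {I R : Type} {H : History P I R} {k m m' : ℕ} {r r' : R}
    (h : H.Responds k m r) (h' : H.Responds k m' r') : m = m' := by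
  obtain ⟨hkm, p, i, hk, hm, hb⟩ := h
  obtain ⟨hkm', p', i', hk', hm', hb'⟩ := h'
  rw [hk] at hk'
  simp only [Option.some.injEq, Event.inv.injEq] at hk'
  obtain ⟨rfl, rfl⟩ := hk'
  by_contra hne
  rcases Nat.lt_or_gt_of_ne hne with hlt | hlt
  · exact hb' m hkm hlt _ hm rfl
  · exact hb m' hkm' hlt _ hm' rfl

open Classical in
theorem History.exists_forall_inSuffix {I R : Type} (H : History P I R) (t : ℕ) :
    ∃ K, ∀ k, K ≤ k → (H k).isSome = true → H.InSuffix t k := by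
  induction t with
  | zero => exact ⟨0, fun k _ _ => Nat.zero_le _⟩
  | succ t ih =>
    obtain ⟨K, hK⟩ := ih
    by_cases h : ∃ k, K ≤ k ∧ (H k).isSome = true
    · obtain ⟨k, hk, hs⟩ := h
      refine ⟨k + 1, fun k' hk' _ => ?_⟩
      have h₁ := hK k hk hs
      unfold History.InSuffix at h₁ ⊢
      have h₂ := Nat.count_monotone (fun j => (H j).isSome = true) hk'
      rw [Nat.count_succ, if_pos hs] at h₂
      omega
    -- No event occurs from `K` on, and the claim is vacuous.
    · exact ⟨K, fun k hk hs => absurd ⟨k, hk, hs⟩ h⟩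

/-- The late responses of an eventually linearizable history are the states at distinct places of
a legal sequential history. -/
theorem EventuallyLinearizable.late_responses {H : History P α (List α)}
    (hH : EventuallyLinearizable (fetchAndCons α) [] H) :
    ∃ S, IsLegalSequential (fetchAndCons α) [] H S ∧ ∃ K, ∀ m p r, K ≤ m → H m = some (.res p r) →
      ∃ k, H.Responds k m r ∧ ∃ j, S j = some (k, r) := by
  obtain ⟨hw, -, t, S, hS⟩ := hH
  obtain ⟨K, hK⟩ := H.exists_forall_inSuffix t
  refine ⟨S, hS.sequential, K, fun m p r hm h => ?_⟩
  obtain ⟨k, hk⟩ := hw.1 m p r h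
  exact ⟨k, hk, hS.response k m r hk (hK m hm (by simp [h]))⟩

/-- Late responses are states at distinct places of one legal sequence, and every occupied place
lengthens the state at its head. -/
theorem EventuallyLinearizable.suffixComparable {H : History P α (List α)}
    (hH : EventuallyLinearizable (fetchAndCons α) [] H) :
    ∃ K, ∀ m₁ m₂ p₁ p₂ r₁ r₂, K ≤ m₁ → K ≤ m₂ → m₁ ≠ m₂ → H m₁ = some (.res p₁ r₁) →
      H m₂ = some (.res p₂ r₂) → SuffixComparable r₁ r₂ := by
  obtain ⟨S, hS, K, hK⟩ := hH.late_responses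
  obtain ⟨s, hs₁, hs₂⟩ := hS.exists_states
  have hsuf : ∀ j, s j <:+ s (j + 1) := by
    intro j
    rcases h : S j with _ | ⟨k, r⟩
    · rw [hs₁ j h]
    · obtain ⟨-, p, v, -, h'⟩ := hs₂ j k r h
      rw [h']
      exact List.suffix_cons _ _
  have hlt : ∀ i j k r, S i = some (k, r) → i < j → s i <:+ s j ∧ (s i).length < (s j).length := by
    intro i j k r hi hij
    refine ⟨suffix_of_le_of_succ hsuf hij.le, ?_⟩
    obtain ⟨-, p, v, -, h'⟩ := hs₂ i k r hi
    have := (suffix_of_le_of_succ hsuf (Nat.succ_le_of_lt hij)).length_le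
    rw [Nat.succ_eq_add_one, h', List.length_cons] at this
    omega
  refine ⟨K, fun m₁ m₂ p₁ p₂ r₁ r₂ h₁ h₂ hne hm₁ hm₂ => ?_⟩
  obtain ⟨k₁, hk₁, j₁, hj₁⟩ := hK _ _ _ h₁ hm₁
  obtain ⟨k₂, hk₂, j₂, hj₂⟩ := hK _ _ _ h₂ hm₂
  have hj : j₁ ≠ j₂ := by
    rintro rfl
    rw [hj₁] at hj₂
    simp only [Option.some.injEq, Prod.mk.injEq] at hj₂
    obtain ⟨rfl, rfl⟩ := hj₂
    exact hne (hk₁.unique hk₂)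
  rw [(hs₂ _ _ _ hj₁).1, (hs₂ _ _ _ hj₂).1]
  rcases Nat.lt_or_gt_of_ne hj with h | h
  · exact Or.inl (hlt _ _ _ _ hj₁ h)
  · exact Or.inr (hlt _ _ _ _ hj₂ h)

/-- If from some time on only `u` is added, then the lists returned late contain only `u` above
some height. -/
theorem EventuallyLinearizable.eventually_constant {H : History P α (List α)}
    (hH : EventuallyLinearizable (fetchAndCons α) [] H) {K₀ : ℕ} {u : α}
    (hu : ∀ k p v, K₀ ≤ k → H k = some (.inv p v) → v = u) :
    ∃ N₀ K, ∀ m p r N, K ≤ m → H m = some (.res p r) → N₀ ≤ N → N < r.length →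
      r.reverse[N]? = some u := by
  obtain ⟨S, hS, K, hK⟩ := hH.late_responses
  obtain ⟨s, hs₁, hs₂⟩ := hS.exists_states
  -- An operation occupies at most one place, so the finitely many operations invoked before `K₀`
  -- all lie below some place `J`; beyond it only `u` is pushed.
  obtain ⟨J, hJ⟩ : ∃ J, ∀ j k r, J ≤ j → S j = some (k, r) → K₀ ≤ k := by
    clear hu
    induction K₀ with
    | zero => exact ⟨0, fun _ _ _ _ _ => Nat.zero_le _⟩
    | succ b ih =>
      obtain ⟨J, hJ⟩ := ih
      by_cases h : ∃ j r, S j = some (b, r)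
      · obtain ⟨j₀, r₀, h₀⟩ := h
        refine ⟨max J (j₀ + 1), fun j k r hj hS' => ?_⟩
        have h₁ := hJ j k r (by omega) hS'
        rcases Nat.lt_or_eq_of_le h₁ with h₂ | rfl
        · exact h₂
        · have := hS.once _ _ _ _ _ h₀ hS'
          omega
      · refine ⟨J, fun j k r hj hS' => ?_⟩
        have h₁ := hJ j k r hj hS'
        rcases Nat.lt_or_eq_of_le h₁ with h₂ | rfl
        · exact h₂
        · exact absurd ⟨j, r, hS'⟩ h
  have hrep : ∀ i, ∃ c, s (J + i) = List.replicate c u ++ s J := by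
    intro i
    induction i with
    | zero => exact ⟨0, by simp⟩
    | succ i ih =>
      obtain ⟨c, hc⟩ := ih
      rcases h : S (J + i) with _ | ⟨k, r⟩
      · exact ⟨c, by rw [← hc, ← hs₁ _ h]; rfl⟩
      · obtain ⟨-, p, v, hk, h'⟩ := hs₂ _ _ _ h
        have := hu k p v (hJ _ _ _ (by omega) h) hk
        subst this
        exact ⟨c + 1, by rw [← add_assoc, h', hc, List.replicate_succ, List.cons_append]⟩
  have hle : ∀ j, (s j).length ≤ (s (j + 1)).length := by
    intro j
    rcases h : S j with _ | ⟨k, r⟩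
    · rw [hs₁ j h]
    · obtain ⟨-, p, v, -, h'⟩ := hs₂ j k r h
      simp [h']
  refine ⟨(s J).length, K, fun m p r N hm hr hN hlt => ?_⟩
  obtain ⟨k, -, j, hj⟩ := hK m p r hm hr
  rw [(hs₂ _ _ _ hj).1] at hlt ⊢
  rcases Nat.lt_or_ge j J with h | h
  · have : (s j).length ≤ (s J).length := monotone_nat_of_le_succ hle h.le
    omega
  · obtain ⟨i, rfl⟩ := Nat.exists_eq_add_of_le h
    obtain ⟨c, hc⟩ := hrep i
    rw [hc] at hlt ⊢
    rw [List.length_append, List.length_replicate] at hlt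
    rw [List.reverse_append, List.getElem?_append_right (by simpa using hN),
      List.reverse_replicate, List.getElem?_replicate_of_lt (by simp; omega)]

end FetchAndCons

/-! ### Responses in atomic executions -/

namespace Implementation

section Outputs

variable {n : ℕ} {U : ADT} {ι ρ V σ : Type} (A : Implementation n fetchAndAdd U ι ρ V σ)

theorem implHistory_of_outAfter {f : ℕ → Fin n × U.Inv} {k : ℕ} {r : U.Resp}
    (h : A.outAfter ((List.range k).map f) (f k).1 = some r) :
    implHistory (A.atomicExec f) (2 * k) = some (.res (f k).1 r) := by
  unfold outAfter at h
  simp only [implHistory, atomicExec_even, confAt]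
  generalize (A.conf ((List.range k).map f)).1 (f k).1 = l at h ⊢
  obtain ⟨s, _ | _⟩ := l
  · simp [Program.atomicOut] at h
  · rcases h' : (A.prog (f k).1).next s with ⟨z, k⟩ | ⟨⟨y, _ | v⟩ | r⟩ <;>
      simp [Program.atomicOut, Program.firstAct, h'] at h ⊢
    exact h

theorem implHistory_inv {f : ℕ → Fin n × U.Inv} {t : ℕ} {p : Fin n} {v : U.Inv}
    (h : implHistory (A.atomicExec f) t = some (.inv p v)) : v = (f (t / 2)).2 := by
  obtain ⟨k, rfl | rfl⟩ := Nat.even_or_odd' t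
  · simp only [implHistory, atomicExec_even] at h
    generalize (A.confAt f k).1 (f k).1 = l at h
    obtain ⟨s, _ | _⟩ := l
    · simp [Program.firstAct] at h
      simp [h.2]
    · rcases h' : (A.prog (f k).1).next s with ⟨z, k⟩ | ⟨⟨y, _ | v⟩ | r⟩ <;>
        simp [Program.firstAct, h'] at h
  · simp only [implHistory, atomicExec_odd] at h
    generalize (A.confAt f k).1 (f k).1 = l at h
    obtain ⟨s, _ | _⟩ := l
    · simp [Program.secondAct] at h
    · rcases h' : (A.prog (f k).1).next s with ⟨z, k⟩ | ⟨⟨y, _ | v⟩ | r⟩ <;>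
        simp [Program.secondAct, h'] at h

/-- Locates the invocation of the operation in progress, to which wait-freedom can then be applied.
-/
theorem exists_invoke_of_busy (f : ℕ → Fin n × U.Inv) (p : Fin n) (k : ℕ)
    (h : ((A.confAt f k).1 p).2 = true) :
    ∃ k₁ < k, (∃ v, A.atomicExec f (2 * k₁) = some (p, .invoke v)) ∧
      ∀ k₂, k₁ < k₂ → k₂ < k → (f k₂).1 = p → A.outAfter ((List.range k₂).map f) p = none := by
  induction k with
  | zero => simp [confAt, conf] at h
  | succ k ih =>
    rw [confAt_succ, atomicStep] at h
    by_cases hp : (f k).1 = p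
    · by_cases hb : ((A.confAt f k).1 p).2 = true
      · obtain ⟨k₁, h₁, hv, h₂⟩ := ih hb
        refine ⟨k₁, by omega, hv, fun k₂ hlt hlt' hk₂ => ?_⟩
        rcases Nat.lt_or_eq_of_le (Nat.le_of_lt_succ hlt') with h₃ | rfl
        · exact h₂ _ hlt h₃ hk₂
        · subst hp
          simp only [Function.update_self] at h
          change Program.atomicOut _ ((A.confAt f k₂).1 (f k₂).1) = none
          generalize (A.confAt f k₂).1 (f k₂).1 = l at *
          obtain ⟨s, _ | _⟩ := l
          · simp at hb
          · rcases h' : (A.prog (f k₂).1).next s with ⟨z, k⟩ | ⟨⟨y, _ | v⟩ | r⟩ <;>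
              simp [Program.atomicOut, Program.atomicUpd, h'] at h ⊢
      · refine ⟨k, by omega, ⟨(f k).2, ?_⟩, fun k₂ _ _ _ => by omega⟩
        rw [atomicExec_even, hp]
        simp only [Bool.not_eq_true] at hb
        simp [Program.firstAct, hb]
    · simp only [Function.update_of_ne (Ne.symm hp)] at h
      obtain ⟨k₁, h₁, hv, h₂⟩ := ih h
      refine ⟨k₁, by omega, hv, fun k₂ hlt hlt' hk₂ => ?_⟩
      rcases Nat.lt_or_eq_of_le (Nat.le_of_lt_succ hlt') with h₃ | rfl
      · exact h₂ _ hlt h₃ hk₂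
      · exact absurd hk₂ hp

theorem outAfter_of_ret {f : ℕ → Fin n × U.Inv} {t : ℕ} {p : Fin n} {r : U.Resp}
    (h : A.atomicExec f t = some (p, .ret r)) :
    ∃ k, t = 2 * k ∧ (f k).1 = p ∧ A.outAfter ((List.range k).map f) p = some r := by
  obtain ⟨k, rfl | rfl⟩ := Nat.even_or_odd' t
  · refine ⟨k, rfl, ?_⟩
    rw [atomicExec_even, Option.some_inj, Prod.mk.injEq] at h
    obtain ⟨rfl, h⟩ := h
    refine ⟨rfl, ?_⟩
    change Program.atomicOut _ ((A.confAt f k).1 (f k).1) = some r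
    generalize (A.confAt f k).1 (f k).1 = l at h ⊢
    obtain ⟨s, _ | _⟩ := l
    · simp [Program.firstAct] at h
    · rcases h' : (A.prog (f k).1).next s with ⟨z, k⟩ | ⟨⟨y, _ | v⟩ | r⟩ <;>
        simp [Program.atomicOut, Program.firstAct, h'] at h ⊢
      exact h
  · rw [atomicExec_odd] at h
    generalize (A.confAt f k).1 (f k).1 = l at h
    obtain ⟨s, _ | _⟩ := l
    · simp [Program.secondAct] at h
    · rcases h' : (A.prog (f k).1).next s with ⟨z, k⟩ | ⟨⟨y, _ | v⟩ | r⟩ <;>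
        simp [Program.secondAct, h'] at h

/-- If no response came from `K` on, then after its next step `p` would be inside an operation,
whose return exists by wait-freedom and comes too late to be avoided. -/
theorem WaitFree.exists_output (hA : A.WaitFree) (f : ℕ → Fin n × U.Inv) (p : Fin n)
    (hp : ∀ K, ∃ k ≥ K, (f k).1 = p) (K : ℕ) :
    ∃ k ≥ K, (f k).1 = p ∧ ∃ r, A.outAfter ((List.range k).map f) p = some r := by
  by_contra! hno
  obtain ⟨k₀, hk₀, hf⟩ := hp K
  have hout : A.outAfter ((List.range k₀).map f) p = none :=
    Option.eq_none_iff_forall_ne_some.2 (hno k₀ hk₀ hf)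
  have hbusy : ((A.confAt f (k₀ + 1)).1 p).2 = true := by
    rw [confAt_succ, atomicStep]
    subst hf
    simp only [Function.update_self]
    change Program.atomicOut _ ((A.confAt f k₀).1 (f k₀).1) = none at hout
    generalize (A.confAt f k₀).1 (f k₀).1 = l at *
    obtain ⟨s, _ | _⟩ := l
    · simp [Program.atomicUpd]
    · rcases h' : (A.prog (f k₀).1).next s with ⟨z, k⟩ | ⟨⟨y, _ | v⟩ | r⟩ <;>
        simp [Program.atomicOut, Program.atomicUpd, h'] at hout ⊢
  obtain ⟨k₁, hk₁, ⟨v, hv⟩, hn⟩ := A.exists_invoke_of_busy f p _ hbusy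
  obtain ⟨m, r, hm, hr⟩ := hA _ (A.atomicExec_isExecution f) p (fun N => by
    obtain ⟨k, hk, hkp⟩ := hp N
    exact ⟨2 * k, by omega, _, by rw [atomicExec_even, hkp]⟩) _ _ hv
  obtain ⟨k₂, rfl, hp₂, ho⟩ := A.outAfter_of_ret hr
  -- A return before `K` would lie between the invocation and the step `k₀`, where the operation is
  -- still in progress.
  rcases Nat.lt_or_ge k₂ K with h | h
  · have := hn k₂ (by omega) (by omega) hp₂
    rw [this] at ho
    cases ho
  · exact hno k₂ h hp₂ r ho

end Outputs

end Implementation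

/-! ## No eventually linearizable fetch-and-cons object for three processes -/

namespace Implementation

variable {n : ℕ} {α ι ρ V σ : Type} (A : Implementation n fetchAndAdd (fetchAndCons α) ι ρ V σ)

/-- In all extensions of the schedule `E`, the responses returned after `E` are comparable. -/
def Stable (E : List (Fin n × α)) : Prop :=
  ∀ (W : List (Fin n × α)) i j x y r₁ r₂, i < j → W[i]? = some x → W[j]? = some y →
    A.outAfter (E ++ W.take i) x.1 = some r₁ → A.outAfter (E ++ W.take j) y.1 = some r₂ →
    SuffixComparable r₁ r₂

/-- If every schedule had an extension producing an incomparable pair, iterating these extensions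
would give an infinite execution with incomparable pairs arbitrarily late, contradicting
`suffixComparable`. -/
theorem exists_stable [NeZero n] [Inhabited α] (hA : A.EventuallyLinearizableImpl []) :
    ∃ E, A.Stable E := by
  by_contra! hno
  have hext : ∀ E : List (Fin n × α), ∃ W : List (Fin n × α), ∃ i j x y r₁ r₂, i < j ∧
      W[i]? = some x ∧ W[j]? = some y ∧ A.outAfter (E ++ W.take i) x.1 = some r₁ ∧
      A.outAfter (E ++ W.take j) y.1 = some r₂ ∧ ¬ SuffixComparable r₁ r₂ := by
    intro E
    have := hno E
    unfold Stable at this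
    push Not at this
    exact this
  choose G hG using hext
  let E : ℕ → List (Fin n × α) := fun k => Nat.rec [] (fun _ E => E ++ G E) k
  have hE : ∀ k, E (k + 1) = E k ++ G (E k) := fun _ => rfl
  have hlen : ∀ k, k ≤ (E k).length := by
    intro k
    induction k with
    | zero => simp
    | succ k ih =>
      obtain ⟨i, j, x, y, r₁, r₂, hij, hx, -⟩ := hG (E k)
      have := (List.getElem?_eq_some_iff.1 hx).1
      rw [hE, List.length_append]
      omega
  have hpre : ∀ k l, k ≤ l → E k <+: E l := by
    intro k l hkl
    induction l, hkl using Nat.le_induction with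
    | base => exact List.prefix_rfl
    | succ l _ ih => exact ih.trans (List.prefix_append _ _)
  -- `E (i + 1)` has length greater than `i`, so the default value is never taken, and `f` is the
  -- common limit of the prefixes `E k`.
  let f : ℕ → Fin n × α := fun i => (E (i + 1)).getD i default
  have hf : ∀ k i, i < (E k).length → (E k)[i]? = some (f i) := by
    intro k i hi
    have hi' : i < (E (i + 1)).length := hlen (i + 1)
    have : (E (i + 1))[i]? = some (f i) := by simp [f, hi']
    rcases le_total k (i + 1) with h | h
    · obtain ⟨t, ht⟩ := hpre _ _ h
      rw [← this, ← ht, List.getElem?_append_left hi]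
    · obtain ⟨t, ht⟩ := hpre _ _ h
      rw [← ht, List.getElem?_append_left hi', this]
  have hfE : ∀ k i, i ≤ (E k).length → (List.range i).map f = (E k).take i := by
    intro k i hi
    apply List.ext_getElem?
    intro j
    by_cases hj : j < i
    · simp [hj, ← hf k j (by omega)]
    · simp [hj]
  obtain ⟨K, hK⟩ := (hA _ (A.atomicExec_isExecution f)).suffixComparable
  obtain ⟨i, j, x, y, r₁, r₂, hij, hx, hy, h₁, h₂, hc⟩ := hG (E K)
  have hj := (List.getElem?_eq_some_iff.1 hy).1
  have out : ∀ i z r, (G (E K))[i]? = some z →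
      A.outAfter (E K ++ (G (E K)).take i) z.1 = some r →
      implHistory (A.atomicExec f) (2 * ((E K).length + i)) =
        some (.res (f ((E K).length + i)).1 r) := by
    intro i z r hz hr
    have hi := (List.getElem?_eq_some_iff.1 hz).1
    have hz' : f ((E K).length + i) = z := by
      have := hf (K + 1) ((E K).length + i) (by rw [hE, List.length_append]; omega)
      rw [hE, List.getElem?_append_right (by omega), Nat.add_sub_cancel_left, hz] at this
      exact (Option.some_inj.1 this).symm
    apply A.implHistory_of_outAfter
    rw [hz', hfE (K + 1) _ (by rw [hE, List.length_append]; omega), hE, List.take_length_add_append]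
    exact hr
  have hl := hlen K
  exact hc (hK _ _ _ _ _ _ (by omega) (by omega) (by omega) (out i x r₁ hx h₁) (out j y r₂ hy h₂))

variable {A}

/-- Reversal counts heights from the oldest entry, and there comparable lists agree wherever both
are defined. This is the agreement property of the consensus protocol. -/
theorem Stable.entry_unique {E W : List (Fin n × α)} (hE : A.Stable E) {N i j : ℕ}
    {x y : Fin n × α} {r₁ r₂ : List α} {d d' : α} (hx : W[i]? = some x) (hy : W[j]? = some y)
    (h₁ : A.outAfter (E ++ W.take i) x.1 = some r₁)
    (h₂ : A.outAfter (E ++ W.take j) y.1 = some r₂)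
    (hd : r₁.reverse[N]? = some d) (hd' : r₂.reverse[N]? = some d') : d = d' := by
  rcases lt_trichotomy i j with h | rfl | h
  · exact (hE W i j x y r₁ r₂ h hx hy h₁ h₂).reverse_getElem?_eq hd hd'
  · rw [hx, Option.some_inj] at hy
    subst hy
    rw [h₁, Option.some_inj] at h₂
    subst h₂
    rw [hd] at hd'
    exact Option.some_inj.1 hd'
  · exact ((hE W j i y x r₂ r₁ h hy hx h₂ h₁).reverse_getElem?_eq hd' hd).symm

/-- A process scheduled infinitely often after a stable prefix gets arbitrarily late and long
responses. -/
theorem Stable.exists_long_output {E : List (Fin n × α)} (hE : A.Stable E) (hA : A.WaitFree)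
    (g : ℕ → Fin n × α) (p : Fin n) (hp : ∀ K, ∃ k ≥ K, (g k).1 = p) (K N : ℕ) :
    ∃ k ≥ K, (g k).1 = p ∧ ∃ r, A.outAfter (E ++ (List.range k).map g) p = some r ∧
      N < r.length := by
  let f : ℕ → Fin n × α := fun i => if h : i < E.length then E[i] else g (i - E.length)
  have hf : ∀ k, (List.range (E.length + k)).map f = E ++ (List.range k).map g := by
    intro k
    rw [List.range_add, List.map_append, List.map_map]
    congr 1
    · apply List.ext_getElem
      · simp
      · intro i h₁ h₂
        simp [f, h₂]
    · apply List.map_congr_left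
      intro i _
      simp [f]
  have hfg : ∀ k, f (E.length + k) = g k := fun k => by simp [f]
  have hout : ∀ K, ∃ k ≥ K, (g k).1 = p ∧
      ∃ r, A.outAfter (E ++ (List.range k).map g) p = some r := by
    intro K
    obtain ⟨k, hk, hkp, r, hr⟩ := WaitFree.exists_output A hA f p (fun K => by
      obtain ⟨k, hk, hkp⟩ := hp K
      exact ⟨E.length + k, by omega, by rw [hfg, hkp]⟩) (E.length + K)
    obtain ⟨k, rfl⟩ := Nat.exists_eq_add_of_le (show E.length ≤ k by omega)
    rw [hfg] at hkp
    rw [hf] at hr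
    exact ⟨k, by omega, hkp, r, hr⟩
  have key : ∀ N, ∃ r : List α, N ≤ r.length ∧ ∃ k ≥ K, (g k).1 = p ∧
      A.outAfter (E ++ (List.range k).map g) p = some r := by
    -- If all late responses were shorter than `N`, two of them would have equal length, whereas
    -- comparable responses have different lengths. `t` enumerates increasing times at which `p`
    -- returns.
    by_contra! hno
    obtain ⟨N, hN⟩ := hno
    choose k hk hkp r hr using hout
    let t : ℕ → ℕ := fun i => Nat.rec (k K) (fun _ m => k (m + 1)) i
    have ht : ∀ i, ∃ m ≥ K, t i = k m := by
      intro i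
      induction i with
      | zero => exact ⟨K, le_rfl, rfl⟩
      | succ i ih =>
        obtain ⟨m, hm, h⟩ := ih
        have := hk m
        exact ⟨t i + 1, by omega, rfl⟩
    have htm : StrictMono t := strictMono_nat_of_lt_succ fun i => by
      have := hk (t i + 1)
      change t i < k (t i + 1)
      omega
    choose m hm htk using ht
    obtain ⟨a, b, hab, heq⟩ := Finite.exists_ne_map_eq_of_infinite
      (fun i => (⟨(r (m i)).length, by
        by_contra hge
        exact hN (r (m i)) (not_lt.1 hge) (k (m i)) (le_trans (hm i) (hk _)) (hkp _) (hr _)⟩ :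
        Fin N))
    simp only [Fin.mk.injEq] at heq
    have hcmp : ∀ a b, a < b → (r (m a)).length = (r (m b)).length → False := by
      intro a b hab heq
      have hlt : k (m a) < k (m b) := by
        rw [← htk, ← htk]
        exact htm hab
      have := hE ((List.range (k (m b) + 1)).map g) (k (m a)) (k (m b)) (g (k (m a)))
        (g (k (m b))) (r (m a)) (r (m b)) hlt
        (by rw [List.getElem?_map, List.getElem?_range (by omega)]; rfl) (by simp)
        (by rw [← List.map_take, List.take_range, min_eq_left (by omega), hkp]; exact hr _)
        (by rw [← List.map_take, List.take_range, min_eq_left (by omega), hkp]; exact hr _)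
      rcases this with h | h <;> have := h.2 <;> omega
    rcases Nat.lt_or_gt_of_ne hab with h | h
    · exact hcmp a b h heq
    · exact hcmp b a h heq.symm
  obtain ⟨r, hr, k, hk, hkp, ho⟩ := key (N + 1)
  exact ⟨k, hk, hkp, r, ho, hr⟩

/-! The consensus protocol: processes repeat operations until the entry at height `N` of their
response is defined, and decide it. -/

section Ghost

variable (A) (val : Fin n → α) (N : ℕ)

/-- The decision is a ghost component: the first one is kept, and the process goes on performing
operations regardless of it. -/
def decisionUpd (p : Fin n) (l : (σ × Bool) × Option α) (m : (ι → ℤ) × (ρ → V)) :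
    (σ × Bool) × Option α :=
  ((A.prog p).atomicUpd (val p) l.1 m,
    l.2 <|> ((A.prog p).atomicOut l.1).bind (fun r => r.reverse[N]?))

noncomputable def decisionEff (p : Fin n) (l : (σ × Bool) × Option α) (m : (ι → ℤ) × (ρ → V)) :
    (ι → ℤ) × (ρ → V) :=
  (A.prog p).atomicEff l.1 m

/-- The initial configuration of the protocol, after the schedule `E`. -/
noncomputable def decisionInit (E : List (Fin n × α)) :
    (Fin n → (σ × Bool) × Option α) × ((ι → ℤ) × (ρ → V)) :=
  (fun p => ((A.conf E).1 p, none), (A.conf E).2)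

noncomputable def decisionRun (E : List (Fin n × α)) (w : List (Fin n)) :
    (Fin n → (σ × Bool) × Option α) × ((ι → ℤ) × (ρ → V)) :=
  Valency.run (decisionUpd A val N) (decisionEff A) (decisionInit A E) w

variable {A} {val} {N}

theorem decisionRun_concat (E : List (Fin n × α)) (w : List (Fin n)) (p : Fin n) :
    decisionRun A val N E (w ++ [p]) =
      Valency.next (decisionUpd A val N) (decisionEff A) (decisionRun A val N E w) p := by
  simp [decisionRun, Valency.run]

theorem decisionRun_conf (E : List (Fin n × α)) (w : List (Fin n)) :
    (∀ p, ((decisionRun A val N E w).1 p).1 = (A.conf (E ++ w.map fun p => (p, val p))).1 p) ∧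
      (decisionRun A val N E w).2 = (A.conf (E ++ w.map fun p => (p, val p))).2 := by
  induction w using List.reverseRecOn with
  | nil => simp [decisionRun, Valency.run, decisionInit]
  | append_singleton w q ih =>
    obtain ⟨h₁, h₂⟩ := ih
    rw [decisionRun_concat, List.map_append, ← List.append_assoc, List.map_singleton, conf_concat]
    constructor
    · intro p
      by_cases hp : p = q
      · subst hp
        simp [Valency.next, atomicStep, decisionUpd, h₁, h₂]
      · simp [Valency.next, atomicStep, hp, h₁]
    · simp [Valency.next, atomicStep, decisionEff, h₁, h₂]

theorem exists_output_of_decided (E : List (Fin n × α)) (w : List (Fin n)) (p : Fin n) (d : α)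
    (h : ((decisionRun A val N E w).1 p).2 = some d) :
    ∃ i, w[i]? = some p ∧ ∃ r,
      A.outAfter (E ++ (w.take i).map fun p => (p, val p)) p = some r ∧
        r.reverse[N]? = some d := by
  induction w using List.reverseRecOn with
  | nil => simp [decisionRun, Valency.run, decisionInit] at h
  | append_singleton w q ih =>
    by_cases h' : ((decisionRun A val N E w).1 p).2 = some d
    · obtain ⟨i, hi, r, hr, hd⟩ := ih h'
      have hlt := (List.getElem?_eq_some_iff.1 hi).1
      refine ⟨i, by rw [List.getElem?_append_left hlt, hi], r, ?_, hd⟩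
      rw [List.take_append_of_le_length hlt.le, hr]
    · rw [decisionRun_concat] at h
      by_cases hp : p = q
      · subst hp
        refine ⟨w.length, by simp, ?_⟩
        rw [List.take_left]
        simp only [Valency.next, Function.update_self, decisionUpd] at h
        rw [(decisionRun_conf E w).1] at h
        cases h'' : ((decisionRun A val N E w).1 p).2 with
        | none =>
          rw [h''] at h
          simp only [Option.orElse_eq_orElse, Option.orElse_none] at h
          obtain ⟨r, hr, hd⟩ := Option.bind_eq_some_iff.1 h
          exact ⟨r, hr, hd⟩
        | some d' =>
          rw [h''] at h h'
          simp at h h'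
          exact absurd h h'
      · simp [Valency.next, hp] at h
        exact absurd h h'

theorem exists_decision_of_output (E : List (Fin n × α)) (w : List (Fin n)) (p : Fin n) (i : ℕ)
    (hi : w[i]? = some p) (r : List α)
    (hr : A.outAfter (E ++ (w.take i).map fun p => (p, val p)) p = some r) (hN : N < r.length) :
    ∃ d, ((decisionRun A val N E w).1 p).2 = some d := by
  induction w using List.reverseRecOn with
  | nil => simp at hi
  | append_singleton w q ih =>
    rw [decisionRun_concat]
    rcases Nat.lt_or_ge i w.length with hlt | hge
    · rw [List.getElem?_append_left hlt] at hi
      rw [List.take_append_of_le_length hlt.le] at hr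
      obtain ⟨d, hd⟩ := ih hi hr
      refine ⟨d, ?_⟩
      by_cases hp : p = q
      · subst hp
        simp [Valency.next, decisionUpd, hd]
      · simp [Valency.next, hp, hd]
    · obtain rfl : i = w.length := by
        have := (List.getElem?_eq_some_iff.1 hi).1
        simp at this
        omega
      simp at hi
      subst hi
      rw [List.take_left] at hr
      simp only [Valency.next, Function.update_self, decisionUpd]
      rw [(decisionRun_conf E w).1]
      cases ((decisionRun A val N E w).1 q).2 with
      | some d => exact ⟨d, by simp⟩
      | none =>
        refine ⟨r.reverse[N]'(by simpa using hN), ?_⟩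
        change (_ <|> (A.outAfter _ q).bind _) = _
        rw [hr]
        simp [hN]

end Ghost

/-- Increments commute, steps at different objects commute, invocations, reads and returns leave the
memory alone, and of two writes to one register the later hides the earlier. -/
theorem atomicEff_comm (B C : Program fetchAndAdd (fetchAndCons α) ι ρ V σ) (l l' : σ × Bool) :
    (∀ m, B.atomicEff l (C.atomicEff l' m) = C.atomicEff l' (B.atomicEff l m)) ∨
      (∀ m, B.atomicEff l (C.atomicEff l' m) = B.atomicEff l m) ∨
      (∀ m, C.atomicEff l' (B.atomicEff l m) = C.atomicEff l' m) := by
  classical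
  obtain ⟨s, _ | _⟩ := l
  · exact Or.inl fun m => rfl
  obtain ⟨s', _ | _⟩ := l'
  · exact Or.inl fun m => rfl
  rcases h : B.next s with ⟨z, k⟩ | ⟨⟨y, _ | v⟩ | r⟩ <;>
    rcases h' : C.next s' with ⟨z', k'⟩ | ⟨⟨y', _ | v'⟩ | r'⟩ <;>
    simp only [Program.atomicEff, h, h', implies_true, true_or]
  · left
    intro m
    by_cases hz : z = z'
    · subst hz
      simp
      ring_nf
    · rw [Function.update_of_ne hz, Function.update_of_ne (Ne.symm hz), Function.update_comm hz]
  · by_cases hy : y = y'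
    · subst hy
      right; left
      simp
    · left
      intro m
      rw [Function.update_comm hy]

/-- After a stable prefix the decision protocol satisfies the hypotheses of `Valency.not_multi`, yet
it is multivalent: `p₀` running alone leads to `u`, and `p₁` running alone to `v`. -/
theorem not_three_processes [Nontrivial α] (hn : 3 ≤ n) (hw : A.WaitFree)
    (hA : A.EventuallyLinearizableImpl []) : False := by
  classical
  obtain ⟨u, v, huv⟩ := exists_pair_ne α
  have : NeZero n := ⟨by omega⟩
  have : Inhabited α := ⟨u⟩
  obtain ⟨E, hE⟩ := A.exists_stable hA
  let p₀ : Fin n := ⟨0, by omega⟩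
  let p₁ : Fin n := ⟨1, by omega⟩
  let val : Fin n → α := fun p => if p = p₀ then u else v
  -- When `p` runs alone after `E`, only `val p` is added from time `2 * E.length` on, so late
  -- responses carry `val p` above some height.
  have solo : ∀ p, ∃ N₀ K, ∀ k r N, K ≤ k →
      A.outAfter (E ++ List.replicate k (p, val p)) p = some r →
      N₀ ≤ N → N < r.length → r.reverse[N]? = some (val p) := by
    intro p
    obtain ⟨N₀, K, h⟩ := (hA _ (A.atomicExec_isExecution
      (fun i => E.getD i (p, val p)))).eventually_constant (K₀ := 2 * E.length) (u := val p) (by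
        intro k q w hk hq
        rw [A.implHistory_inv hq, List.getD_eq_default _ _ (by omega)])
    refine ⟨N₀, K, fun k r N hk hr => h (2 * (E.length + k)) p r N (by omega) ?_⟩
    have := A.implHistory_of_outAfter (f := fun i => E.getD i (p, val p)) (k := E.length + k)
      (r := r) (by
        rw [Valency.range_map_getD, List.getD_eq_default _ _ (by omega)]
        exact hr)
    rwa [List.getD_eq_default _ _ (by omega)] at this
  choose N₀ K solo using solo
  -- The height must lie above the part of the list that is not controlled by the solo runs of `p₀`
  -- and `p₁`.
  let N := max (N₀ p₀) (N₀ p₁)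
  refine Valency.not_multi (upd := decisionUpd A val N) (eff := decisionEff A)
    (dec := fun l => l.2) (X := decisionInit A E) hn ?_ ?_ ?_ ?_
  · intro p q l l'
    exact atomicEff_comm _ _ _ _
  · intro w₁ w₂ p q d d' h h'
    obtain ⟨i, hi, r, hr, hd⟩ := exists_output_of_decided E w₁ p d h
    obtain ⟨j, hj, r', hr', hd'⟩ := exists_output_of_decided E (w₁ ++ w₂) q d' h'
    have hlt := (List.getElem?_eq_some_iff.1 hi).1
    refine hE.entry_unique (W := (w₁ ++ w₂).map fun p => (p, val p)) (i := i) (j := j)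
      (x := (p, val p)) (y := (q, val q)) ?_ ?_ ?_ ?_ hd hd'
    · rw [List.getElem?_map, List.getElem?_append_left hlt, hi]; rfl
    · rw [List.getElem?_map, hj]; rfl
    · rw [← List.map_take, List.take_append_of_le_length hlt.le]; exact hr
    · rw [← List.map_take]; exact hr'
  · intro f p hp
    obtain ⟨k, -, hkp, r, hr, hN⟩ := hE.exists_long_output hw (fun i => (f i, val (f i))) p hp 0 N
    have hdec : ∀ k' ≥ k + 1, ∃ d,
        ((decisionRun A val N E ((List.range k').map f)).1 p).2 = some d := by
      intro k' hk'
      refine exists_decision_of_output E _ p k ?_ r ?_ hN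
      · simp [show k < k' by omega]; exact hkp
      · rw [← List.map_take, List.take_range, min_eq_left (by omega), List.map_map]
        exact hr
    obtain ⟨d, hd⟩ := hdec (k + 1) le_rfl
    refine ⟨k + 1, d, fun k' hk' => ?_⟩
    obtain ⟨d', hd'⟩ := hdec k' hk'
    obtain ⟨i, hi, r₁, hr₁, h₁⟩ := exists_output_of_decided E _ p d hd
    obtain ⟨j, hj, r₂, hr₂, h₂⟩ := exists_output_of_decided E _ p d' hd'
    have hlt : i < k + 1 := by simpa using (List.getElem?_eq_some_iff.1 hi).1
    have : d = d' := by
      refine hE.entry_unique (W := ((List.range k').map f).map fun p => (p, val p)) (i := i)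
        (j := j) (x := (p, val p)) (y := (p, val p)) ?_ ?_ ?_ ?_ h₁ h₂
      · rw [List.getElem?_map] at hi ⊢
        rw [List.getElem?_map]
        rw [List.getElem?_range hlt] at hi
        rw [List.getElem?_range (by omega)]
        simp at hi ⊢
        simp [hi]
      · rw [List.getElem?_map, hj]; rfl
      · rw [← List.map_take, ← List.map_take, List.take_range, min_eq_left (by omega)]
        rw [← List.map_take, List.take_range, min_eq_left (by omega)] at hr₁
        exact hr₁
      · rw [← List.map_take]; exact hr₂
    rw [this]
    exact hd'
  · have hval : ∀ p, N₀ p ≤ N →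
        Valency.Val (decisionUpd A val N) (decisionEff A) (fun l => l.2) (decisionInit A E)
          (val p) := by
      intro p hpN
      obtain ⟨k, hk, -, r, hr, hN⟩ :=
        hE.exists_long_output hw (fun _ => (p, val p)) p (fun K => ⟨K, le_rfl, rfl⟩) (K p) N
      simp only [List.map_const', List.length_range] at hr
      have hd := solo p k r N hk hr hpN hN
      refine ⟨List.replicate (k + 1) p, p, ?_⟩
      have hr' : A.outAfter (E ++ ((List.replicate (k + 1) p).take k).map fun p => (p, val p)) p =
          some r := by
        rw [List.take_replicate, min_eq_left (by omega), List.map_replicate]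
        exact hr
      obtain ⟨d, hd'⟩ := exists_decision_of_output E (List.replicate (k + 1) p) p k
        (by simp) r hr' hN
      obtain ⟨j, hj, r₂, hr₂, h₂⟩ := exists_output_of_decided E _ p d hd'
      have : d = val p := by
        refine hE.entry_unique (W := (List.replicate (k + 1) p).map fun p => (p, val p)) (i := j)
          (j := k) (x := (p, val p)) (y := (p, val p)) ?_ ?_ ?_ ?_ h₂ hd
        · rw [List.getElem?_map, hj]; rfl
        · simp
        · rw [← List.map_take]; exact hr₂
        · rw [← List.map_take]; exact hr'
      rw [← this]
      exact hd'
    refine ⟨u, v, huv, ?_, ?_⟩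
    · have := hval p₀ (le_max_left _ _)
      simpa [val] using this
    · have := hval p₁ (le_max_right _ _)
      simpa [val, p₀, p₁] using this

end Implementation

theorem not_waitFreeEventuallyImplements_of_three_le {α : Type} [Primcodable α] [Nontrivial α]
    {n : ℕ} (hn : 3 ≤ n) : ¬ WaitFreeEventuallyImplements n fetchAndAdd (fetchAndCons α) := by
  rintro ⟨ι, ρ, V, σ, _, _, _, _, A, u₀, hu, -, hw, hA⟩
  obtain rfl : u₀ = [] := hu
  exact A.not_three_processes hn hw hA

/-! ## Linearizations of fetch-and-cons histories from growing lists -/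

section Chain

theorem List.IsSuffix.eq_of_suffix_of_length {β : Type} {l l' L : List β} (h : l <:+ L)
    (h' : l' <:+ L) (hl : l.length = l'.length) : l = l' :=
  (List.suffix_of_suffix_length_le h h' hl.le).eq_of_length hl

theorem eq_of_suffix_chain {β : Type} {Q : ℕ → List β} (hQ : ∀ i, Q i <:+ Q (i + 1))
    {i i' : ℕ} {l l' : List β} (h : l <:+ Q i) (h' : l' <:+ Q i') (hl : l.length = l'.length) :
    l = l' :=
  (h.trans (suffix_of_le_of_succ hQ (le_max_left i i'))).eq_of_suffix_of_length
    (h'.trans (suffix_of_le_of_succ hQ (le_max_right i i'))) hl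

/-- The limit of a growing sequence of lists has a suffix of every length `j`, or is itself finite
and of length less than `j`. -/
theorem exists_suffix_of_length {β : Type} (Q : ℕ → List β) (j : ℕ) :
    ∃ L : List β, (∃ i, L <:+ Q i) ∧
      (L.length = j ∨ (L.length < j ∧ ∀ i, (Q i).length ≤ L.length)) := by
  by_cases h : ∃ i, j ≤ (Q i).length
  · obtain ⟨i, hi⟩ := h
    exact ⟨(Q i).drop ((Q i).length - j), ⟨i, List.drop_suffix _ _⟩, Or.inl (by simp; omega)⟩
  · push Not at h
    have hfin : (Set.range fun i => (Q i).length).Finite :=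
      (Set.finite_lt_nat j).subset (by rintro _ ⟨i, rfl⟩; exact h i)
    obtain ⟨_, ⟨i, rfl⟩, hi⟩ := Set.exists_max_image _ id hfin ⟨_, ⟨0, rfl⟩⟩
    exact ⟨Q i, ⟨i, List.suffix_rfl⟩, Or.inr ⟨h i, fun i' => hi _ ⟨i', rfl⟩⟩⟩

variable {P : Type} {α : Type} {H : History P α (List α)} {val : ℕ → α}

open Classical in
-- A list of invocation times, newest first, encodes a sequential history: `k` with tail `l` takes
-- place `l.length` and returns the values of `l`. The chain condition makes the occupant of a place
-- unique, and absence of duplicates gives each operation one place.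
theorem exists_sequence_of_chain {Q : ℕ → List ℕ} (hQ : ∀ i, Q i <:+ Q (i + 1))
    (hnodup : ∀ i, (Q i).Nodup) (hinv : ∀ i, ∀ k ∈ Q i, ∃ p, H.Invoked k p (val k)) :
    ∃ S : ℕ → Option (ℕ × List α), IsLegalSequential (fetchAndCons α) [] H S ∧
      (∀ i k l, (k :: l) <:+ Q i → S l.length = some (k, l.map val)) ∧
      (∀ j k r, S j = some (k, r) → ∃ i l, (k :: l) <:+ Q i ∧ l.length = j ∧ r = l.map val) := by
  let E : ℕ → Prop := fun j => ∃ x : ℕ × List ℕ, x.2.length = j ∧ ∃ i, (x.1 :: x.2) <:+ Q i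
  let S : ℕ → Option (ℕ × List α) := fun j =>
    if h : E j then some (h.choose.1, h.choose.2.map val) else none
  have hS₁ : ∀ i k l, (k :: l) <:+ Q i → S l.length = some (k, l.map val) := by
    intro i k l h
    have hE : E l.length := ⟨(k, l), rfl, i, h⟩
    obtain ⟨h₁, i', h₂⟩ := hE.choose_spec
    have := eq_of_suffix_chain hQ h h₂ (by simp [h₁])
    rw [List.cons.injEq] at this
    simp only [S, dif_pos hE]
    rw [← this.1, ← this.2]
  have hS₂ : ∀ j k r, S j = some (k, r) →
      ∃ i l, (k :: l) <:+ Q i ∧ l.length = j ∧ r = l.map val := by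
    intro j k r h
    by_cases hE : E j
    · simp only [S, dif_pos hE, Option.some.injEq, Prod.mk.injEq] at h
      obtain ⟨h₁, i', h₂⟩ := hE.choose_spec
      rw [h.1] at h₂
      exact ⟨i', _, h₂, h₁, h.2.symm⟩
    · simp [S, dif_neg hE] at h
  -- `L j` encodes the state before place `j`; it becomes constant if the chain does.
  choose L hL hLlen using exists_suffix_of_length Q
  refine ⟨S, ⟨?_, ?_, fun j => (L j).map val, ?_, ?_, ?_⟩, hS₁, hS₂⟩
  · intro j k r h
    obtain ⟨i, l, hl, -⟩ := hS₂ j k r h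
    obtain ⟨p, hp⟩ := hinv i k (hl.subset (by simp))
    exact ⟨p, _, hp⟩
  · intro j j' k r r' h h'
    obtain ⟨i, l, hl, rfl, -⟩ := hS₂ j k r h
    obtain ⟨i', l', hl', rfl, -⟩ := hS₂ j' k r' h'
    have h₁ := hl.trans (suffix_of_le_of_succ hQ (le_max_left i i'))
    have h₂ := hl'.trans (suffix_of_le_of_succ hQ (le_max_right i i'))
    have hno := hnodup (max i i')
    have aux : ∀ l l' : List ℕ, (k :: l) <:+ (k :: l') → (k :: l').Nodup → l = l' := by
      intro l l' h hno
      rcases List.suffix_cons_iff.1 h with h | h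
      · simpa using h
      · exact absurd (h.subset (by simp)) (List.nodup_cons.1 hno).1
    rcases le_total l.length l'.length with hle | hle
    · rw [aux l l' (List.suffix_of_suffix_length_le h₁ h₂ (by simpa using hle))
        (hno.sublist h₂.sublist)]
    · rw [aux l' l (List.suffix_of_suffix_length_le h₂ h₁ (by simpa using hle))
        (hno.sublist h₁.sublist)]
  · have : L 0 = [] := by
      rcases hLlen 0 with h | h
      · exact List.length_eq_zero_iff.1 h
      · omega
    simp [this]
  · intro j hj
    have : L (j + 1) = L j := by
      obtain ⟨i, hi⟩ := hL j
      obtain ⟨i', hi'⟩ := hL (j + 1)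
      refine eq_of_suffix_chain hQ hi' hi ?_
      rcases hLlen (j + 1) with h | ⟨h, hmax⟩
      · obtain ⟨k, l, hkl⟩ := List.exists_cons_of_length_eq_add_one h
        rw [hkl] at hi' h
        have := hS₁ i' k l hi'
        rw [show l.length = j by simpa using h, hj] at this
        cases this
      · have h₁ := hmax i
        have h₂ := hi.length_le
        rcases hLlen j with h' | ⟨h', hmax'⟩
        · omega
        · have h₃ := hmax' i'
          have h₄ := hi'.length_le
          omega
    simp only [this]
  · intro j k r p v hj hk
    obtain ⟨i, l, hl, rfl, rfl⟩ := hS₂ j k r hj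
    have hlen := hl.length_le
    rw [List.length_cons] at hlen
    have hfull : ∀ j ≤ l.length + 1, (L j).length = j := by
      intro j hj
      rcases hLlen j with h | ⟨h, hmax⟩
      · exact h
      · have := hmax i
        omega
    have h₀ : L l.length = l := by
      obtain ⟨i', hi'⟩ := hL l.length
      exact eq_of_suffix_chain hQ hi' ((List.suffix_cons k l).trans hl) (hfull _ (by omega))
    have h₁ : L (l.length + 1) = k :: l := by
      obtain ⟨i', hi'⟩ := hL (l.length + 1)
      exact eq_of_suffix_chain hQ hi' hl (by rw [hfull _ le_rfl, List.length_cons])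
    obtain ⟨p', hp'⟩ := hinv i k (hl.subset (by simp))
    rw [History.Invoked] at hk hp'
    rw [hk] at hp'
    simp at hp'
    simp [h₀, h₁, hp'.2]

/-- The single list `k :: l`, taken as a constant chain, is the explanation. -/
theorem exists_explanation {k m : ℕ} {p : P} {l : List ℕ} (hnodup : (k :: l).Nodup)
    (hinv : ∀ x ∈ k :: l, ∃ p, H.Invoked x p (val x)) (hlt : ∀ x ∈ k :: l, x < m)
    (hown : ∀ x i, H.Invoked x p i → x < k → x ∈ l) :
    ∃ S, IsLegalSequential (fetchAndCons α) [] H S ∧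
      (∀ j k' r', S j = some (k', r') → k' < m) ∧
      (∀ k' i', H.Invoked k' p i' → k' < k → ∃ j r', S j = some (k', r')) ∧
      (∃ e, S e = some (k, l.map val) ∧ ∀ j, e < j → S j = none) := by
  obtain ⟨S, hS, h₁, h₂⟩ := exists_sequence_of_chain (Q := fun _ => k :: l) (val := val)
    (fun _ => List.suffix_rfl) (fun _ => hnodup) (fun _ => hinv)
  refine ⟨S, hS, ?_, ?_, l.length, h₁ 0 k l List.suffix_rfl, ?_⟩
  · intro j k' r' hj
    obtain ⟨i, l', hl', -⟩ := h₂ j k' r' hj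
    exact hlt k' (hl'.subset (by simp))
  · intro k' i' hk' hlt'
    obtain ⟨s, t, hst⟩ := List.append_of_mem (hown k' i' hk' hlt')
    exact ⟨_, _, h₁ 0 k' t ⟨k :: s, by simp [hst]⟩⟩
  · intro j hj
    by_contra hne
    obtain ⟨⟨k', r'⟩, hk'⟩ := Option.ne_none_iff_exists'.1 hne
    obtain ⟨i, l', hl', rfl, -⟩ := h₂ j k' r' hk'
    have := hl'.length_le
    simp only [List.length_cons] at this
    omega

open Classical in
-- Translates a bound on times into a number of removed events: as many as occur before `T₀`.
theorem History.exists_inSuffix_iff {I R : Type} (H : History P I R) (T₀ : ℕ) :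
    ∃ t, ∀ k, (H k).isSome = true → (H.InSuffix t k ↔ T₀ ≤ k) := by
  refine ⟨Nat.count (fun j => (H j).isSome = true) T₀, fun k hk => ?_⟩
  constructor
  · intro h
    by_contra hlt
    have h₁ := Nat.count_monotone (fun j => (H j).isSome = true) (show k + 1 ≤ T₀ by omega)
    rw [Nat.count_succ, if_pos hk] at h₁
    unfold History.InSuffix at h
    omega
  · intro h
    exact Nat.count_monotone _ h

/-- A criterion for `t`-linearizability of a fetch-and-cons history: the operations are collected
by a growing sequence `Q` of lists, of which the responses after some time are suffixes. -/
theorem tLinearizable_of_chain {Q : ℕ → List ℕ} (hQ : ∀ i, Q i <:+ Q (i + 1))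
    (hnodup : ∀ i, (Q i).Nodup) (hinv : ∀ i, ∀ k ∈ Q i, ∃ p, H.Invoked k p (val k))
    (hcomp : ∀ k m r, H.Responds k m r → ∃ i, k ∈ Q i) (T₀ : ℕ)
    (hresp : ∀ k m r, H.Responds k m r → T₀ ≤ m → ∃ i l, (k :: l) <:+ Q i ∧ r = l.map val ∧
      ∀ k₁ m₁ r₁, H.Responds k₁ m₁ r₁ → T₀ ≤ m₁ → m₁ < k → k₁ ∈ l)
    (hpend : ∀ i, ∀ k ∈ Q i, T₀ ≤ k → ∃ m r, H.Responds k m r) :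
    ∃ t, TLinearizable (fetchAndCons α) [] H t := by
  obtain ⟨S, hS, h₁, h₂⟩ := exists_sequence_of_chain hQ hnodup hinv
  obtain ⟨t, ht⟩ := H.exists_inSuffix_iff T₀
  refine ⟨t, S, hS, ?_, ?_, ?_⟩
  · intro k m r hr
    obtain ⟨i, hi⟩ := hcomp k m r hr
    obtain ⟨s, l, hl⟩ := List.append_of_mem hi
    exact ⟨_, _, h₁ i k l ⟨s, hl.symm⟩⟩
  · intro k₁ m₁ r₁ k₂ hr₁ hlt hm₁ hk₂ j₁ j₂ a₁ a₂ hj₁ hj₂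
    obtain ⟨p₁, i₁, -, hm₁', -⟩ := hr₁.2
    rw [ht m₁ (by simp [hm₁'])] at hm₁
    obtain ⟨p₂, i₂, hk₂'⟩ := hS.invoked _ _ _ hj₂
    rw [ht k₂ (by simp [show H k₂ = _ from hk₂'])] at hk₂
    obtain ⟨i, l, hl, rfl, -⟩ := h₂ _ _ _ hj₂
    -- Operations invoked after `T₀` enter the chain only if they complete; the hypothesis on the
    -- response of `k₂` then puts `k₁` below it.
    obtain ⟨m₂, r₂, hr₂⟩ := hpend i k₂ (hl.subset (by simp)) hk₂
    obtain ⟨i', l', hl', -, hmem⟩ := hresp k₂ m₂ r₂ hr₂ (by have := hr₂.1; omega)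
    have hk₁ := hmem k₁ m₁ r₁ hr₁ hm₁ hlt
    have := hS.once _ _ _ _ _ hj₂ (h₁ _ _ _ hl')
    obtain ⟨s, l₁, hs⟩ := List.append_of_mem hk₁
    have := hS.once _ _ _ _ _ hj₁ (h₁ i' k₁ l₁ (List.IsSuffix.trans ⟨k₂ :: s, by simp [hs]⟩ hl'))
    have : l'.length = (s ++ k₁ :: l₁).length := by rw [hs]
    simp at this
    omega
  · intro k m r hr hm
    obtain ⟨p, i, -, hm', -⟩ := hr.2
    rw [ht m (by simp [hm'])] at hm
    obtain ⟨i, l, hl, rfl, -⟩ := hresp k m r hr hm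
    exact ⟨_, h₁ i k l hl⟩

open Classical in
-- All responses are exempted, so the completed operations may be listed in any order.
theorem tLinearizable_of_finite {T₀ : ℕ} (hT : ∀ k m r, H.Responds k m r → m < T₀)
    (hinv : ∀ k p v, H.Invoked k p v → v = val k) :
    ∃ t, TLinearizable (fetchAndCons α) [] H t := by
  refine tLinearizable_of_chain (val := val)
    (Q := fun _ => (List.range T₀).filter (fun k => ∃ m r, H.Responds k m r))
    (fun _ => List.suffix_rfl) (fun _ => List.nodup_range.filter _) ?_ ?_ T₀ ?_ ?_
  · intro _ k hk
    simp only [List.mem_filter, decide_eq_true_eq] at hk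
    obtain ⟨-, m, r, -, p, i, hk, -⟩ := hk
    exact ⟨p, by rw [← hinv k p i hk]; exact hk⟩
  · intro k m r h
    refine ⟨0, ?_⟩
    simp only [List.mem_filter, decide_eq_true_eq, List.mem_range]
    exact ⟨h.1.trans (hT _ _ _ h), m, r, h⟩
  · intro k m r h hm
    have := hT _ _ _ h
    omega
  · intro _ k hk hk'
    simp only [List.mem_filter, List.mem_range] at hk
    omega

end Chain

/-! ## A fetch-and-cons object for two processes -/

section CountedEvents

variable {n : ℕ} {T U : ADT} {ι ρ V : Type} {e : ℕ → Option (Fin n × Act T U ι ρ V)}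

open Classical in
/-- The number of steps of process `p` before time `k`. -/
noncomputable def stepCount (e : ℕ → Option (Fin n × Act T U ι ρ V)) (p : Fin n) (k : ℕ) : ℕ :=
  Nat.count (fun j => ∃ a, e j = some (p, a)) k

theorem stepCount_zero (p : Fin n) : stepCount e p 0 = 0 := rfl

theorem stepCount_succ_of_step {p : Fin n} {k : ℕ} (h : ∃ a, e k = some (p, a)) :
    stepCount e p (k + 1) = stepCount e p k + 1 := by
  rw [stepCount, Nat.count_succ, if_pos h, stepCount]

theorem stepCount_succ_of_not_step {p : Fin n} {k : ℕ} (h : ¬ ∃ a, e k = some (p, a)) :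
    stepCount e p (k + 1) = stepCount e p k := by
  rw [stepCount, Nat.count_succ, if_neg h, stepCount, add_zero]

theorem stepCount_mono (p : Fin n) : Monotone (stepCount e p) := by
  classical exact Nat.count_monotone _

/-- The `i`-th step of process `p` occurs at time `k`. -/
def StepAt (e : ℕ → Option (Fin n × Act T U ι ρ V)) (p : Fin n) (i k : ℕ) : Prop :=
  (∃ a, e k = some (p, a)) ∧ stepCount e p k = i

theorem StepAt.lt_iff {p : Fin n} {i i' k k' : ℕ} (h : StepAt e p i k) (h' : StepAt e p i' k') :
    i < i' ↔ k < k' := by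
  obtain ⟨h₁, rfl⟩ := h
  obtain ⟨h₂, rfl⟩ := h'
  constructor
  · intro h
    by_contra hle
    exact absurd (stepCount_mono (e := e) p (not_lt.1 hle)) (by omega)
  · intro h
    have := stepCount_mono (e := e) p (Nat.succ_le_of_lt h)
    rw [Nat.succ_eq_add_one, stepCount_succ_of_step h₁] at this
    omega

theorem StepAt.unique {p : Fin n} {i k k' : ℕ} (h : StepAt e p i k) (h' : StepAt e p i k') :
    k = k' := by
  have h₁ := h.lt_iff h'
  have h₂ := h'.lt_iff h
  omega

theorem exists_stepAt_of_lt_stepCount {p : Fin n} {i k : ℕ} (h : i < stepCount e p k) :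
    ∃ k' < k, StepAt e p i k' := by
  induction k with
  | zero => simp [stepCount_zero] at h
  | succ k ih =>
    by_cases hk : ∃ a, e k = some (p, a)
    · rw [stepCount_succ_of_step hk] at h
      rcases Nat.lt_or_eq_of_le (Nat.le_of_lt_succ h) with hi | hi
      · obtain ⟨k', hk', h'⟩ := ih hi
        exact ⟨k', by omega, h'⟩
      · exact ⟨k, by omega, hk, hi.symm⟩
    · rw [stepCount_succ_of_not_step hk] at h
      obtain ⟨k', hk', h'⟩ := ih h
      exact ⟨k', by omega, h'⟩

theorem StepAt.exists_earlier {p : Fin n} {i i' k : ℕ} (h : StepAt e p i k) (hi : i' < i) :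
    ∃ k' < k, StepAt e p i' k' := by
  obtain ⟨-, rfl⟩ := h
  exact exists_stepAt_of_lt_stepCount hi

end CountedEvents

namespace TwoProcess

variable {α : Type}

/-- The number of entries of process `q` in a list of tagged values. -/
def countOf (q : Fin 2) (w : List (Fin 2 × α)) : ℕ := (w.filter (fun x => x.1 = q)).length

/-- Process `p`, which has performed the operations `own` and believes that the operations `log`
have been performed, has read `w`; the result is the new belief. Process `0` only extends
its log by new operations of process `1`; process `1` adopts a log of process `0` that goes
beyond its own. -/
def merge (p : Fin 2) (own log w : List (Fin 2 × α)) : List (Fin 2 × α) :=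
  -- Here `w` lists all operations of process `1` up to some point, newest first; those beyond the
  -- ones already logged are added.
  if p = 0 then w.take (w.length - countOf 1 log) ++ log
  else if countOf 0 log < countOf 0 w then
    -- A log of process `0` that counts more operations of process `1` than it has previously
    -- performed is rejected. Otherwise its missing operations go directly below the newest
    -- operation of process `0`.
    if countOf 1 w ≤ own.length then
      w.take 1 ++ (own.take (own.length - countOf 1 w) ++ w.drop 1)
    else log
  else log

/-- The local memory: the pending command, whether the fetch-and-add has been done, the own
operations and the log. -/
abbrev Memory (α : Type) : Type :=
  ((Unit × ℤ) ⊕ (((Fin 2 × ℕ) × Option (List (Fin 2 × α))) ⊕ List α)) × Bool ×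
    List (Fin 2 × α) × List (Fin 2 × α)

/-- An operation announces its value in a new register, increments the fetch-and-add object,
reads the register of the last preceding operation of the other process, and returns. -/
def prog (p : Fin 2) :
    Program fetchAndAdd (fetchAndCons α) Unit (Fin 2 × ℕ) (List (Fin 2 × α)) (Memory α) where
  init := (.inr (.inr []), false, [], [])
  -- Registers are numbered from `1`, so register `0` keeps its initial value `[]` for a reader that
  -- finds no operation before its own. Process `0` announces its log, process `1` its own
  -- operations.
  start s v := (.inr (.inl ((p, s.2.2.1.length + 1),
    some (if p = 0 then (p, v) :: s.2.2.2 else (p, v) :: s.2.2.1))),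
    false, (p, v) :: s.2.2.1, (p, v) :: s.2.2.2)
  next s := s.1
  -- The tail omits the current operation, so the difference counts the increments of the other
  -- process.
  onObj s r := (.inr (.inl ((1 - p, Int.toNat r - s.2.2.1.tail.length), none)),
    true, s.2.2.1, s.2.2.2)
  onReg s w :=
    -- The flag distinguishes the reply to the read from the reply to the announcing write.
    if s.2.1 = true then
      (.inr (.inr ((merge p s.2.2.1.tail s.2.2.2.tail (w.getD [])).map Prod.snd)), false,
        s.2.2.1, s.2.2.2.take 1 ++ merge p s.2.2.1.tail s.2.2.2.tail (w.getD []))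
    else (.inl ((), 1), false, s.2.2.1, s.2.2.2)

/-- The implementation. -/
def impl (α : Type) : Implementation 2 fetchAndAdd (fetchAndCons α) Unit (Fin 2 × ℕ)
    (List (Fin 2 × α)) (Memory α) where
  prog := prog
  objInit _ := 0
  objInit_mem _ := Set.mem_univ _
  regInit _ := []

/-! ### Computability -/

section Computability

/-- Integers are encoded with `n ≥ 0` as `2 * n` and the negative ones as odd numbers. -/
theorem _root_.Int.primrec_toNat : Primrec Int.toNat := by
  have h : Primrec fun z : ℤ => bif Nat.bodd (Encodable.encode z) then 0
      else Nat.div2 (Encodable.encode z) :=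
    Primrec.cond (Primrec.nat_bodd.comp Primrec.encode) (Primrec.const 0)
      (Primrec.nat_div2.comp Primrec.encode)
  refine h.of_eq fun z => ?_
  have : Encodable.encode z = Equiv.intEquivNat z := rfl
  rw [this]
  cases z with
  | ofNat n =>
    rw [show Equiv.intEquivNat (Int.ofNat n) = 2 * n from rfl]
    simp
  | negSucc n =>
    rw [show Equiv.intEquivNat (Int.negSucc n) = 2 * n + 1 from rfl]
    simp

variable [Primcodable α]

theorem primrec_countOf (q : Fin 2) : Primrec (countOf (α := α) q) :=
  Primrec.list_length.comp (Primrec.listFilter (Primrec.eq.comp Primrec.fst (Primrec.const q)))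

theorem primrec_merge (p : Fin 2) :
    Primrec fun x : List (Fin 2 × α) × List (Fin 2 × α) × List (Fin 2 × α) =>
      merge p x.1 x.2.1 x.2.2 := by
  have own := Primrec.fst (α := List (Fin 2 × α)) (β := List (Fin 2 × α) × List (Fin 2 × α))
  have log : Primrec fun x : List (Fin 2 × α) × List (Fin 2 × α) × List (Fin 2 × α) => x.2.1 :=
    Primrec.fst.comp Primrec.snd
  have w : Primrec fun x : List (Fin 2 × α) × List (Fin 2 × α) × List (Fin 2 × α) => x.2.2 :=
    Primrec.snd.comp Primrec.snd
  unfold merge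
  by_cases hp : p = 0
  · simp only [hp, if_true]
    exact Primrec.list_append.comp
      (Primrec.list_take.comp (Primrec.nat_sub.comp (Primrec.list_length.comp w)
        ((primrec_countOf 1).comp log)) w) log
  · simp only [hp, if_false]
    refine Primrec.ite (Primrec.nat_lt.comp ((primrec_countOf 0).comp log)
      ((primrec_countOf 0).comp w)) ?_ log
    refine Primrec.ite (Primrec.nat_le.comp ((primrec_countOf 1).comp w)
      (Primrec.list_length.comp own)) ?_ log
    exact Primrec.list_append.comp (Primrec.list_take.comp (Primrec.const 1) w)
      (Primrec.list_append.comp (Primrec.list_take.comp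
        (Primrec.nat_sub.comp (Primrec.list_length.comp own) ((primrec_countOf 1).comp w)) own)
        (Primrec.list_drop.comp (Primrec.const 1) w))

theorem prog_isComputable (p : Fin 2) : (prog (α := α) p).IsComputable where
  start := by
    have own : Primrec fun x : Memory α × α => x.1.2.2.1 :=
      Primrec.fst.comp (Primrec.snd.comp (Primrec.snd.comp Primrec.fst))
    have log : Primrec fun x : Memory α × α => x.1.2.2.2 :=
      Primrec.snd.comp (Primrec.snd.comp (Primrec.snd.comp Primrec.fst))
    have ent : Primrec fun x : Memory α × α => (p, x.2) := (Primrec.const p).pair Primrec.snd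
    have h₁ := Primrec.list_cons.comp ent own
    have h₂ := Primrec.list_cons.comp ent log
    refine Primrec₂.to_comp (Primrec.pair ?_ ((Primrec.const false).pair (h₁.pair h₂)))
    refine Primrec.sumInr.comp (Primrec.sumInl.comp (Primrec.pair
      ((Primrec.const p).pair (Primrec.succ.comp (Primrec.list_length.comp own))) ?_))
    refine Primrec.option_some.comp ?_
    by_cases hp : p = 0
    · simpa only [hp, if_true] using h₂
    · simpa only [hp, if_false] using h₁
  next := Computable.fst
  onObj := by
    have own : Primrec fun x : Memory α × ℤ => x.1.2.2.1 :=
      Primrec.fst.comp (Primrec.snd.comp (Primrec.snd.comp Primrec.fst))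
    have log : Primrec fun x : Memory α × ℤ => x.1.2.2.2 :=
      Primrec.snd.comp (Primrec.snd.comp (Primrec.snd.comp Primrec.fst))
    refine Primrec₂.to_comp (Primrec.pair ?_ ((Primrec.const true).pair (own.pair log)))
    exact Primrec.sumInr.comp (Primrec.sumInl.comp (Primrec.pair
      ((Primrec.const (1 - p)).pair (Primrec.nat_sub.comp (Int.primrec_toNat.comp Primrec.snd)
        (Primrec.list_length.comp (Primrec.list_tail.comp own)))) (Primrec.const none)))
  onReg := by
    have flag : Primrec fun x : Memory α × Option (List (Fin 2 × α)) => x.1.2.1 :=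
      Primrec.fst.comp (Primrec.snd.comp Primrec.fst)
    have own : Primrec fun x : Memory α × Option (List (Fin 2 × α)) => x.1.2.2.1 :=
      Primrec.fst.comp (Primrec.snd.comp (Primrec.snd.comp Primrec.fst))
    have log : Primrec fun x : Memory α × Option (List (Fin 2 × α)) => x.1.2.2.2 :=
      Primrec.snd.comp (Primrec.snd.comp (Primrec.snd.comp Primrec.fst))
    have w : Primrec fun x : Memory α × Option (List (Fin 2 × α)) => x.2.getD [] :=
      Primrec.option_getD.comp Primrec.snd (Primrec.const [])
    have m : Primrec fun x : Memory α × Option (List (Fin 2 × α)) =>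
        merge p x.1.2.2.1.tail x.1.2.2.2.tail (x.2.getD []) :=
      (primrec_merge p).comp ((Primrec.list_tail.comp own).pair
        ((Primrec.list_tail.comp log).pair w))
    refine Primrec₂.to_comp (Primrec.ite (Primrec.eq.comp flag (Primrec.const true)) ?_ ?_)
    · exact Primrec.pair (Primrec.sumInr.comp (Primrec.sumInr.comp
        (Primrec.list_map m (Primrec.snd.comp Primrec.snd).to₂)))
        ((Primrec.const false).pair (own.pair (Primrec.list_append.comp
          (Primrec.list_take.comp (Primrec.const 1) log) m)))
    · exact (Primrec.const _).pair ((Primrec.const false).pair (own.pair log))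

theorem impl_isComputable : (impl α).IsComputable where
  prog := prog_isComputable
  objInit := Computable.const _
  regInit := Computable.const _

end Computability

end TwoProcess

/-! ### The steps of a process -/

namespace TwoProcess

section Trace

variable {α : Type} [Nonempty α]

/-- The steps of the implementation. -/
abbrev StepType (α : Type) : Type :=
  Act fetchAndAdd (fetchAndCons α) Unit (Fin 2 × ℕ) (List (Fin 2 × α))

variable (e : ℕ → Option (Fin 2 × StepType α))

/-- The value added by the `j`-th operation of process `p`. -/
noncomputable def opVal (p : Fin 2) (j : ℕ) : α :=
  Classical.epsilon fun v => ∃ k, StepAt e p (8 * j) k ∧ e k = some (p, .invoke v)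

/-- The reply of the fetch-and-add object to the `j`-th operation of process `p`. -/
noncomputable def faaReply (p : Fin 2) (j : ℕ) : ℤ :=
  Classical.epsilon fun r => ∃ k, StepAt e p (8 * j + 4) k ∧ e k = some (p, .replyObj () r)

/-- The reply of the register read in the `j`-th operation of process `p`. -/
noncomputable def readReply (p : Fin 2) (j : ℕ) : Option (List (Fin 2 × α)) :=
  Classical.epsilon fun w => ∃ k y, StepAt e p (8 * j + 6) k ∧ e k = some (p, .replyReg y w)

/-- The first `j` operations of process `p`. -/
noncomputable def ownOps (p : Fin 2) : ℕ → List (Fin 2 × α)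
  | 0 => []
  | j + 1 => (p, opVal e p j) :: ownOps p j

/-- The log of process `p` after `j` operations. -/
noncomputable def logAfter (p : Fin 2) : ℕ → List (Fin 2 × α)
  | 0 => []
  | j + 1 => (p, opVal e p j) :: merge p (ownOps e p j) (logAfter p j) ((readReply e p j).getD [])

/-- What process `p` announces in its `j`-th operation. -/
noncomputable def announcement (p : Fin 2) (j : ℕ) : List (Fin 2 × α) :=
  if p = 0 then (p, opVal e p j) :: logAfter e p j else ownOps e p (j + 1)

/-- The number of operations of the other process that the `j`-th operation of process `p` finds
before itself. -/
noncomputable def seen (p : Fin 2) (j : ℕ) : ℕ := (faaReply e p j).toNat - j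

@[simp] theorem ownOps_length (p : Fin 2) (j : ℕ) : (ownOps e p j).length = j := by
  induction j with
  | zero => rfl
  | succ j ih => simp [ownOps, ih]

/-- The state of process `p` before step `s` of its `j`-th operation. -/
def StateOf (p : Fin 2) (j s : ℕ) (x : Memory α × Phase) : Prop :=
  match s with
  | 0 => x.2 = .idle ∧ x.1.2.2 = (ownOps e p j, logAfter e p j)
  | 1 => x = ((.inr (.inl ((p, j + 1), some (announcement e p j))), false,
      ownOps e p (j + 1), (p, opVal e p j) :: logAfter e p j), .running)
  | 2 => x = ((.inr (.inl ((p, j + 1), some (announcement e p j))), false,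
      ownOps e p (j + 1), (p, opVal e p j) :: logAfter e p j), .waiting)
  | 3 => x = ((.inl ((), 1), false, ownOps e p (j + 1), (p, opVal e p j) :: logAfter e p j),
      .running)
  | 4 => x = ((.inl ((), 1), false, ownOps e p (j + 1), (p, opVal e p j) :: logAfter e p j),
      .waiting)
  | 5 => x = ((.inr (.inl ((1 - p, seen e p j), none)), true,
      ownOps e p (j + 1), (p, opVal e p j) :: logAfter e p j), .running)
  | 6 => x = ((.inr (.inl ((1 - p, seen e p j), none)), true,
      ownOps e p (j + 1), (p, opVal e p j) :: logAfter e p j), .waiting)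
  | _ => x = ((.inr (.inr ((logAfter e p (j + 1)).tail.map Prod.snd)), false,
      ownOps e p (j + 1), logAfter e p (j + 1)), .running)

/-- Step `s` of the `j`-th operation of process `p`. -/
def ActOf (p : Fin 2) (j s : ℕ) (a : StepType α) : Prop :=
  match s with
  | 0 => a = .invoke (opVal e p j)
  | 1 => a = .callReg (p, j + 1) (some (announcement e p j))
  | 2 => ∃ r, a = .replyReg (p, j + 1) r
  | 3 => a = .callObj () 1
  | 4 => a = .replyObj () (faaReply e p j)
  | 5 => a = .callReg (1 - p, seen e p j) none
  | 6 => a = .replyReg (1 - p, seen e p j) (readReply e p j)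
  | _ => a = .ret ((logAfter e p (j + 1)).tail.map Prod.snd)

variable {e}

theorem opVal_eq {p : Fin 2} {j k : ℕ} {v : α} (h : StepAt e p (8 * j) k)
    (hk : e k = some (p, .invoke v)) : opVal e p j = v := by
  obtain ⟨k', h', hk'⟩ := Classical.epsilon_spec
    (p := fun v => ∃ k, StepAt e p (8 * j) k ∧ e k = some (p, .invoke v)) ⟨v, k, h, hk⟩
  obtain rfl := h'.unique h
  simpa [opVal] using hk'.symm.trans hk

theorem faaReply_eq {p : Fin 2} {j k : ℕ} {r : ℤ} (h : StepAt e p (8 * j + 4) k)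
    (hk : e k = some (p, .replyObj () r)) : faaReply e p j = r := by
  obtain ⟨k', h', hk'⟩ := Classical.epsilon_spec
    (p := fun r => ∃ k, StepAt e p (8 * j + 4) k ∧ e k = some (p, .replyObj () r)) ⟨r, k, h, hk⟩
  obtain rfl := h'.unique h
  simpa [faaReply] using hk'.symm.trans hk

theorem readReply_eq {p : Fin 2} {j k : ℕ} {y : Fin 2 × ℕ} {w : Option (List (Fin 2 × α))}
    (h : StepAt e p (8 * j + 6) k) (hk : e k = some (p, .replyReg y w)) :
    readReply e p j = w := by
  obtain ⟨k', y', h', hk'⟩ := Classical.epsilon_spec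
    (p := fun w => ∃ k y, StepAt e p (8 * j + 6) k ∧ e k = some (p, .replyReg y w))
    ⟨w, k, y, h, hk⟩
  obtain rfl := h'.unique h
  have := hk'.symm.trans hk
  simp only [Option.some.injEq, Prod.mk.injEq, true_and, Act.replyReg.injEq] at this
  exact this.2

/-- An operation always consists of eight steps in a fixed order, so the number `8 * j + s` of steps
made determines what a process does next, up to values supplied by the environment. -/
theorem step_actOf {p : Fin 2} {j s k : ℕ} (hs : s < 8) {x x' : Memory α × Phase}
    {a : StepType α} (hx : StateOf e p j s x) (hstep : (prog p).Step x a x')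
    (hk : StepAt e p (8 * j + s) k) (ha : e k = some (p, a)) :
    ActOf e p j s a ∧
      (if s = 7 then StateOf e p (j + 1) 0 x' else StateOf e p j (s + 1) x') := by
  have hlen := ownOps_length e p j
  interval_cases s
  · obtain ⟨h₁, h₂⟩ := hx
    cases hstep <;> simp only [reduceCtorEq] at h₁
    rename_i s v
    have hv := opVal_eq hk ha
    simp only at h₂
    simp [ActOf, StateOf, hv, prog, h₂, ownOps, announcement]
  · simp only [StateOf] at hx
    subst hx
    cases hstep <;> simp_all [prog, ActOf, StateOf]
  · simp only [StateOf] at hx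
    subst hx
    cases hstep <;> simp_all [prog, ActOf, StateOf]
  · simp only [StateOf] at hx
    subst hx
    cases hstep <;> simp_all [prog, ActOf, StateOf]
  · simp only [StateOf] at hx
    subst hx
    cases hstep with
    | replyReg s y i r h => simp [prog] at h
    | replyObj s x i r h =>
      have hv := faaReply_eq hk ha
      simp [prog, ActOf, StateOf, hv, ownOps, seen]
  · simp only [StateOf] at hx
    subst hx
    cases hstep <;> simp_all [prog, ActOf, StateOf]
  · simp only [StateOf] at hx
    subst hx
    cases hstep with
    | replyObj s x i r h => simp [prog] at h
    | replyReg s y i r h =>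
      have hv := readReply_eq hk ha
      simp only [prog, Sum.inr.injEq, Sum.inl.injEq, Prod.mk.injEq] at h
      simp [prog, ActOf, StateOf, hv, ownOps, logAfter, ← h.1]
  · simp only [StateOf] at hx
    subst hx
    cases hstep <;> simp_all [prog, ActOf, StateOf]

theorem actOf_of_stepAt (he : (impl α).IsRun e) {p : Fin 2} {j s k : ℕ} (hs : s < 8)
    (hk : StepAt e p (8 * j + s) k) : ∃ a, e k = some (p, a) ∧ ActOf e p j s a := by
  obtain ⟨c, h₀, hnone, hsome⟩ := he
  have inv : ∀ k, ∃ j s, s < 8 ∧ stepCount e p k = 8 * j + s ∧ StateOf e p j s (c k p) := by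
    intro k
    induction k with
    | zero =>
      refine ⟨0, 0, by omega, stepCount_zero p, ?_⟩
      rw [h₀]
      simp [StateOf, impl, prog, ownOps, logAfter]
    | succ k ih =>
      obtain ⟨j, s, hs, hc, hst⟩ := ih
      rcases hek : e k with _ | ⟨q, a⟩
      · rw [hnone k hek, stepCount_succ_of_not_step (by simp [hek])]
        exact ⟨j, s, hs, hc, hst⟩
      · obtain ⟨h₁, h₂⟩ := hsome k q a hek
        by_cases hq : p = q
        · subst hq
          obtain ⟨-, h⟩ := step_actOf hs hst h₁ ⟨⟨a, hek⟩, hc⟩ hek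
          rw [stepCount_succ_of_step ⟨a, hek⟩]
          split_ifs at h with h7
          · exact ⟨j + 1, 0, by omega, by omega, h⟩
          · exact ⟨j, s + 1, by omega, by omega, h⟩
        · rw [h₂ p hq, stepCount_succ_of_not_step (by simp [hek, Ne.symm hq])]
          exact ⟨j, s, hs, hc, hst⟩
  obtain ⟨⟨a, ha⟩, hc⟩ := id hk
  obtain ⟨j', s', hs', hc', hst⟩ := inv k
  obtain rfl : j = j' := by omega
  obtain rfl : s = s' := by omega
  exact ⟨a, ha, (step_actOf hs hst (hsome k p a ha).1 hk ha).1⟩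

theorem stepAt_of_act (he : (impl α).IsRun e) {p : Fin 2} {k : ℕ} {a : StepType α}
    (h : e k = some (p, a)) : ∃ j s, s < 8 ∧ StepAt e p (8 * j + s) k ∧ ActOf e p j s a := by
  have hk : StepAt e p (8 * (stepCount e p k / 8) + stepCount e p k % 8) k :=
    ⟨⟨a, h⟩, by rw [Nat.div_add_mod]⟩
  have hs : stepCount e p k % 8 < 8 := Nat.mod_lt _ (by omega)
  obtain ⟨a', ha', hact⟩ := actOf_of_stepAt he hs hk
  rw [h] at ha'
  simp only [Option.some.injEq, Prod.mk.injEq, true_and] at ha'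
  exact ⟨_, _, hs, hk, ha' ▸ hact⟩

end Trace

end TwoProcess

/-! ### The histories of the objects -/

/-- Once the register holds `x` it keeps it, and a write completed before the read precedes it in
the linearization. -/
theorem Linearizable.read_eq {P V : Type} {H : History P (Option V) (Option V)} {v₀ x : V}
    (hH : Linearizable (registerADT V) v₀ H) (hw : ∀ k p v, H.Invoked k p (some v) → v = x)
    {k m : ℕ} {r : Option V} {p : P} (hr : H.Responds k m r) (hk : H.Invoked k p none)
    (hprev : (∃ k' m' r' p', H.Responds k' m' r' ∧ m' < k ∧ H.Invoked k' p' (some x)) ∨ v₀ = x) :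
    r = some x := by
  obtain ⟨-, S, hS⟩ := hH
  obtain ⟨s, h₀, hnone, hsome⟩ := hS.sequential.legal
  have hin : ∀ k, H.InSuffix 0 k := fun k => Nat.zero_le _
  have hstay : ∀ j, s j = x → s (j + 1) = x := by
    intro j hj
    rcases h : S j with _ | ⟨k', r'⟩
    · rw [hnone j h, hj]
    · obtain ⟨p', i, hi⟩ := hS.sequential.invoked j k' r' h
      rcases hsome j k' r' p' i h hi with ⟨-, -, h'⟩ | ⟨v, rfl, -, h'⟩
      · rw [h', hj]
      · rw [h', hw _ _ _ hi]
  have hmono : ∀ j j', j ≤ j' → s j = x → s j' = x := by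
    intro j j' hjj' hj
    induction j', hjj' using Nat.le_induction with
    | base => exact hj
    | succ j' _ ih => exact hstay _ ih
  obtain ⟨j, hj⟩ := hS.response k m r hr (hin m)
  have hsj : s j = x := by
    rcases hprev with ⟨k', m', r', p', hr', hlt, hk'⟩ | hx
    · obtain ⟨j', hj'⟩ := hS.response k' m' r' hr' (hin m')
      have hord := hS.order k' m' r' k hr' hlt (hin _) (hin _) _ _ _ _ hj' hj
      refine hmono (j' + 1) j hord ?_
      rcases hsome j' k' r' p' _ hj' hk' with ⟨h, -⟩ | ⟨v, h, -, h'⟩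
      · cases h
      · rw [h', ← Option.some_inj.1 h]
    · exact hmono 0 j (Nat.zero_le _) (h₀.trans hx)
  rcases hsome j k r p _ hj hk with ⟨-, h, -⟩ | ⟨v, h, -⟩
  · rw [h, hsj]
  · cases h

namespace TwoProcess

section Histories

variable {α : Type} [Nonempty α] {e : ℕ → Option (Fin 2 × StepType α)}

/-- The response to the `j`-th operation of process `p`. -/
noncomputable def opResp (e : ℕ → Option (Fin 2 × StepType α)) (p : Fin 2) (j : ℕ) : List α :=
  (logAfter e p (j + 1)).tail.map Prod.snd

variable (he : (impl α).IsRun e)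
include he

theorem implHistory_inv_iff {k : ℕ} {p : Fin 2} {v : α} :
    implHistory e k = some (.inv p v) ↔ ∃ j, StepAt e p (8 * j) k ∧ v = opVal e p j := by
  constructor
  · intro h
    rcases hk : e k with _ | ⟨q, a⟩
    · simp [implHistory, hk] at h
    · obtain ⟨j, s, hs, hst, hact⟩ := stepAt_of_act he hk
      cases a <;> simp [implHistory, hk] at h
      obtain ⟨rfl, rfl⟩ := h
      interval_cases s <;> simp [ActOf] at hact
      exact ⟨j, hst, hact⟩
  · rintro ⟨j, hst, rfl⟩
    obtain ⟨a, ha, hact⟩ := actOf_of_stepAt (s := 0) he (by omega) hst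
    obtain rfl := hact
    simp [implHistory, ha]

theorem implHistory_res_iff {k : ℕ} {p : Fin 2} {r : List α} :
    implHistory e k = some (.res p r) ↔ ∃ j, StepAt e p (8 * j + 7) k ∧ r = opResp e p j := by
  constructor
  · intro h
    rcases hk : e k with _ | ⟨q, a⟩
    · simp [implHistory, hk] at h
    · obtain ⟨j, s, hs, hst, hact⟩ := stepAt_of_act he hk
      cases a <;> simp [implHistory, hk] at h
      obtain ⟨rfl, rfl⟩ := h
      interval_cases s <;> simp [ActOf] at hact
      exact ⟨j, hst, by rw [hact]; simp [opResp]⟩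
  · rintro ⟨j, hst, rfl⟩
    obtain ⟨a, ha, hact⟩ := actOf_of_stepAt (s := 7) he (by omega) hst
    obtain rfl := hact
    simp [implHistory, ha, opResp]

theorem objHistory_inv_iff {k : ℕ} {p : Fin 2} {v : ℤ} :
    objHistory e () k = some (.inv p v) ↔ ∃ j, StepAt e p (8 * j + 3) k ∧ v = 1 := by
  constructor
  · intro h
    rcases hk : e k with _ | ⟨q, a⟩
    · simp [objHistory, hk] at h
    · obtain ⟨j, s, hs, hst, hact⟩ := stepAt_of_act he hk
      cases a <;> simp [objHistory, hk] at h
      obtain ⟨rfl, rfl⟩ := h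
      interval_cases s <;> simp [ActOf] at hact
      exact ⟨j, hst, hact⟩
  · rintro ⟨j, hst, rfl⟩
    obtain ⟨a, ha, hact⟩ := actOf_of_stepAt (s := 3) he (by omega) hst
    obtain rfl := hact
    simp [objHistory, ha]

theorem objHistory_res_iff {k : ℕ} {p : Fin 2} {r : ℤ} :
    objHistory e () k = some (.res p r) ↔
      ∃ j, StepAt e p (8 * j + 4) k ∧ r = faaReply e p j := by
  constructor
  · intro h
    rcases hk : e k with _ | ⟨q, a⟩
    · simp [objHistory, hk] at h
    · obtain ⟨j, s, hs, hst, hact⟩ := stepAt_of_act he hk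
      cases a <;> simp [objHistory, hk] at h
      obtain ⟨rfl, rfl⟩ := h
      interval_cases s <;> simp [ActOf] at hact
      exact ⟨j, hst, hact⟩
  · rintro ⟨j, hst, rfl⟩
    obtain ⟨a, ha, hact⟩ := actOf_of_stepAt (s := 4) he (by omega) hst
    obtain rfl := hact
    simp [objHistory, ha]

theorem regHistory_write_iff {y : Fin 2 × ℕ} {k : ℕ} {p : Fin 2} {v : List (Fin 2 × α)} :
    regHistory e y k = some (.inv p (some v)) ↔
      ∃ j, StepAt e p (8 * j + 1) k ∧ y = (p, j + 1) ∧ v = announcement e p j := by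
  constructor
  · intro h
    rcases hk : e k with _ | ⟨q, a⟩
    · simp [regHistory, hk] at h
    · obtain ⟨j, s, hs, hst, hact⟩ := stepAt_of_act he hk
      cases a <;> simp [regHistory, hk] at h
      obtain ⟨rfl, rfl, rfl⟩ := h
      interval_cases s <;> simp [ActOf] at hact
      exact ⟨j, hst, hact⟩
  · rintro ⟨j, hst, rfl, rfl⟩
    obtain ⟨a, ha, hact⟩ := actOf_of_stepAt (s := 1) he (by omega) hst
    obtain rfl := hact
    simp [regHistory, ha]

theorem regHistory_read_iff {y : Fin 2 × ℕ} {k : ℕ} {p : Fin 2} :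
    regHistory e y k = some (.inv p none) ↔
      ∃ j, StepAt e p (8 * j + 5) k ∧ y = (1 - p, seen e p j) := by
  constructor
  · intro h
    rcases hk : e k with _ | ⟨q, a⟩
    · simp [regHistory, hk] at h
    · obtain ⟨j, s, hs, hst, hact⟩ := stepAt_of_act he hk
      cases a <;> simp [regHistory, hk] at h
      obtain ⟨rfl, rfl, rfl⟩ := h
      interval_cases s <;> simp [ActOf] at hact
      exact ⟨j, hst, hact⟩
  · rintro ⟨j, hst, rfl⟩
    obtain ⟨a, ha, hact⟩ := actOf_of_stepAt (s := 5) he (by omega) hst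
    obtain rfl := hact
    simp [regHistory, ha]

theorem regHistory_responds_of_write {p : Fin 2} {j k m : ℕ} (hk : StepAt e p (8 * j + 1) k)
    (hm : StepAt e p (8 * j + 2) m) : ∃ r, (regHistory e (p, j + 1)).Responds k m r := by
  obtain ⟨a, ha, hact⟩ := actOf_of_stepAt (s := 2) he (by omega) hm
  obtain ⟨r, rfl⟩ := hact
  refine ⟨r, (hk.lt_iff hm).1 (by omega), p, _,
    (regHistory_write_iff he).2 ⟨j, hk, rfl, rfl⟩, by simp [regHistory, ha], ?_⟩
  intro t h₁ h₂ ev hev hp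
  have hst : ∃ a, e t = some (p, a) := by
    rcases ht : e t with _ | ⟨q, a⟩
    · simp [regHistory, ht] at hev
    · cases a <;> simp [regHistory, ht] at hev
      all_goals
        obtain ⟨-, rfl⟩ := hev
        simp [Event.proc] at hp
        simp [hp]
  have := ((hk.lt_iff (show StepAt e p _ t from ⟨hst, rfl⟩)).2 h₁)
  have := (((show StepAt e p _ t from ⟨hst, rfl⟩)).lt_iff hm).2 h₂
  omega

theorem regHistory_responds_of_read {p : Fin 2} {j k m : ℕ} (hk : StepAt e p (8 * j + 5) k)
    (hm : StepAt e p (8 * j + 6) m) :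
    (regHistory e (1 - p, seen e p j)).Responds k m (readReply e p j) := by
  obtain ⟨a, ha, hact⟩ := actOf_of_stepAt (s := 6) he (by omega) hm
  obtain rfl := hact
  refine ⟨(hk.lt_iff hm).1 (by omega), p, _,
    (regHistory_read_iff he).2 ⟨j, hk, rfl⟩, by simp [regHistory, ha], ?_⟩
  intro t h₁ h₂ ev hev hp
  have hst : ∃ a, e t = some (p, a) := by
    rcases ht : e t with _ | ⟨q, a⟩
    · simp [regHistory, ht] at hev
    · cases a <;> simp [regHistory, ht] at hev
      all_goals
        obtain ⟨-, rfl⟩ := hev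
        simp [Event.proc] at hp
        simp [hp]
  have := ((hk.lt_iff (show StepAt e p _ t from ⟨hst, rfl⟩)).2 h₁)
  have := (((show StepAt e p _ t from ⟨hst, rfl⟩)).lt_iff hm).2 h₂
  omega

theorem objHistory_responds_iff {k m : ℕ} {r : ℤ} :
    (objHistory e ()).Responds k m r ↔
      ∃ p j, StepAt e p (8 * j + 3) k ∧ StepAt e p (8 * j + 4) m ∧ r = faaReply e p j := by
  constructor
  · rintro ⟨hkm, p, i, hk, hm, hb⟩
    obtain ⟨j, hj, -⟩ := (objHistory_inv_iff he).1 hk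
    obtain ⟨j', hj', rfl⟩ := (objHistory_res_iff he).1 hm
    refine ⟨p, j, hj, ?_⟩
    have h₁ := (hj.lt_iff hj').2 hkm
    rcases Nat.lt_or_ge j j' with hlt | hge
    · obtain ⟨t, ht, hst⟩ := hj'.exists_earlier (show 8 * j + 4 < 8 * j' + 4 by omega)
      exact absurd rfl (hb t ((hj.lt_iff hst).1 (by omega)) ht _
        ((objHistory_res_iff he).2 ⟨j, hst, rfl⟩))
    · obtain rfl : j' = j := by omega
      exact ⟨hj', rfl⟩
  · rintro ⟨p, j, hk, hm, rfl⟩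
    refine ⟨(hk.lt_iff hm).1 (by omega), p, _, (objHistory_inv_iff he).2 ⟨j, hk, rfl⟩,
      (objHistory_res_iff he).2 ⟨j, hm, rfl⟩, ?_⟩
    intro t h₁ h₂ ev hev hp
    cases ev with
    | inv q i =>
      obtain rfl : q = p := hp
      obtain ⟨j', hst, -⟩ := (objHistory_inv_iff he).1 hev
      have := (hk.lt_iff hst).2 h₁
      have := (hst.lt_iff hm).2 h₂
      omega
    | res q i =>
      obtain rfl : q = p := hp
      obtain ⟨j', hst, -⟩ := (objHistory_res_iff he).1 hev
      have := (hk.lt_iff hst).2 h₁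
      have := (hst.lt_iff hm).2 h₂
      omega

theorem implHistory_responds_iff {k m : ℕ} {r : List α} :
    (implHistory e).Responds k m r ↔
      ∃ p j, StepAt e p (8 * j) k ∧ StepAt e p (8 * j + 7) m ∧ r = opResp e p j := by
  constructor
  · rintro ⟨hkm, p, i, hk, hm, hb⟩
    obtain ⟨j, hj, -⟩ := (implHistory_inv_iff he).1 hk
    obtain ⟨j', hj', rfl⟩ := (implHistory_res_iff he).1 hm
    refine ⟨p, j, hj, ?_⟩
    have h₁ := (hj.lt_iff hj').2 hkm
    rcases Nat.lt_or_ge j j' with hlt | hge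
    · obtain ⟨t, ht, hst⟩ := hj'.exists_earlier (show 8 * j + 7 < 8 * j' + 7 by omega)
      exact absurd rfl (hb t ((hj.lt_iff hst).1 (by omega)) ht _
        ((implHistory_res_iff he).2 ⟨j, hst, rfl⟩))
    · obtain rfl : j' = j := by omega
      exact ⟨hj', rfl⟩
  · rintro ⟨p, j, hk, hm, rfl⟩
    refine ⟨(hk.lt_iff hm).1 (by omega), p, _, (implHistory_inv_iff he).2 ⟨j, hk, rfl⟩,
      (implHistory_res_iff he).2 ⟨j, hm, rfl⟩, ?_⟩
    intro t h₁ h₂ ev hev hp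
    cases ev with
    | inv q i =>
      obtain rfl : q = p := hp
      obtain ⟨j', hst, -⟩ := (implHistory_inv_iff he).1 hev
      have := (hk.lt_iff hst).2 h₁
      have := (hst.lt_iff hm).2 h₂
      omega
    | res q i =>
      obtain rfl : q = p := hp
      obtain ⟨j', hst, -⟩ := (implHistory_res_iff he).1 hev
      have := (hk.lt_iff hst).2 h₁
      have := (hst.lt_iff hm).2 h₂
      omega

theorem implHistory_wellFormed : (implHistory e).WellFormed := by
  constructor
  · intro m p r hm
    obtain ⟨j, hj, rfl⟩ := (implHistory_res_iff he).1 hm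
    obtain ⟨k, -, hk⟩ := hj.exists_earlier (show 8 * j < 8 * j + 7 by omega)
    exact ⟨k, (implHistory_responds_iff he).2 ⟨p, j, hk, hj, rfl⟩⟩
  · intro k k' p i i' hk hk' hlt
    obtain ⟨j, hj, -⟩ := (implHistory_inv_iff he).1 hk
    obtain ⟨j', hj', -⟩ := (implHistory_inv_iff he).1 hk'
    have := (hj.lt_iff hj').2 hlt
    obtain ⟨m, hm, hst⟩ := hj'.exists_earlier (show 8 * j + 7 < 8 * j' by omega)
    exact ⟨m, _, hm, (implHistory_responds_iff he).2 ⟨p, j, hj, hst, rfl⟩⟩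

end Histories

theorem exists_stepAt_of_infinite {α : Type} {e : ℕ → Option (Fin 2 × StepType α)} {p : Fin 2}
    (hp : ∀ N, ∃ k, N ≤ k ∧ ∃ a, e k = some (p, a)) (i : ℕ) : ∃ k, StepAt e p i k := by
  have h : ∀ i, ∃ k, i < stepCount e p k := by
    intro i
    induction i with
    | zero =>
      obtain ⟨k, -, hk⟩ := hp 0
      exact ⟨k + 1, by rw [stepCount_succ_of_step hk]; omega⟩
    | succ i ih =>
      obtain ⟨N, hN⟩ := ih
      obtain ⟨k, hk, hst⟩ := hp N
      have := stepCount_mono (e := e) p hk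
      exact ⟨k + 1, by rw [stepCount_succ_of_step hst]; omega⟩
  obtain ⟨k, hk⟩ := h i
  obtain ⟨k', -, h'⟩ := exists_stepAt_of_lt_stepCount hk
  exact ⟨k', h'⟩

theorem impl_waitFree (α : Type) [Nonempty α] : (impl α).WaitFree := by
  intro e he p hp k a hk
  obtain ⟨j, hj, -⟩ := (implHistory_inv_iff he.run (k := k) (p := p) (v := a)).1 (by simp [implHistory, hk])
  obtain ⟨m, hm⟩ := exists_stepAt_of_infinite hp (8 * j + 7)
  obtain ⟨b, hb, rfl⟩ := actOf_of_stepAt (s := 7) he.run (by omega) hm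
  exact ⟨m, _, (hj.lt_iff hm).1 (by omega), hb⟩

end TwoProcess

/-! ### The replies of the fetch-and-add object and of the registers -/

namespace TwoProcess

variable {α : Type} [Nonempty α] {e : ℕ → Option (Fin 2 × StepType α)}

/-- Place `j` of the sequential history `S` is taken by the increment of the `i`-th operation of
process `p`. -/
def IncrementAt (e : ℕ → Option (Fin 2 × StepType α)) (S : ℕ → Option (ℕ × ℤ)) (j : ℕ) (p : Fin 2)
    (i : ℕ) : Prop :=
  ∃ k r, S j = some (k, r) ∧ StepAt e p (8 * i + 3) k

open Classical in
/-- The replies in a legal sequential history are the numbers of the preceding increments. -/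
theorem exists_preceding (he : (impl α).IsRun e) {S : ℕ → Option (ℕ × ℤ)}
    (hS : IsLegalSequential fetchAndAdd (0 : ℤ) (objHistory e ()) S) :
    ∃ F : ℕ → Finset (Fin 2 × ℕ),
      (∀ j p i, (p, i) ∈ F j ↔ ∃ j' < j, IncrementAt e S j' p i) ∧
      ∀ j k r, S j = some (k, r) → r = (F j).card := by
  obtain ⟨s, h₀, hnone, hsome⟩ := hS.legal
  have key : ∀ j, ∃ F : Finset (Fin 2 × ℕ), (∀ p i, (p, i) ∈ F ↔ ∃ j' < j, IncrementAt e S j' p i) ∧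
      s j = (F.card : ℤ) := by
    intro j
    induction j with
    | zero => exact ⟨∅, by simp, by simp [h₀]⟩
    | succ j ih =>
      obtain ⟨F, hF, hs⟩ := ih
      rcases h : S j with _ | ⟨k, r⟩
      · refine ⟨F, fun p i => ?_, by rw [hnone j h, hs]⟩
        rw [hF]
        constructor
        · rintro ⟨j', hj', hat⟩
          exact ⟨j', by omega, hat⟩
        · rintro ⟨j', hj', hat⟩
          refine ⟨j', ?_, hat⟩
          rcases Nat.lt_or_eq_of_le (Nat.le_of_lt_succ hj') with h' | rfl
          · exact h'
          · obtain ⟨k, r, hk, -⟩ := hat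
            rw [h] at hk
            cases hk
      · obtain ⟨p, i, hk⟩ := hS.invoked j k r h
        obtain ⟨-, hstep⟩ := hsome j k r p i h hk
        obtain ⟨i', hi', rfl⟩ := (objHistory_inv_iff he).1 hk
        have huniq : ∀ p' i'', StepAt e p' (8 * i'' + 3) k → p' = p ∧ i'' = i' := by
          intro p' i'' hst
          obtain ⟨⟨a, ha⟩, h₁⟩ := hst
          obtain ⟨⟨b, hb⟩, h₂⟩ := hi'
          rw [ha] at hb
          simp only [Option.some.injEq, Prod.mk.injEq] at hb
          obtain ⟨rfl, -⟩ := hb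
          exact ⟨rfl, by omega⟩
        refine ⟨insert (p, i') F, fun p' i'' => ?_, ?_⟩
        · rw [Finset.mem_insert, hF, Prod.mk.injEq]
          constructor
          · rintro (⟨rfl, rfl⟩ | ⟨j', hj', hat⟩)
            · exact ⟨j, by omega, k, r, h, hi'⟩
            · exact ⟨j', by omega, hat⟩
          · rintro ⟨j', hj', hat⟩
            rcases Nat.lt_or_eq_of_le (Nat.le_of_lt_succ hj') with h' | rfl
            · exact Or.inr ⟨j', h', hat⟩
            · obtain ⟨k', r', hk', hst⟩ := hat
              rw [h] at hk'
              simp only [Option.some.injEq, Prod.mk.injEq] at hk'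
              obtain ⟨rfl, rfl⟩ := hk'
              exact Or.inl (huniq _ _ hst)
        · rw [Finset.card_insert_of_notMem, hstep, hs]
          · push_cast; rfl
          · rw [hF]
            rintro ⟨j', hj', k', r', hk', hst⟩
            obtain rfl := hst.unique hi'
            have := hS.once _ _ _ _ _ h hk'
            omega
  choose F hF hs using key
  refine ⟨F, hF, fun j k r h => ?_⟩
  obtain ⟨p, i, hk⟩ := hS.invoked j k r h
  rw [← hs]
  exact (hsome j k r p i h hk).1

theorem fin_two_eq_or {p q : Fin 2} : q = p ∨ q = 1 - p := by
  revert p q; decide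

theorem fin_two_sub_ne {p : Fin 2} : 1 - p ≠ p := by
  revert p; decide

open Classical in
/-- If the increments of `p` in `F` are exactly the first `j` ones, then the others are the
increments of the other process. -/
theorem card_eq_add_of_own {F : Finset (Fin 2 × ℕ)} {p : Fin 2} {j : ℕ}
    (h : ∀ i, (p, i) ∈ F ↔ i < j) :
    F.card = j + ((F.filter fun x => x.1 = 1 - p).image Prod.snd).card := by
  rw [← Finset.card_filter_add_card_filter_not (s := F) (fun x => x.1 = p)]
  congr 1
  · have : F.filter (fun x => x.1 = p) = (Finset.range j).image (fun i => (p, i)) := by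
      ext ⟨q, i⟩
      simp only [Finset.mem_filter, Finset.mem_image, Finset.mem_range, Prod.mk.injEq]
      constructor
      · rintro ⟨hF, rfl⟩
        exact ⟨i, (h i).1 hF, rfl, rfl⟩
      · rintro ⟨i', hi', rfl, rfl⟩
        exact ⟨(h _).2 hi', rfl⟩
    rw [this, Finset.card_image_of_injective _ (fun a b hab => by simpa using hab),
      Finset.card_range]
  · rw [Finset.card_image_of_injOn]
    · congr 1
      ext x
      simp only [Finset.mem_filter]
      refine and_congr_right fun _ => ?_
      rcases fin_two_eq_or (p := p) (q := x.1) with hx | hx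
      · simp [hx, fin_two_sub_ne.symm]
      · simp [hx, fin_two_sub_ne]
    · rintro ⟨q, i⟩ hx ⟨q', i'⟩ hx' heq
      simp only [Finset.coe_filter, Set.mem_ofPred_eq] at hx hx'
      simp only at heq
      rw [hx.2, hx'.2, heq]

open Classical in
theorem seen_of_preceding {F : Finset (Fin 2 × ℕ)} {p : Fin 2} {j : ℕ}
    (h : ∀ i, (p, i) ∈ F ↔ i < j) (hr : faaReply e p j = F.card) :
    seen e p j = ((F.filter fun x => x.1 = 1 - p).image Prod.snd).card := by
  rw [seen, hr, Int.toNat_natCast, card_eq_add_of_own h, Nat.add_sub_cancel_left]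

/-- Only increments that have been invoked are counted. -/
theorem exists_increment_of_lt_seen (he : (impl α).IsExecution e) {p : Fin 2} {j m i : ℕ}
    (hm : StepAt e p (8 * j + 4) m) (hi : i < seen e p j) :
    ∃ k < m, StepAt e (1 - p) (8 * i + 3) k := by
  classical
  obtain ⟨k, hkm, hk⟩ := hm.exists_earlier (show 8 * j + 3 < 8 * j + 4 by omega)
  -- Weak consistency is used because the reply may come before the object stabilizes. The
  -- explanation has exactly `j` own increments before the last place; the remaining count refers to
  -- increments of the other process that have been invoked.
  obtain ⟨S, hS, hlt, hown, j₀, hj₀, hlast⟩ := (he.obj ()).2.1 k m (faaReply e p j) p 1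
    ((objHistory_inv_iff he.run).2 ⟨j, hk, rfl⟩)
    ((objHistory_responds_iff he.run).2 ⟨p, j, hk, hm, rfl⟩)
  obtain ⟨F, hF, hcard⟩ := exists_preceding he.run hS
  have hF' : ∀ i, (p, i) ∈ F j₀ ↔ i < j := by
    intro i
    rw [hF]
    constructor
    · rintro ⟨j', hj', k', r', hk', hst⟩
      have h₁ := (hst.lt_iff hm).2 (hlt _ _ _ hk')
      rcases Nat.lt_or_ge i j with h | h
      · exact h
      · obtain rfl : i = j := by omega
        obtain rfl := hst.unique hk
        have := hS.once _ _ _ _ _ hk' hj₀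
        omega
    · intro hij
      obtain ⟨k', hk', hst⟩ := hk.exists_earlier (show 8 * i + 3 < 8 * j + 3 by omega)
      obtain ⟨j', r', hj'⟩ := hown k' 1 ((objHistory_inv_iff he.run).2 ⟨i, hst, rfl⟩) hk'
      refine ⟨j', ?_, k', r', hj', hst⟩
      by_contra hge
      rcases Nat.lt_or_eq_of_le (not_lt.1 hge) with h | rfl
      · rw [hlast j' h] at hj'
        cases hj'
      · rw [hj₀] at hj'
        simp only [Option.some.injEq, Prod.mk.injEq] at hj'
        omega
  have hs := seen_of_preceding hF' (hcard _ _ _ hj₀)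
  rw [hs] at hi
  -- More than `i` distinct indices cannot all be below `i`; an increment with index at least `i`
  -- implies that the `i`-th one was invoked.
  obtain ⟨i', hi', hle⟩ : ∃ i' ∈ ((F j₀).filter fun x => x.1 = 1 - p).image Prod.snd, i ≤ i' := by
    by_contra! hno
    have := Finset.card_le_card (t := Finset.range i) (fun x hx => Finset.mem_range.2 (hno x hx))
    rw [Finset.card_range] at this
    omega
  obtain ⟨⟨q, i''⟩, hmem, rfl⟩ := Finset.mem_image.1 hi'
  obtain ⟨hmem, rfl⟩ := Finset.mem_filter.1 hmem
  obtain ⟨j', -, k', r', hj', hst⟩ := (hF _ _ _).1 hmem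
  have hk' := hlt _ _ _ hj'
  rcases Nat.lt_or_eq_of_le hle with h | h
  · obtain ⟨k'', hk'', hst'⟩ := hst.exists_earlier (show 8 * i + 3 < 8 * i'' + 3 by omega)
    exact ⟨k'', by omega, hst'⟩
  · exact ⟨k', hk', by rw [h]; exact hst⟩

/-- An increment that is counted was invoked after its announcement had been written, and each
register receives at most one value; register `0` receives none. -/
theorem readReply_of_stepAt (he : (impl α).IsExecution e) {p : Fin 2} {j m : ℕ}
    (hm : StepAt e p (8 * j + 6) m) :
    (seen e p j = 0 → readReply e p j = some []) ∧
      ∀ i, seen e p j = i + 1 → readReply e p j = some (announcement e (1 - p) i) := by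
  obtain ⟨k, -, hk⟩ := hm.exists_earlier (show 8 * j + 5 < 8 * j + 6 by omega)
  obtain ⟨k₄, -, hk₄⟩ := hm.exists_earlier (show 8 * j + 4 < 8 * j + 6 by omega)
  have hr := regHistory_responds_of_read he.run hk hm
  have hread := (regHistory_read_iff he.run).2 ⟨j, hk, rfl⟩
  constructor
  · intro h0
    refine (he.reg _).read_eq (x := []) (fun k' p' v hv => ?_) hr hread (Or.inr rfl)
    obtain ⟨j', -, hy, -⟩ := (regHistory_write_iff he.run).1 hv
    rw [Prod.mk.injEq] at hy
    omega
  · intro i hi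
    obtain ⟨k₃, hlt, hk₃⟩ := exists_increment_of_lt_seen he hk₄ (show i < seen e p j by omega)
    obtain ⟨k₂, hlt₂, hk₂⟩ := hk₃.exists_earlier (show 8 * i + 2 < 8 * i + 3 by omega)
    obtain ⟨k₁, -, hk₁⟩ := hk₂.exists_earlier (show 8 * i + 1 < 8 * i + 2 by omega)
    obtain ⟨r, hw⟩ := regHistory_responds_of_write he.run hk₁ hk₂
    have hlt₄ := (hk₄.lt_iff hk).1 (by omega)
    refine (he.reg _).read_eq (fun k' p' v hv => ?_) hr hread
      (Or.inl ⟨k₁, k₂, r, 1 - p, by rw [hi]; exact hw, by omega,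
        (regHistory_write_iff he.run).2 ⟨i, hk₁, by rw [hi], rfl⟩⟩)
    obtain ⟨j', -, hy, rfl⟩ := (regHistory_write_iff he.run).1 hv
    rw [Prod.mk.injEq] at hy
    obtain ⟨rfl, h⟩ := hy
    rw [show j' = i by omega]

/-! ### The eventual order of the increments -/

/-- Process `p` takes infinitely many steps. -/
def Active (e : ℕ → Option (Fin 2 × StepType α)) (p : Fin 2) : Prop :=
  ∀ i, ∃ k, StepAt e p i k

theorem exists_finite_bound (p : Fin 2) (h : ¬ Active e p) : ∃ i, ∀ i' k, StepAt e p i' k → i' < i := by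
  unfold Active at h
  push Not at h
  obtain ⟨i, hi⟩ := h
  refine ⟨i, fun i' k hk => ?_⟩
  by_contra hge
  rcases Nat.lt_or_eq_of_le (not_lt.1 hge) with h' | rfl
  · obtain ⟨k', -, hk'⟩ := hk.exists_earlier h'
    exact hi k' hk'
  · exact hi k hk

/-- The places of the increments of an active process in a linearization of the fetch-and-add
history. -/
structure Places (e : ℕ → Option (Fin 2 × StepType α)) (F : ℕ → Finset (Fin 2 × ℕ)) (p : Fin 2)
    (g : ℕ) (pos : ℕ → ℕ) : Prop where
  mem : ∀ i j, (p, i) ∈ F j ↔ pos i < j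
  mono : ∀ i i', g ≤ i → i < i' → pos i < pos i'
  seen : ∃ N, ∀ j ≥ N, seen e p j =
    (((F (pos j)).filter fun x => x.1 = 1 - p).image Prod.snd).card

theorem le_of_strictMono_from {f : ℕ → ℕ} {g : ℕ} (h : ∀ i i', g ≤ i → i < i' → f i < f i')
    {j : ℕ} (hj : g ≤ j) : j - g ≤ f j := by
  induction j, hj using Nat.le_induction with
  | base => omega
  | succ j hj ih =>
    have := h j (j + 1) hj (by omega)
    omega

theorem Places.eventually_gt {F : ℕ → Finset (Fin 2 × ℕ)} {p : Fin 2} {g : ℕ}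
    {pos : ℕ → ℕ} (h : Places e F p g pos) (B : ℕ) : ∃ N, ∀ j ≥ N, B < pos j := by
  refine ⟨g + B + 1, fun j hj => ?_⟩
  have := le_of_strictMono_from h.mono (show g ≤ j by omega)
  omega

open Classical in
/-- A single order of the increments which the fetch-and-add object respects from some time on. -/
theorem exists_places (he : (impl α).IsExecution e) :
    ∃ F : ℕ → Finset (Fin 2 × ℕ), Monotone F ∧
      (∀ q i k, StepAt e q (8 * i + 4) k → ∃ j, (q, i) ∈ F j) ∧
      (∀ j q i, (q, i) ∈ F j → ∃ k, StepAt e q (8 * i + 3) k) ∧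
      ∃ pos : Fin 2 → ℕ → ℕ, ∃ T₀, (∀ p, Active e p → ∃ g, Places e F p g (pos p)) ∧
        (∀ p q, Active e p → Active e q → ∀ i j, pos p i = pos q j → p = q) ∧
        ∀ p q, Active e p → Active e q → ∀ i j k m, StepAt e p (8 * i + 4) m → T₀ ≤ m →
          StepAt e q (8 * j + 3) k → m < k → pos p i < pos q j := by
  obtain ⟨-, -, t, S, hS⟩ := he.obj ()
  obtain ⟨F, hF, hcard⟩ := exists_preceding he.run hS.sequential
  obtain ⟨T₀, hT⟩ := (objHistory e ()).exists_forall_inSuffix t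
  have hplace : ∀ q i, ∃ j, ∀ k m, StepAt e q (8 * i + 3) k → StepAt e q (8 * i + 4) m →
      ∃ r, S j = some (k, r) ∧ (T₀ ≤ m → r = faaReply e q i) := by
    intro q i
    by_cases h : ∃ m, StepAt e q (8 * i + 4) m
    · obtain ⟨m, hm⟩ := h
      obtain ⟨k, -, hk⟩ := hm.exists_earlier (show 8 * i + 3 < 8 * i + 4 by omega)
      have hr := (objHistory_responds_iff he.run).2 ⟨q, i, hk, hm, rfl⟩
      by_cases hT₀ : T₀ ≤ m
      · obtain ⟨j, hj⟩ := hS.response _ _ _ hr (hT m hT₀ (by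
          rw [(objHistory_res_iff he.run).2 ⟨i, hm, rfl⟩]; rfl))
        refine ⟨j, fun k' m' hk' hm' => ?_⟩
        obtain rfl := hk.unique hk'
        exact ⟨_, hj, fun _ => rfl⟩
      · obtain ⟨j, r, hj⟩ := hS.completed _ _ _ hr
        refine ⟨j, fun k' m' hk' hm' => ?_⟩
        obtain rfl := hk.unique hk'
        obtain rfl := hm.unique hm'
        exact ⟨r, hj, fun h => absurd h hT₀⟩
    -- The place of an increment that never completes is irrelevant.
    · exact ⟨0, fun k m _ hm => absurd ⟨m, hm⟩ h⟩
  choose pos hpos using hplace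
  have hat : ∀ p i, Active e p → IncrementAt e S (pos p i) p i := by
    intro p i hp
    obtain ⟨k, hk⟩ := hp (8 * i + 3)
    obtain ⟨m, hm⟩ := hp (8 * i + 4)
    obtain ⟨r, hr, -⟩ := hpos p i k m hk hm
    exact ⟨k, r, hr, hk⟩
  have hatu : ∀ p i j j', IncrementAt e S j p i → IncrementAt e S j' p i → j = j' := by
    rintro p i j j' ⟨k, r, h, hst⟩ ⟨k', r', h', hst'⟩
    obtain rfl := hst.unique hst'
    exact hS.sequential.once _ _ _ _ _ h h'
  have hord : ∀ p q, Active e p → Active e q → ∀ i j k m, StepAt e p (8 * i + 4) m → T₀ ≤ m →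
      StepAt e q (8 * j + 3) k → m < k → pos p i < pos q j := by
    intro p q hp hq i j k m hm hTm hk hmk
    obtain ⟨k', -, hk'⟩ := hm.exists_earlier (show 8 * i + 3 < 8 * i + 4 by omega)
    obtain ⟨r, hr, -⟩ := hpos p i k' m hk' hm
    obtain ⟨m', hm'⟩ := hq (8 * j + 4)
    obtain ⟨r', hr', -⟩ := hpos q j k m' hk hm'
    refine hS.order k' m _ k ((objHistory_responds_iff he.run).2 ⟨p, i, hk', hm, rfl⟩) hmk
      (hT m hTm ?_) (hT k (by omega) ?_) _ _ _ _ hr hr'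
    · rw [(objHistory_res_iff he.run).2 ⟨i, hm, rfl⟩]; rfl
    · rw [(objHistory_inv_iff he.run).2 ⟨j, hk, rfl⟩]; rfl
  refine ⟨F, ?_, ?_, ?_, pos, T₀, ?_, ?_, hord⟩
  · intro j j' hjj' ⟨q, i⟩ h
    rw [hF] at h ⊢
    obtain ⟨j'', hlt, h⟩ := h
    exact ⟨j'', by omega, h⟩
  · intro q i m hm
    obtain ⟨k, -, hk⟩ := hm.exists_earlier (show 8 * i + 3 < 8 * i + 4 by omega)
    obtain ⟨r, hr, -⟩ := hpos q i k m hk hm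
    exact ⟨pos q i + 1, (hF _ _ _).2 ⟨pos q i, by omega, k, r, hr, hk⟩⟩
  · intro j q i h
    obtain ⟨j', -, k, r, -, hk⟩ := (hF _ _ _).1 h
    exact ⟨k, hk⟩
  · intro p hp
    obtain ⟨g, hg⟩ : ∃ g, ∀ i ≥ g, ∀ m, StepAt e p (8 * i + 4) m → T₀ ≤ m := by
      -- The reply to the `i`-th increment is step `8 * i + 4` of its process, hence occurs no
      -- earlier than time `i`.
      refine ⟨T₀, fun i hi m hm => ?_⟩
      obtain ⟨-, h⟩ := hm
      have : ∀ k, stepCount e p k ≤ k := by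
        intro k
        classical exact Nat.count_le _
      have := this m
      omega
    have hmem : ∀ i j, (p, i) ∈ F j ↔ pos p i < j := by
      intro i j
      rw [hF]
      constructor
      · rintro ⟨j', hj', h⟩
        rwa [hatu p i _ _ (hat p i hp) h]
      · intro h
        exact ⟨_, h, hat p i hp⟩
    have hmono : ∀ i i', g ≤ i → i < i' → pos p i < pos p i' := by
      intro i i' hi hlt
      obtain ⟨m, hm⟩ := hp (8 * i + 4)
      obtain ⟨k, hk⟩ := hp (8 * i' + 3)
      exact hord p p hp hp i i' k m hm (hg i hi m hm) hk ((hm.lt_iff hk).1 (by omega))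
    refine ⟨g, hmem, hmono, ?_⟩
    -- The finitely many early increments may be placed anywhere; beyond `g + B` all of them precede
    -- the place of `j`, so exactly the first `j` own increments do.
    obtain ⟨B, hB⟩ : ∃ B, ∀ i < g, pos p i < B :=
      ⟨(Finset.range g).sup (pos p) + 1, fun i hi =>
        Nat.lt_succ_of_le (Finset.le_sup (f := pos p) (Finset.mem_range.2 hi))⟩
    refine ⟨g + B, fun j hj => ?_⟩
    have hj' := le_of_strictMono_from hmono (show g ≤ j by omega)
    refine seen_of_preceding (fun i => ?_) ?_
    · rw [hmem]
      constructor
      · intro h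
        by_contra hge
        rcases Nat.lt_or_eq_of_le (not_lt.1 hge) with h' | rfl
        · have := hmono j i (by omega) h'
          omega
        · omega
      · intro h
        rcases Nat.lt_or_ge i g with hi | hi
        · have := hB i hi
          omega
        · exact hmono i j hi h
    · obtain ⟨k, hk⟩ := hp (8 * j + 3)
      obtain ⟨m, hm⟩ := hp (8 * j + 4)
      obtain ⟨r, hr, hrm⟩ := hpos p j k m hk hm
      rw [← hrm (hg j (by omega) m hm)]
      exact hcard _ _ _ hr
  · intro p q hp hq i j hij
    obtain ⟨k, r, h, ⟨⟨a, ha⟩, -⟩⟩ := hat p i hp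
    obtain ⟨k', r', h', ⟨⟨a', ha'⟩, -⟩⟩ := hat q j hq
    rw [hij, h'] at h
    simp only [Option.some.injEq, Prod.mk.injEq] at h
    obtain ⟨rfl, -⟩ := h
    rw [ha] at ha'
    simp only [Option.some.injEq, Prod.mk.injEq] at ha'
    exact ha'.1

end TwoProcess

/-! ### What active processes eventually see -/

namespace TwoProcess

variable {α : Type} [Nonempty α] {e : ℕ → Option (Fin 2 × StepType α)}

/-- A downward closed finite set is an initial segment. This converts numbers of increments seen
into statements about individual increments. -/
theorem lt_card_iff_mem {D : Finset ℕ} (h : ∀ i ∈ D, ∀ i' < i, i' ∈ D) (m : ℕ) :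
    m < D.card ↔ m ∈ D := by
  constructor
  · intro hm
    by_contra hno
    have : D ⊆ Finset.range m := fun i hi => by
      rw [Finset.mem_range]
      by_contra hge
      rcases Nat.lt_or_eq_of_le (not_lt.1 hge) with h' | rfl
      · exact hno (h i hi m h')
      · exact hno hi
    have := Finset.card_le_card this
    rw [Finset.card_range] at this
    omega
  · intro hm
    have : Finset.range (m + 1) ⊆ D := fun i hi => by
      rcases Nat.lt_or_eq_of_le (Nat.le_of_lt_succ (Finset.mem_range.1 hi)) with h' | rfl
      · exact h m hm i h'
      · exact hm
    have := Finset.card_le_card this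
    rw [Finset.card_range] at this
    omega

/-- An active process eventually sees every completed increment of the other process. -/
theorem eventually_lt_seen (he : (impl α).IsExecution e) {p : Fin 2} (hp : Active e p) {m k : ℕ}
    (hk : StepAt e (1 - p) (8 * m + 4) k) : ∃ N, ∀ j ≥ N, m < seen e p j := by
  classical
  obtain ⟨F, hF, hcomp, -, pos, T₀, hpl, -⟩ := exists_places he
  obtain ⟨g, hg⟩ := hpl p hp
  have : ∃ B, ∀ i ≤ m, (1 - p, i) ∈ F B := by
    have : ∀ i ≤ m, ∃ j, (1 - p, i) ∈ F j := by
      intro i hi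
      rcases Nat.lt_or_eq_of_le hi with h | rfl
      · obtain ⟨k', -, hk'⟩ := hk.exists_earlier (show 8 * i + 4 < 8 * m + 4 by omega)
        exact hcomp _ _ _ hk'
      · exact hcomp _ _ _ hk
    choose! f hf using this
    exact ⟨(Finset.range (m + 1)).sup f, fun i hi =>
      hF (Finset.le_sup (f := f) (Finset.mem_range.2 (by omega))) (hf i hi)⟩
  obtain ⟨B, hB⟩ := this
  obtain ⟨N₁, hN₁⟩ := hg.eventually_gt B
  obtain ⟨N₂, hN₂⟩ := hg.seen
  refine ⟨max N₁ N₂, fun j hj => ?_⟩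
  rw [hN₂ j (by omega)]
  have : Finset.range (m + 1) ⊆
      ((F (pos p j)).filter fun x => x.1 = 1 - p).image Prod.snd := fun i hi => by
    rw [Finset.mem_range] at hi
    exact Finset.mem_image.2 ⟨(1 - p, i), Finset.mem_filter.2
      ⟨hF (hN₁ j (by omega)).le (hB i (by omega)), rfl⟩, rfl⟩
  have := Finset.card_le_card this
  rw [Finset.card_range] at this
  omega

/-- If the other process is not active, then the number of its increments seen by an active process
is eventually constant. -/
theorem eventually_seen_eq (he : (impl α).IsExecution e) {p : Fin 2} (hp : Active e p)
    (hq : ¬ Active e (1 - p)) : ∃ β N, ∀ j ≥ N, seen e p j = β := by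
  classical
  obtain ⟨F, hF, -, hinv, pos, T₀, hpl, -⟩ := exists_places he
  obtain ⟨g, hg⟩ := hpl p hp
  obtain ⟨N, hN⟩ := hg.seen
  obtain ⟨b, hb⟩ := exists_finite_bound _ hq
  have hbd : ∀ j ≥ N, seen e p j ≤ b := by
    intro j hj
    rw [hN j hj, ← Finset.card_range b]
    refine Finset.card_le_card fun i hi => ?_
    obtain ⟨⟨q, i'⟩, hmem, rfl⟩ := Finset.mem_image.1 hi
    obtain ⟨hmem, rfl⟩ := Finset.mem_filter.1 hmem
    obtain ⟨k, hk⟩ := hinv _ _ _ hmem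
    have := hb _ _ hk
    rw [Finset.mem_range]
    simp only
    omega
  have hmono : ∀ j j', max N g ≤ j → j ≤ j' → seen e p j ≤ seen e p j' := by
    intro j j' hj hjj'
    rw [hN j (by omega), hN j' (by omega)]
    refine Finset.card_le_card (Finset.image_subset_image (Finset.filter_subset_filter _ ?_))
    apply hF
    rcases Nat.lt_or_eq_of_le hjj' with h | rfl
    · exact (hg.mono j j' (by omega) h).le
    · exact le_rfl
  obtain ⟨j₀, hj₀, hmax⟩ : ∃ j₀ ≥ max N g, ∀ j ≥ max N g, seen e p j ≤ seen e p j₀ := by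
    have hfin : ((seen e p) '' {j | max N g ≤ j}).Finite :=
      (Set.finite_le_nat b).subset (by
        rintro _ ⟨j, hj, rfl⟩
        exact hbd j (le_trans (le_max_left _ _) hj))
    obtain ⟨_, ⟨j₀, hj₀, rfl⟩, h⟩ := Set.exists_max_image _ id hfin
      ⟨_, ⟨max N g, le_refl (max N g), rfl⟩⟩
    exact ⟨j₀, hj₀, fun j hj => h _ ⟨j, hj, rfl⟩⟩
  exact ⟨seen e p j₀, j₀, fun j hj =>
    le_antisymm (hmax j (le_trans hj₀ hj)) (hmono j₀ j hj₀ hj)⟩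

/-- If both processes are active, then from some time on they agree on the order of their
increments, and this order respects real time. -/
theorem eventually_seen_agree (he : (impl α).IsExecution e) (hact : ∀ p, Active e p) :
    ∃ N T₀, (∀ j m, N ≤ j → N ≤ m → (m < seen e 0 j ↔ seen e 1 m ≤ j)) ∧
      ∀ p i j k m, N ≤ j → StepAt e (1 - p) (8 * i + 4) m → T₀ ≤ m → StepAt e p (8 * j + 3) k →
        m < k → i < seen e p j := by
  classical
  obtain ⟨F, hF, -, -, pos, T₀, hpl, hne, hord⟩ := exists_places he
  -- Once `pos p j` lies beyond the early, possibly misplaced increments of the other process, those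
  -- placed before it form an initial segment.
  have key : ∀ p, ∃ N, ∀ j ≥ N, ∀ i, i < seen e p j ↔ pos (1 - p) i < pos p j := by
    intro p
    obtain ⟨g, hg⟩ := hpl p (hact p)
    obtain ⟨g', hg'⟩ := hpl (1 - p) (hact _)
    obtain ⟨N₁, hN₁⟩ := hg.seen
    obtain ⟨N₂, hN₂⟩ := hg.eventually_gt ((Finset.range g').sup (pos (1 - p)))
    refine ⟨max N₁ N₂, fun j hj i => ?_⟩
    have hmem : ∀ i, i ∈ ((F (pos p j)).filter fun x => x.1 = 1 - p).image Prod.snd ↔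
        pos (1 - p) i < pos p j := by
      intro i
      rw [← hg'.mem, Finset.mem_image]
      constructor
      · rintro ⟨⟨q, i'⟩, hq, rfl⟩
        obtain ⟨hq, rfl⟩ := Finset.mem_filter.1 hq
        exact hq
      · intro h
        exact ⟨(1 - p, i), Finset.mem_filter.2 ⟨h, rfl⟩, rfl⟩
    rw [hN₁ j (by omega), lt_card_iff_mem, hmem]
    intro i hi i' hlt
    rw [hmem] at hi ⊢
    rcases Nat.lt_or_ge i' g' with h | h
    · exact lt_of_le_of_lt (Finset.le_sup (f := pos (1 - p)) (Finset.mem_range.2 h))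
        (hN₂ j (by omega))
    · exact (hg'.mono i' i h hlt).trans hi
  choose N hN using key
  refine ⟨max (N 0) (N 1), T₀, ?_, ?_⟩
  · intro j m hj hm
    rw [hN 0 j (by omega), ← not_lt, hN 1 m (by omega)]
    have := hne 1 0 (hact 1) (hact 0) m j
    simp only [sub_zero, sub_self] at *
    have : pos 1 m ≠ pos 0 j := fun h => by simpa using this h
    omega
  · intro p i j k m hj hm hT hk hmk
    have : N p ≤ j := by
      have : N p ≤ max (N 0) (N 1) := by
        rcases fin_two_eq_or (p := 0) (q := p) with rfl | rfl <;> simp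
      omega
    rw [hN p j this]
    exact hord _ _ (hact _) (hact _) i j k m hm hT hk hmk

end TwoProcess

/-! ### The logs -/

namespace TwoProcess

/-- The operations `n - 1, …, c` of process `1`. -/
def segment (c : ℕ) : ℕ → List (Fin 2 × ℕ)
  | 0 => []
  | n + 1 => if c ≤ n then (1, n) :: segment c n else []

theorem mem_segment {c n : ℕ} {x : Fin 2 × ℕ} : x ∈ segment c n ↔ x.1 = 1 ∧ c ≤ x.2 ∧ x.2 < n := by
  induction n with
  | zero => simp [segment]
  | succ n ih =>
    obtain ⟨q, i⟩ := x
    unfold segment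
    split_ifs with h
    · simp only [List.mem_cons, ih, Prod.mk.injEq]
      constructor
      · rintro (⟨rfl, rfl⟩ | ⟨h₁, h₂⟩)
        · exact ⟨rfl, h, by omega⟩
        · exact ⟨h₁, by omega⟩
      · rintro ⟨rfl, h₁, h₂⟩
        by_cases hi : i = n
        · exact Or.inl ⟨rfl, hi⟩
        · exact Or.inr ⟨rfl, h₁, by omega⟩
    · simp
      omega

theorem nodup_segment (c n : ℕ) : (segment c n).Nodup := by
  induction n with
  | zero => simp [segment]
  | succ n ih =>
    unfold segment
    split_ifs
    · refine List.nodup_cons.2 ⟨?_, ih⟩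
      simp [mem_segment]
    · simp

theorem length_segment (c n : ℕ) : (segment c n).length = n - c := by
  induction n with
  | zero => simp [segment]
  | succ n ih =>
    unfold segment
    split_ifs
    · rw [List.length_cons, ih]
      omega
    · rw [List.length_nil]
      omega

theorem segment_suffix (c : ℕ) {n n' : ℕ} (h : n ≤ n') : segment c n <:+ segment c n' := by
  induction n', h using Nat.le_induction with
  | base => exact List.suffix_rfl
  | succ n' hn ih =>
    rw [segment]
    split_ifs with hc
    · exact ih.trans (List.suffix_cons _ _)
    · have : segment c n = [] := List.length_eq_zero_iff.1 (by rw [length_segment]; omega)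
      rw [this]

theorem take_segment (c n : ℕ) : (segment 0 n).take (n - c) = segment c n := by
  induction n with
  | zero => simp [segment]
  | succ n ih =>
    rw [segment, segment, if_pos (Nat.zero_le _)]
    split_ifs with h
    · rw [show n + 1 - c = (n - c) + 1 by omega, List.take_succ_cons, ih]
    · rw [show n + 1 - c = 0 by omega, List.take_zero]

/-! ### The logs as functions of the numbers `a j` and `b m` of operations seen by processes `0` and
`1` -/

variable (a b : ℕ → ℕ)

/-- The number of operations of process `1` in the log of process `0` after `j` operations. -/
def leaderSeen : ℕ → ℕ
  | 0 => 0
  | j + 1 => max (leaderSeen j) (a j)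

/-- The log of process `0`. -/
def leaderLog : ℕ → List (Fin 2 × ℕ)
  | 0 => []
  | j + 1 => (0, j) :: (segment (leaderSeen a j) (a j) ++ leaderLog j)

/-- The number of operations of process `0` in the log of process `1` after `m` operations. -/
def followerSeen : ℕ → ℕ
  | 0 => 0
  | m + 1 => if followerSeen m < b m ∧ leaderSeen a (b m - 1) ≤ m then b m else followerSeen m

/-- The log of process `1`. -/
def followerLog : ℕ → List (Fin 2 × ℕ)
  | 0 => []
  | m + 1 => (1, m) :: (if followerSeen a b m < b m ∧ leaderSeen a (b m - 1) ≤ m then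
      (0, b m - 1) :: (segment (leaderSeen a (b m - 1)) m ++ leaderLog a (b m - 1))
    else followerLog m)

variable {a b}

theorem mem_leaderLog {j : ℕ} {x : Fin 2 × ℕ} :
    x ∈ leaderLog a j ↔ (x.1 = 0 ∧ x.2 < j) ∨ (x.1 = 1 ∧ x.2 < leaderSeen a j) := by
  induction j with
  | zero => simp [leaderLog, leaderSeen]
  | succ j ih =>
    obtain ⟨q, i⟩ := x
    simp only [leaderLog, leaderSeen, List.mem_cons, List.mem_append, mem_segment, ih,
      Prod.mk.injEq]
    rcases fin_two_eq_or (p := 0) (q := q) with rfl | rfl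
    · simp
      omega
    · simp
      omega

theorem nodup_leaderLog (j : ℕ) : (leaderLog a j).Nodup := by
  induction j with
  | zero => simp [leaderLog]
  | succ j ih =>
    refine List.nodup_cons.2 ⟨?_, (nodup_segment _ _).append ih ?_⟩
    · simp [mem_segment, mem_leaderLog]
    · rintro ⟨q, i⟩ h h'
      rw [mem_segment] at h
      rw [mem_leaderLog] at h'
      rcases fin_two_eq_or (p := 0) (q := q) with rfl | rfl
      · simp at h
      · simp at h h'
        omega

theorem leaderLog_suffix (j : ℕ) : leaderLog a j <:+ leaderLog a (j + 1) :=
  (List.suffix_append _ _).trans (List.suffix_cons _ _)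

theorem mem_followerLog {m : ℕ} {x : Fin 2 × ℕ} :
    x ∈ followerLog a b m ↔ (x.1 = 1 ∧ x.2 < m) ∨ (x.1 = 0 ∧ x.2 < followerSeen a b m) := by
  induction m with
  | zero => simp [followerLog, followerSeen]
  | succ m ih =>
    obtain ⟨q, i⟩ := x
    simp only [followerLog, followerSeen, List.mem_cons, Prod.mk.injEq]
    split_ifs with h
    · simp only [List.mem_cons, List.mem_append, mem_segment, mem_leaderLog, Prod.mk.injEq]
      rcases fin_two_eq_or (p := 0) (q := q) with rfl | rfl
      · simp
        omega
      · simp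
        omega
    · rw [ih]
      rcases fin_two_eq_or (p := 0) (q := q) with rfl | rfl
      · simp
      · simp
        omega

/-- The guard `leaderSeen a (b m - 1) ≤ m` keeps `(1, m)` out of the adopted log. No relation
between `a` and `b` may be assumed, as weak consistency is required before stabilization too. -/
theorem nodup_followerLog (m : ℕ) : (followerLog a b m).Nodup := by
  induction m with
  | zero => simp [followerLog]
  | succ m ih =>
    rw [followerLog]
    split_ifs with h
    · refine List.nodup_cons.2 ⟨?_, List.nodup_cons.2 ⟨?_, (nodup_segment _ _).append
        (nodup_leaderLog _) ?_⟩⟩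
      · simp [mem_segment, mem_leaderLog]
        omega
      · simp [mem_segment, mem_leaderLog]
      · rintro ⟨q, i⟩ h h'
        rw [mem_segment] at h
        rw [mem_leaderLog] at h'
        rcases fin_two_eq_or (p := 0) (q := q) with rfl | rfl
        · simp at h
        · simp at h h'
          omega
    · refine List.nodup_cons.2 ⟨?_, ih⟩
      simp [mem_followerLog]

/-! ### Eventual agreement of the logs -/

/-- Agreement makes `a` monotone from `N` on and unbounded, since `m < a j` as soon as `j ≥ b m`; so
it eventually exceeds its finitely many early values. -/
theorem eventually_max_of_agree {N : ℕ} (h : ∀ j m, N ≤ j → N ≤ m → (m < a j ↔ b m ≤ j)) :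
    ∃ N' ≥ N, ∀ j ≥ N', N ≤ a j ∧ ∀ i ≤ j, a i ≤ a j := by
  have hlarge : ∀ B, ∃ J, ∀ j ≥ J, B < a j := by
    intro B
    refine ⟨max N (b (max N B)), fun j hj => ?_⟩
    have := (h j (max N B) (by omega) (by omega)).2 (by omega)
    omega
  obtain ⟨J, hJ⟩ := hlarge (N + (Finset.range N).sup a)
  refine ⟨max N J, le_max_left _ _, fun j hj => ⟨?_, fun i hi => ?_⟩⟩
  · have := hJ j (by omega)
    omega
  · have hj' := hJ j (by omega)
    rcases Nat.lt_or_ge i N with hiN | hiN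
    · have := Finset.le_sup (f := a) (Finset.mem_range.2 hiN)
      omega
    · by_contra hlt
      have h₁ := (h i (a j) hiN (by omega)).1 (by omega)
      have h₂ := (h j (a j) (by omega) (by omega)).2 (by omega)
      omega

theorem leaderSeen_le {j B : ℕ} (h : ∀ i < j, a i ≤ B) : leaderSeen a j ≤ B := by
  induction j with
  | zero => exact Nat.zero_le _
  | succ j ih =>
    rw [leaderSeen]
    exact max_le (ih fun i hi => h i (by omega)) (h j (by omega))

theorem followerSeen_le {m B : ℕ} (h : ∀ i < m, b i ≤ B) : followerSeen a b m ≤ B := by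
  induction m with
  | zero => exact Nat.zero_le _
  | succ m ih =>
    rw [followerSeen]
    split_ifs
    · exact h m (by omega)
    · exact ih fun i hi => h i (by omega)

theorem le_leaderSeen_succ (j : ℕ) : a j ≤ leaderSeen a (j + 1) := le_max_right _ _

theorem leaderSeen_mono : Monotone (leaderSeen a) :=
  monotone_nat_of_le_succ fun _ => le_max_left _ _

theorem followerSeen_mono : Monotone (followerSeen a b) :=
  monotone_nat_of_le_succ fun m => by
    rw [followerSeen]
    split_ifs <;> omega

/-- If the two processes eventually agree on the order of their increments, then the log of
process `1` is eventually an initial part of the log of process `0`. -/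
theorem eventually_followerLog {N : ℕ} (h : ∀ j m, N ≤ j → N ≤ m → (m < a j ↔ b m ≤ j)) :
    ∃ N', ∀ m ≥ N', followerLog a b (m + 1) <:+ leaderLog a (b m + 1) ∧
      b m ≤ followerSeen a b (m + 1) := by
  have h' : ∀ m j, N ≤ m → N ≤ j → (j < b m ↔ a j ≤ m) := by
    intro m j hm hj
    have := h j m hj hm
    omega
  obtain ⟨A, hAN, hA⟩ := eventually_max_of_agree h
  obtain ⟨B, hBN, hB⟩ := eventually_max_of_agree h'
  have hc : ∀ j ≥ A, leaderSeen a (j + 1) = a j := fun j hj =>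
    le_antisymm (leaderSeen_le fun i hi => (hA j hj).2 i (by omega)) (le_leaderSeen_succ j)
  have hlarge : ∃ M, ∀ m ≥ M, A + 1 < b m := by
    refine ⟨max N (a (A + 1)), fun m hm => ?_⟩
    exact (h' m (A + 1) (by omega) (by omega)).2 (by omega)
  obtain ⟨M, hM⟩ := hlarge
  let K := max M B + 1
  have hseen : ∀ m ≥ K, a (b m - 1) ≤ m := fun m hm => by
    have := hM m (by omega)
    exact (h' m (b m - 1) (by omega) (by omega)).1 (by omega)
  have hguard : ∀ m ≥ K, leaderSeen a (b m - 1) ≤ m := fun m hm => by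
    have := hM m (by omega)
    refine le_trans (leaderSeen_mono (show b m - 1 ≤ b m by omega)) ?_
    have h₁ := hc (b m - 1) (by omega)
    rw [show b m - 1 + 1 = b m by omega] at h₁
    rw [h₁]
    exact hseen m hm
  have hd : ∀ m ≥ K, b m ≤ followerSeen a b (m + 1) := fun m hm => by
    rw [followerSeen]
    split_ifs with hif
    · exact le_rfl
    · have := hguard m hm
      omega
  -- A new operation of process `0` is seen, so `b m - 1` falls between operations `m - 1` and `m`
  -- of process `1` in the common order. Hence `a (b m - 1) = m`, and the adopted log with the
  -- inserted operations is exactly `leaderLog a (b m)`.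
  have hrebase : ∀ m ≥ K + 1, followerSeen a b m < b m →
      followerLog a b (m + 1) = segment (leaderSeen a (b m)) (m + 1) ++ leaderLog a (b m) := by
    intro m hm hlt
    have hbm := hM m (by omega)
    have hd' := hd (m - 1) (by omega)
    rw [show m - 1 + 1 = m by omega] at hd'
    have hb1 := hM (m - 1) (by omega)
    have hge : m - 1 < a (b m - 1) :=
      (h (b m - 1) (m - 1) (by omega) (by omega)).2 (by omega)
    have hle := hseen m (by omega)
    have ham : a (b m - 1) = m := by omega
    have hcm := hc (b m - 1) (by omega)
    rw [show b m - 1 + 1 = b m by omega] at hcm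
    have hL : leaderLog a (b m) = (0, b m - 1) ::
        (segment (leaderSeen a (b m - 1)) (a (b m - 1)) ++ leaderLog a (b m - 1)) := by
      conv_lhs => rw [show b m = b m - 1 + 1 by omega]
      rfl
    rw [followerLog, if_pos ⟨hlt, hguard m (by omega)⟩, hcm, ham, segment, if_pos le_rfl, hL, ham]
    have : segment m m = [] := List.length_eq_zero_iff.1 (by rw [length_segment]; omega)
    rw [this]
    rfl
  -- Without a new operation of process `0`, `b` is unchanged and `(1, m)` extends the segment on
  -- top.
  have hstep : ∀ m ≥ K + 1,
      followerLog a b m = segment (leaderSeen a (b (m - 1))) m ++ leaderLog a (b (m - 1)) →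
      followerLog a b (m + 1) = segment (leaderSeen a (b m)) (m + 1) ++ leaderLog a (b m) := by
    intro m hm ih
    by_cases hlt : followerSeen a b m < b m
    · exact hrebase m hm hlt
    · have hbm := hM m (by omega)
      have hb1 : b (m - 1) ≤ b m := (hB m (by omega)).2 _ (by omega)
      have hb2 : followerSeen a b m ≤ b (m - 1) :=
        followerSeen_le fun i hi => (hB (m - 1) (by omega)).2 i (by omega)
      have heq : b (m - 1) = b m := by omega
      have hcm := hc (b m - 1) (by omega)
      rw [show b m - 1 + 1 = b m by omega] at hcm
      have := hseen m (by omega)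
      rw [followerLog, if_neg (by omega), ih, heq, segment, if_pos (by omega)]
      rfl
  -- As `b` is unbounded, some late adoption takes place; it replaces whatever was wrong in the
  -- earlier log.
  obtain ⟨m₀, hm₀, hlt⟩ : ∃ m ≥ K + 1, followerSeen a b m < b m := by
    by_contra! hno
    have : ∀ m ≥ K, b m ≤ b K := by
      intro m hm
      induction m, hm using Nat.le_induction with
      | base => exact le_rfl
      | succ m hm ih =>
        refine le_trans (hno (m + 1) (by omega)) (le_trans ?_ ih)
        exact followerSeen_le fun i hi => (hB m (by omega)).2 i (by omega)
    have h₁ := this (max K (a (max N (b K)))) (le_max_left _ _)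
    have h₂ := (h' (max K (a (max N (b K)))) (max N (b K)) (by omega) (by omega)).2 (by omega)
    omega
  have hform : ∀ m ≥ m₀,
      followerLog a b (m + 1) = segment (leaderSeen a (b m)) (m + 1) ++ leaderLog a (b m) := by
    intro m hm
    induction m, hm using Nat.le_induction with
    | base => exact hrebase m₀ hm₀ hlt
    | succ m hm ih => exact hstep (m + 1) (by omega) ih
  refine ⟨m₀, fun m hm => ⟨?_, hd m (by omega)⟩⟩
  have hbm := hM m (by omega)
  have hlt : m < a (b m) := (h (b m) m (by omega) (by omega)).2 le_rfl
  rw [hform m hm, leaderLog]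
  refine List.IsSuffix.trans ?_ (List.suffix_cons _ _)
  obtain ⟨t, ht⟩ := segment_suffix (leaderSeen a (b m)) (show m + 1 ≤ a (b m) from hlt)
  exact ⟨t, by rw [← ht, List.append_assoc]⟩

/-- If process `1` eventually sees a constant number of operations of process `0`, then it
eventually only extends its log. -/
theorem eventually_followerLog_succ {β N : ℕ} (h : ∀ m ≥ N, b m = β) :
    ∃ N', ∀ m ≥ N', followerLog a b (m + 1) = (1, m) :: followerLog a b m ∧
      β ≤ followerSeen a b m := by
  -- From here on the guard holds, so all `β` operations get into the log by operation `K`, and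
  -- later ones bring nothing new.
  let K := max N (leaderSeen a (β - 1))
  have h₁ : β ≤ followerSeen a b (K + 1) := by
    rw [followerSeen, h K (by omega)]
    split_ifs with hif
    · exact le_rfl
    · omega
  refine ⟨K + 1, fun m hm => ?_⟩
  have h₂ := h₁.trans (followerSeen_mono (a := a) (b := b) hm)
  refine ⟨?_, h₂⟩
  rw [followerLog, h m (by omega), if_neg (by omega)]

/-! ### The logs of the implementation -/

section Implementation

variable {α : Type} [Nonempty α] {e : ℕ → Option (Fin 2 × StepType α)}

/-- The log entry of an operation. -/
noncomputable def entry (e : ℕ → Option (Fin 2 × StepType α)) (x : Fin 2 × ℕ) : Fin 2 × α :=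
  (x.1, opVal e x.1 x.2)

theorem countOf_map_entry (q : Fin 2) (l : List (Fin 2 × ℕ)) :
    countOf q (l.map (entry e)) = (l.filter (fun x => x.1 = q)).length := by
  rw [countOf, List.filter_map, List.length_map]
  rfl

theorem ownOps_one (n : ℕ) : ownOps e 1 n = (segment 0 n).map (entry e) := by
  induction n with
  | zero => rfl
  | succ n ih =>
    rw [ownOps, ih, segment, if_pos (Nat.zero_le _)]
    rfl

theorem filter_segment_zero (c n : ℕ) : (segment c n).filter (fun x => x.1 = 0) = [] := by
  rw [List.filter_eq_nil_iff]
  intro x hx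
  rw [mem_segment] at hx
  simp [hx.1]

theorem filter_segment_one (c n : ℕ) : (segment c n).filter (fun x => x.1 = 1) = segment c n := by
  rw [List.filter_eq_self]
  intro x hx
  rw [mem_segment] at hx
  simp [hx.1]

theorem length_filter_leaderLog_zero (j : ℕ) :
    ((leaderLog a j).filter (fun x => x.1 = 0)).length = j := by
  induction j with
  | zero => rfl
  | succ j ih =>
    simp only [leaderLog, List.filter_cons, List.filter_append, filter_segment_zero]
    simp [ih]

theorem length_filter_leaderLog_one (j : ℕ) :
    ((leaderLog a j).filter (fun x => x.1 = 1)).length = leaderSeen a j := by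
  induction j with
  | zero => rfl
  | succ j ih =>
    simp only [leaderLog, List.filter_cons, List.filter_append, filter_segment_one, leaderSeen]
    simp [ih, length_segment]
    omega

theorem length_filter_followerLog_zero (m : ℕ) :
    ((followerLog a b m).filter (fun x => x.1 = 0)).length = followerSeen a b m := by
  induction m with
  | zero => rfl
  | succ m ih =>
    rw [followerLog, followerSeen]
    split_ifs with h
    · simp only [List.filter_cons, List.filter_append, filter_segment_zero]
      simp [length_filter_leaderLog_zero]
      omega
    · simp only [List.filter_cons]
      simp [ih]

/-- The value read is the list of the first `seen e 0 j` operations of process `1`; cutting off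
those already logged leaves a segment. -/
theorem logAfter_zero (he : (impl α).IsExecution e) {j : ℕ}
    (h : ∀ i < j, ∃ k, StepAt e 0 (8 * i + 6) k) :
    logAfter e 0 j = (leaderLog (seen e 0) j).map (entry e) := by
  induction j with
  | zero => rfl
  | succ j ih =>
    obtain ⟨k, hk⟩ := h j (by omega)
    have hw : (readReply e 0 j).getD [] = ownOps e 1 (seen e 0 j) := by
      obtain ⟨h₁, h₂⟩ := readReply_of_stepAt he hk
      rcases hs : seen e 0 j with _ | i
      · rw [h₁ hs]; rfl
      · rw [h₂ i hs]
        simp [announcement]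
    rw [logAfter, ih fun i hi => h i (by omega), hw, merge, if_pos rfl, leaderLog, List.map_cons,
      List.map_append, countOf_map_entry, length_filter_leaderLog_one, ownOps_length, ownOps_one,
      ← List.map_take, take_segment]
    rfl

theorem logAfter_one (he : (impl α).IsExecution e) {m : ℕ}
    (h : ∀ i < m, ∃ k, StepAt e 1 (8 * i + 6) k) :
    logAfter e 1 m = (followerLog (seen e 0) (seen e 1) m).map (entry e) := by
  induction m with
  | zero => rfl
  | succ m ih =>
    obtain ⟨k, hk⟩ := h m (by omega)
    obtain ⟨h₁, h₂⟩ := readReply_of_stepAt he hk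
    rw [logAfter, ih fun i hi => h i (by omega), merge, if_neg (by simp), followerLog,
      List.map_cons]
    congr 1
    rcases hs : seen e 1 m with _ | i
    · rw [h₁ hs]
      simp [countOf]
    · have hw : (readReply e 1 m).getD [] =
          ((0, i) :: leaderLog (seen e 0) i).map (entry e) := by
        rw [h₂ i hs]
        -- The increment of operation `i` of process `0` was invoked, so its earlier operations have
        -- finished reading.
        have : logAfter e 0 i = (leaderLog (seen e 0) i).map (entry e) := by
          apply logAfter_zero he
          intro i' hi'
          obtain ⟨k₄, -, hk₄⟩ := hk.exists_earlier (show 8 * m + 4 < 8 * m + 6 by omega)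
          obtain ⟨k₃, -, hk₃⟩ :=
            exists_increment_of_lt_seen he hk₄ (show i < seen e 1 m by omega)
          obtain ⟨k', -, hk'⟩ := hk₃.exists_earlier (show 8 * i' + 6 < 8 * i + 3 by omega)
          exact ⟨k', hk'⟩
        simp [announcement, this, entry]
      have hc₀ : countOf 0 (((0, i) :: leaderLog (seen e 0) i).map (entry e)) = i + 1 := by
        rw [countOf_map_entry]
        simp [length_filter_leaderLog_zero]
      have hc₁ : countOf 1 (((0, i) :: leaderLog (seen e 0) i).map (entry e)) =
          leaderSeen (seen e 0) i := by
        rw [countOf_map_entry]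
        simp [length_filter_leaderLog_one]
      rw [hw, hc₀, hc₁, countOf_map_entry, length_filter_followerLog_zero, ownOps_length,
        Nat.add_sub_cancel]
      by_cases hg : followerSeen (seen e 0) (seen e 1) m < i + 1 ∧ leaderSeen (seen e 0) i ≤ m
      · rw [if_pos hg.1, if_pos hg.2, if_pos hg, ownOps_one,
          ← take_segment (leaderSeen (seen e 0) i) m]
        simp [List.map_take]
      · rw [if_neg hg]
        split_ifs with hg₁ hg₂
        · exact absurd ⟨hg₁, hg₂⟩ hg
        · rfl
        · rfl

end Implementation

end TwoProcess

/-! ### Eventual linearizability of the implementation -/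

namespace TwoProcess

theorem exists_lt_of_lt_leaderSeen {a : ℕ → ℕ} {i j : ℕ} (h : i < leaderSeen a j) :
    ∃ j' < j, i < a j' := by
  by_contra! hno
  exact absurd (leaderSeen_le hno) (by omega)

theorem exists_lt_of_lt_followerSeen {a b : ℕ → ℕ} {i m : ℕ} (h : i < followerSeen a b m) :
    ∃ m' < m, i < b m' := by
  by_contra! hno
  exact absurd (followerSeen_le (a := a) hno) (by omega)

variable {α : Type} [Nonempty α] {e : ℕ → Option (Fin 2 × StepType α)}

/-- The operations in the log of process `p` after `j` operations. -/
noncomputable def opLog (e : ℕ → Option (Fin 2 × StepType α)) (p : Fin 2) (j : ℕ) :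
    List (Fin 2 × ℕ) :=
  if p = 0 then leaderLog (seen e 0) j else followerLog (seen e 0) (seen e 1) j

theorem opLog_zero (j : ℕ) : opLog e 0 j = leaderLog (seen e 0) j := rfl

theorem opLog_one (j : ℕ) : opLog e 1 j = followerLog (seen e 0) (seen e 1) j := rfl

theorem nodup_opLog (p : Fin 2) (j : ℕ) : (opLog e p j).Nodup := by
  rcases fin_two_eq_or (p := 0) (q := p) with rfl | rfl
  · exact nodup_leaderLog _
  · exact nodup_followerLog _

theorem opLog_succ (p : Fin 2) (j : ℕ) : opLog e p (j + 1) = (p, j) :: (opLog e p (j + 1)).tail := by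
  rcases fin_two_eq_or (p := 0) (q := p) with rfl | rfl <;> rfl

theorem mem_opLog_own {p : Fin 2} {i j : ℕ} : (p, i) ∈ opLog e p j ↔ i < j := by
  rcases fin_two_eq_or (p := 0) (q := p) with rfl | rfl
  · simp [opLog_zero, mem_leaderLog]
  · rw [sub_zero, opLog_one, mem_followerLog]
    simp

theorem mem_tail_opLog {p : Fin 2} {j : ℕ} {x : Fin 2 × ℕ} (hx : x ∈ opLog e p (j + 1))
    (hne : x ≠ (p, j)) : x ∈ (opLog e p (j + 1)).tail := by
  rw [opLog_succ, List.mem_cons] at hx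
  exact hx.resolve_left hne

theorem logAfter_eq_map (he : (impl α).IsExecution e) {p : Fin 2} {j m : ℕ}
    (hm : StepAt e p (8 * j + 7) m) : logAfter e p (j + 1) = (opLog e p (j + 1)).map (entry e) := by
  have h : ∀ i < j + 1, ∃ k, StepAt e p (8 * i + 6) k := fun i hi => by
    obtain ⟨k, -, hk⟩ := hm.exists_earlier (show 8 * i + 6 < 8 * j + 7 by omega)
    exact ⟨k, hk⟩
  rcases fin_two_eq_or (p := 0) (q := p) with rfl | rfl
  · exact logAfter_zero he h
  · exact logAfter_one he h

/-- All operations in the log have been invoked. -/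
theorem invoked_of_mem_opLog (he : (impl α).IsExecution e) {p : Fin 2} {j m : ℕ}
    (hm : StepAt e p (8 * j + 7) m) {x : Fin 2 × ℕ} (hx : x ∈ opLog e p (j + 1)) :
    ∃ k < m, StepAt e x.1 (8 * x.2) k := by
  obtain ⟨q, i⟩ := x
  rcases fin_two_eq_or (p := p) (q := q) with rfl | rfl
  · rw [mem_opLog_own] at hx
    exact hm.exists_earlier (by simp only; omega)
  · have : ∃ j' < j + 1, i < seen e p j' := by
      rcases fin_two_eq_or (p := 0) (q := p) with rfl | rfl
      · rw [opLog_zero, mem_leaderLog] at hx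
        exact exists_lt_of_lt_leaderSeen (by simpa using hx)
      · rw [sub_zero, opLog_one, mem_followerLog] at hx
        exact exists_lt_of_lt_followerSeen (by simpa using hx)
    obtain ⟨j', hj', hlt⟩ := this
    obtain ⟨k₄, hk₄, hst⟩ := hm.exists_earlier (show 8 * j' + 4 < 8 * j + 7 by omega)
    obtain ⟨k₃, hk₃, hst₃⟩ := exists_increment_of_lt_seen he hst hlt
    obtain ⟨k, hk, hst₀⟩ := hst₃.exists_earlier (show 8 * i < 8 * i + 3 by omega)
    exact ⟨k, by omega, hst₀⟩

/-- The time of the invocation of an operation. -/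
noncomputable def opTime (e : ℕ → Option (Fin 2 × StepType α)) (x : Fin 2 × ℕ) : ℕ :=
  Classical.epsilon fun k => StepAt e x.1 (8 * x.2) k

theorem opTime_eq {x : Fin 2 × ℕ} {k : ℕ} (h : StepAt e x.1 (8 * x.2) k) : opTime e x = k :=
  StepAt.unique (Classical.epsilon_spec (p := fun k => StepAt e x.1 (8 * x.2) k) ⟨k, h⟩) h

/-- The value of the operation invoked at time `k`. -/
noncomputable def valAt (e : ℕ → Option (Fin 2 × StepType α)) (k : ℕ) : α :=
  match implHistory e k with
  | some (.inv _ v) => v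
  | _ => Classical.arbitrary α

theorem valAt_eq {k : ℕ} {p : Fin 2} {v : α} (h : (implHistory e).Invoked k p v) :
    valAt e k = v := by
  rw [History.Invoked] at h
  simp [valAt, h]

theorem invoked_opTime (he : (impl α).IsRun e) {x : Fin 2 × ℕ} {k : ℕ}
    (h : StepAt e x.1 (8 * x.2) k) :
    opTime e x = k ∧ (implHistory e).Invoked k x.1 (valAt e k) ∧ valAt e k = opVal e x.1 x.2 := by
  have hi : (implHistory e).Invoked k x.1 (opVal e x.1 x.2) :=
    (implHistory_inv_iff he).2 ⟨_, h, rfl⟩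
  rw [valAt_eq hi]
  exact ⟨opTime_eq h, hi, rfl⟩

theorem StepAt.op_unique {x y : Fin 2 × ℕ} {k s : ℕ} (hx : StepAt e x.1 (8 * x.2 + s) k)
    (hy : StepAt e y.1 (8 * y.2 + s) k) : x = y := by
  obtain ⟨⟨a, ha⟩, h₁⟩ := hx
  obtain ⟨⟨b, hb⟩, h₂⟩ := hy
  rw [ha] at hb
  simp only [Option.some.injEq, Prod.mk.injEq] at hb
  rw [hb.1] at h₁
  exact Prod.ext hb.1 (by omega)

theorem nodup_map_opTime {l : List (Fin 2 × ℕ)} (hl : l.Nodup)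
    (hinv : ∀ x ∈ l, ∃ k, StepAt e x.1 (8 * x.2) k) : (l.map (opTime e)).Nodup := by
  refine hl.map_on fun x hx y hy hxy => ?_
  obtain ⟨k, hk⟩ := hinv x hx
  obtain ⟨k', hk'⟩ := hinv y hy
  rw [opTime_eq hk, opTime_eq hk'] at hxy
  subst hxy
  exact StepAt.op_unique (s := 0) hk hk'

theorem invoked_of_mem_map (he : (impl α).IsRun e) {l : List (Fin 2 × ℕ)}
    (hinv : ∀ x ∈ l, ∃ k, StepAt e x.1 (8 * x.2) k) :
    ∀ k ∈ l.map (opTime e), ∃ p, (implHistory e).Invoked k p (valAt e k) := by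
  intro k hk
  obtain ⟨x, hx, rfl⟩ := List.mem_map.1 hk
  obtain ⟨k, hk⟩ := hinv x hx
  obtain ⟨h₁, h₂, -⟩ := invoked_opTime he hk
  rw [h₁]
  exact ⟨_, h₂⟩

theorem opResp_eq (he : (impl α).IsExecution e) {p : Fin 2} {j m : ℕ}
    (hm : StepAt e p (8 * j + 7) m) :
    opResp e p j = ((opLog e p (j + 1)).tail.map (opTime e)).map (valAt e) := by
  rw [opResp, logAfter_eq_map he hm, ← List.map_tail, List.map_map, List.map_map]
  apply List.map_congr_left
  intro x hx
  obtain ⟨k, -, hk⟩ := invoked_of_mem_opLog he hm (List.mem_of_mem_tail hx)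
  obtain ⟨h₁, -, h₂⟩ := invoked_opTime he.run hk
  simp [h₁, h₂, entry]

theorem map_opLog_succ {p : Fin 2} {j k : ℕ} (hk : StepAt e p (8 * j) k) :
    (opLog e p (j + 1)).map (opTime e) = k :: (opLog e p (j + 1)).tail.map (opTime e) := by
  conv_lhs => rw [opLog_succ, List.map_cons]
  rw [opTime_eq (x := (p, j)) hk]

/-- The log held at the return explains the response: it has no duplicates, contains all own
operations, and contains only operations invoked before the return. -/
theorem implHistory_weaklyConsistent (he : (impl α).IsExecution e) :
    WeaklyConsistent (fetchAndCons α) [] (implHistory e) := by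
  intro k m r p v hk hr
  obtain ⟨q, j, hj, hm, rfl⟩ := (implHistory_responds_iff he.run).1 hr
  obtain rfl : p = q := by
    obtain ⟨⟨a, ha⟩, -⟩ := hj
    obtain ⟨j', ⟨⟨b, hb⟩, -⟩, -⟩ := (implHistory_inv_iff he.run).1 hk
    rw [ha] at hb
    simp only [Option.some.injEq, Prod.mk.injEq] at hb
    exact hb.1.symm
  have hinv : ∀ x ∈ opLog e p (j + 1), ∃ k, StepAt e x.1 (8 * x.2) k := fun x hx => by
    obtain ⟨k, -, hk⟩ := invoked_of_mem_opLog he hm hx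
    exact ⟨k, hk⟩
  rw [opResp_eq he hm]
  apply exists_explanation
  · rw [← map_opLog_succ hj]
    exact nodup_map_opTime (nodup_opLog _ _) hinv
  · rw [← map_opLog_succ hj]
    exact invoked_of_mem_map he.run hinv
  · rw [← map_opLog_succ hj]
    intro t ht
    obtain ⟨x, hx, rfl⟩ := List.mem_map.1 ht
    obtain ⟨k', hlt, hk'⟩ := invoked_of_mem_opLog he hm hx
    rwa [opTime_eq hk']
  · intro t i ht hlt
    obtain ⟨j', hj', -⟩ := (implHistory_inv_iff he.run).1 ht
    have := (hj'.lt_iff hj).2 hlt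
    refine List.mem_map.2 ⟨(p, j'), mem_tail_opLog (mem_opLog_own.2 (by omega)) ?_,
      opTime_eq hj'⟩
    simp
    omega

/-- `tLinearizable_of_chain` for growing lists of operations of the implementation. -/
theorem tLinearizable_of_opLog (he : (impl α).IsExecution e) {Q : ℕ → List (Fin 2 × ℕ)}
    (hQ : ∀ i, Q i <:+ Q (i + 1)) (hnodup : ∀ i, (Q i).Nodup)
    (hinv : ∀ i, ∀ x ∈ Q i, ∃ k, StepAt e x.1 (8 * x.2) k)
    (hcomp : ∀ p j m, StepAt e p (8 * j + 7) m → ∃ i, (p, j) ∈ Q i) (T₀ : ℕ)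
    (hresp : ∀ p j m, StepAt e p (8 * j + 7) m → T₀ ≤ m → (∃ i, opLog e p (j + 1) <:+ Q i) ∧
      ∀ k i m₁, StepAt e p (8 * j) k → StepAt e (1 - p) (8 * i + 7) m₁ → T₀ ≤ m₁ → m₁ < k →
        (1 - p, i) ∈ opLog e p (j + 1))
    (hpend : ∀ i, ∀ x ∈ Q i, ∀ k, StepAt e x.1 (8 * x.2) k → T₀ ≤ k →
      ∃ m, StepAt e x.1 (8 * x.2 + 7) m) :
    ∃ t, TLinearizable (fetchAndCons α) [] (implHistory e) t := by
  refine tLinearizable_of_chain (val := valAt e) (Q := fun i => (Q i).map (opTime e))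
    (fun i => ?_) (fun i => nodup_map_opTime (hnodup i) (hinv i))
    (fun i => invoked_of_mem_map he.run (hinv i)) ?_ T₀ ?_ ?_
  · obtain ⟨t, ht⟩ := hQ i
    exact ⟨t.map (opTime e), by rw [← ht, List.map_append]⟩
  · intro k m r hr
    obtain ⟨p, j, hj, hm, rfl⟩ := (implHistory_responds_iff he.run).1 hr
    obtain ⟨i, hi⟩ := hcomp p j m hm
    exact ⟨i, List.mem_map.2 ⟨_, hi, opTime_eq hj⟩⟩
  · intro k m r hr hT
    obtain ⟨p, j, hj, hm, rfl⟩ := (implHistory_responds_iff he.run).1 hr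
    obtain ⟨⟨i, t, ht⟩, hmem⟩ := hresp p j m hm hT
    refine ⟨i, _, ⟨t.map (opTime e), ?_⟩, opResp_eq he hm, ?_⟩
    · rw [← map_opLog_succ hj, ← List.map_append, ht]
    · intro k₁ m₁ r₁ hr₁ hT₁ hlt
      obtain ⟨q, i', hi', hm₁, rfl⟩ := (implHistory_responds_iff he.run).1 hr₁
      refine List.mem_map.2 ⟨(q, i'), ?_, opTime_eq hi'⟩
      rcases fin_two_eq_or (p := p) (q := q) with rfl | rfl
      · have := (hm₁.lt_iff hj).2 hlt
        refine mem_tail_opLog (mem_opLog_own.2 (by omega)) ?_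
        simp
        omega
      · refine mem_tail_opLog (hmem k i' m₁ hj hm₁ hT₁ hlt) ?_
        simp [fin_two_sub_ne]
  · intro i k hk hT
    obtain ⟨x, hx, rfl⟩ := List.mem_map.1 hk
    obtain ⟨k, hk⟩ := hinv i x hx
    rw [opTime_eq hk] at hT ⊢
    obtain ⟨m, hm⟩ := hpend i x hx k hk hT
    exact ⟨m, _, (implHistory_responds_iff he.run).2 ⟨_, _, hk, hm, rfl⟩⟩

theorem exists_time_bound {p : Fin 2} (h : ¬ Active e p) : ∃ T, ∀ i k, StepAt e p i k → k < T := by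
  by_contra! hno
  exact h (exists_stepAt_of_infinite fun N => by
    obtain ⟨i, k, hk, hle⟩ := hno N
    exact ⟨k, hle, hk.1⟩)

theorem _root_.StepAt.le_time {p : Fin 2} {i k : ℕ} (h : StepAt e p i k) : i ≤ k := by
  classical
  rw [← h.2]
  exact Nat.count_le _

theorem leaderLog_invoked (he : (impl α).IsExecution e) (hact : Active e 0) :
    ∀ i, ∀ x ∈ leaderLog (seen e 0) i, ∃ k, StepAt e x.1 (8 * x.2) k := by
  intro i x hx
  rcases i with _ | i
  · simp [leaderLog] at hx
  · obtain ⟨m, hm⟩ := hact (8 * i + 7)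
    obtain ⟨k, -, hk⟩ := invoked_of_mem_opLog he hm hx
    exact ⟨k, hk⟩

theorem leaderLog_complete (he : (impl α).IsExecution e) (hact : Active e 0) :
    ∀ p j m, StepAt e p (8 * j + 7) m → ∃ i, (p, j) ∈ leaderLog (seen e 0) i := by
  intro p j m hm
  rcases fin_two_eq_or (p := 0) (q := p) with rfl | rfl
  · exact ⟨j + 1, mem_leaderLog.2 (Or.inl ⟨rfl, Nat.lt_succ_self j⟩)⟩
  · obtain ⟨k, -, hk⟩ := hm.exists_earlier (show 8 * j + 4 < 8 * j + 7 by omega)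
    obtain ⟨N, hN⟩ := eventually_lt_seen he hact hk
    exact ⟨N + 1, mem_leaderLog.2 (Or.inr
      ⟨rfl, lt_of_lt_of_le (hN N le_rfl) (le_leaderSeen_succ N)⟩)⟩

/-- The logs of process `0` are the chain; late logs of process `1` are suffixes of them, and the
real-time order is inherited from the increments. -/
theorem tLinearizable_of_active (he : (impl α).IsExecution e) (hact : ∀ p, Active e p) :
    ∃ t, TLinearizable (fetchAndCons α) [] (implHistory e) t := by
  obtain ⟨N, T₀, hN, hT₀⟩ := eventually_seen_agree he hact
  obtain ⟨N', hN'⟩ := eventually_followerLog hN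
  -- Late returns belong to operations of index at least `K`; including `T₀` makes the replies to
  -- their increments late as well.
  let K := max (max N N') T₀
  have hK : ∀ p, ∃ T, ∀ j m, StepAt e p (8 * j + 7) m → T ≤ m → K ≤ j := by
    intro p
    obtain ⟨T, hT⟩ := hact p (8 * K + 7)
    refine ⟨T, fun j m hm hle => ?_⟩
    by_contra hlt
    have := (hm.lt_iff hT).1 (by omega)
    omega
  choose T hT using hK
  have hTle : ∀ p, T p ≤ max (T 0) (T 1) := fun p => by
    rcases fin_two_eq_or (p := 0) (q := p) with rfl | rfl <;> simp
  refine tLinearizable_of_opLog he leaderLog_suffix nodup_leaderLog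
    (leaderLog_invoked he (hact 0)) (leaderLog_complete he (hact 0)) (max (T 0) (T 1)) ?_
    (fun _ x _ _ _ _ => hact x.1 _)
  intro p j m hm hmT
  have hj := hT p j m hm ((hTle p).trans hmT)
  have hseen : ∀ k i m₁, StepAt e p (8 * j) k → StepAt e (1 - p) (8 * i + 7) m₁ →
      max (T 0) (T 1) ≤ m₁ → m₁ < k → i < seen e p j := by
    intro k i m₁ hk hm₁ hmT₁ hlt
    have hi := hT _ i m₁ hm₁ ((hTle _).trans hmT₁)
    obtain ⟨m₂, hlt₂, hm₂⟩ := hm₁.exists_earlier (show 8 * i + 4 < 8 * i + 7 by omega)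
    obtain ⟨k₃, -, hk₃⟩ := hm.exists_earlier (show 8 * j + 3 < 8 * j + 7 by omega)
    have := (hk.lt_iff hk₃).1 (by omega)
    have := hm₂.le_time
    exact hT₀ p i j k₃ m₂ (by omega) hm₂ (by omega) hk₃ (by omega)
  rcases fin_two_eq_or (p := 0) (q := p) with rfl | rfl
  · refine ⟨⟨j + 1, List.suffix_rfl⟩, fun k i m₁ hk hm₁ hmT₁ hlt => ?_⟩
    exact mem_leaderLog.2 (Or.inr ⟨rfl,
      lt_of_lt_of_le (hseen k i m₁ hk hm₁ hmT₁ hlt) (le_leaderSeen_succ j)⟩)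
  · obtain ⟨h₁, h₂⟩ := hN' j (by omega)
    refine ⟨⟨_, h₁⟩, fun k i m₁ hk hm₁ hmT₁ hlt => ?_⟩
    exact mem_followerLog.2 (Or.inr ⟨rfl, lt_of_lt_of_le (hseen k i m₁ hk hm₁ hmT₁ hlt) h₂⟩)

/-- All events of process `1` come before `T`, so only responses of process `0` have to fit the
chain of its logs. -/
theorem tLinearizable_of_active_zero (he : (impl α).IsExecution e) (h₀ : Active e 0)
    (h₁ : ¬ Active e 1) : ∃ t, TLinearizable (fetchAndCons α) [] (implHistory e) t := by
  obtain ⟨T, hT⟩ := exists_time_bound h₁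
  refine tLinearizable_of_opLog he leaderLog_suffix nodup_leaderLog
    (leaderLog_invoked he h₀) (leaderLog_complete he h₀) T ?_ ?_
  · intro p j m hm hmT
    rcases fin_two_eq_or (p := 0) (q := p) with rfl | rfl
    · refine ⟨⟨j + 1, List.suffix_rfl⟩, fun k i m₁ hk hm₁ hmT₁ hlt => ?_⟩
      have := hT _ _ hm₁
      omega
    · have := hT _ _ hm
      omega
  · rintro i ⟨q, j⟩ hx k hk hkT
    rcases fin_two_eq_or (p := 0) (q := q) with rfl | rfl
    · exact h₀ _
    · have := hT _ _ hk
      omega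

theorem tLinearizable_of_active_one (he : (impl α).IsExecution e) (h₀ : ¬ Active e 0)
    (h₁ : Active e 1) : ∃ t, TLinearizable (fetchAndCons α) [] (implHistory e) t := by
  obtain ⟨T, hT⟩ := exists_time_bound h₀
  obtain ⟨β, N, hβ⟩ := eventually_seen_eq he h₁ h₀
  obtain ⟨N', hN'⟩ := eventually_followerLog_succ (a := seen e 0) hβ
  obtain ⟨T₁, hT₁⟩ := h₁ (8 * N' + 7)
  -- The chain starts at `N'`, because process `1` may still rearrange its log before.
  refine tLinearizable_of_opLog he (Q := fun i => followerLog (seen e 0) (seen e 1) (N' + i))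
    (fun i => ?_) (fun _ => nodup_followerLog _) ?_ ?_ (max T T₁) ?_ ?_
  · rw [← add_assoc, (hN' (N' + i) (by omega)).1]
    exact List.suffix_cons _ _
  · intro i x hx
    obtain ⟨m, hm⟩ := h₁ (8 * (N' + i) + 7)
    have : x ∈ opLog e 1 (N' + i + 1) := by
      rw [opLog_one, (hN' (N' + i) (by omega)).1]
      exact List.mem_cons_of_mem _ hx
    obtain ⟨k, -, hk⟩ := invoked_of_mem_opLog he hm this
    exact ⟨k, hk⟩
  · intro p j m hm
    rcases fin_two_eq_or (p := 1) (q := p) with rfl | rfl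
    · exact ⟨j + 1, mem_followerLog.2 (Or.inl ⟨rfl, by simp only; omega⟩)⟩
    · obtain ⟨k, -, hk⟩ := hm.exists_earlier (show 8 * j + 4 < 8 * j + 7 by omega)
      obtain ⟨N₂, hN₂⟩ := eventually_lt_seen he h₁ hk
      have h₁ := hN₂ (max N N₂) (le_max_right _ _)
      rw [hβ _ (le_max_left _ _)] at h₁
      have h₂ := (hN' N' le_rfl).2
      exact ⟨0, mem_followerLog.2 (Or.inr ⟨rfl, lt_of_lt_of_le h₁ h₂⟩)⟩
  · intro p j m hm hmT
    rcases fin_two_eq_or (p := 1) (q := p) with rfl | rfl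
    · refine ⟨⟨j + 1 - N', ?_⟩, fun k i m₁ hk hm₁ hmT₁ hlt => ?_⟩
      · have : N' ≤ j := by
          by_contra hlt
          have := (hm.lt_iff hT₁).1 (by omega)
          omega
        rw [show N' + (j + 1 - N') = j + 1 by omega]
        exact List.suffix_rfl
      · have := hT _ _ hm₁
        omega
    · have := hT _ _ hm
      omega
  · rintro i ⟨q, j⟩ hx k hk hkT
    rcases fin_two_eq_or (p := 1) (q := q) with rfl | rfl
    · exact h₁ _
    · have := hT _ _ hk
      omega

theorem impl_eventuallyLinearizable (α : Type) [Nonempty α] :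
    (impl α).EventuallyLinearizableImpl [] := by
  intro e he
  refine ⟨implHistory_wellFormed he.run, implHistory_weaklyConsistent he, ?_⟩
  by_cases h₀ : Active e 0
  · by_cases h₁ : Active e 1
    · refine tLinearizable_of_active he fun p => ?_
      rcases fin_two_eq_or (p := 0) (q := p) with rfl | rfl
      · exact h₀
      · exact h₁
    · exact tLinearizable_of_active_zero he h₀ h₁
  · by_cases h₁ : Active e 1
    · exact tLinearizable_of_active_one he h₀ h₁
    · obtain ⟨T, hT⟩ := exists_time_bound h₀
      obtain ⟨T', hT'⟩ := exists_time_bound h₁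
      refine tLinearizable_of_finite (T₀ := max T T') (val := valAt e) ?_ ?_
      · intro k m r hr
        obtain ⟨p, j, -, hm, -⟩ := (implHistory_responds_iff he.run).1 hr
        rcases fin_two_eq_or (p := 0) (q := p) with rfl | rfl
        · have := hT _ _ hm
          omega
        · have := hT' _ _ hm
          omega
      · intro k p v hk
        exact (valAt_eq hk).symm

end TwoProcess

theorem waitFreeEventuallyImplements_two (α : Type) [Primcodable α] [Nonempty α] :
    WaitFreeEventuallyImplements 2 fetchAndAdd (fetchAndCons α) :=
  ⟨Unit, Fin 2 × ℕ, List (Fin 2 × α), TwoProcess.Memory α, inferInstance, inferInstance,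
    inferInstance, inferInstance, TwoProcess.impl α, [], rfl, TwoProcess.impl_isComputable,
    TwoProcess.impl_waitFree α, TwoProcess.impl_eventuallyLinearizable α⟩

theorem theorem16 (α : Type) [Primcodable α] [Nontrivial α] :
    IsEventualConsensusNumber α fetchAndAdd 2 := by
  refine ⟨waitFreeEventuallyImplements_two α, fun n hn => ?_⟩
  by_contra hlt
  exact not_waitFreeEventuallyImplements_of_three_le (by omega) hn
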